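/- Let $\mathbb{D}$ be the open unit disc and $dA$ the area measure. A radial weight is $\omega(z)=\omega(|z|)$ with $0\le\omega\in L^1([0,1))$; put $\widehat\omega(z)=\int_{|z|}^1\omega(s)\,ds$, and assume throughout that $\widehat\omega>0$ on $\mathbb{D}$. Write $\omega\in\mathcal{D}$ if there are constants $C\ge1$ and $K,C'>1$ with $\widehat\omega(r)\le C\,\widehat\omega\big(\tfrac{1+r}{2}\big)$ and $\widehat\omega(r)\ge C'\,\widehat\omega\big(1-\tfrac{1-r}{K}\big)$ for all $0\le r<1$. For a measure $\nu$ on $\mathbb{D}$ let $\|f\|_{L^p_\nu}=\big(\int_{\mathbb{D}}|f|^p\,d\nu\big)^{1/p}$, and for a non-negative function $w$ let $L^p_w$ denote $L^p_\nu$ with $d\nu=w\,dA$. Let $A^p_\omega$ be the space of analytic functions on $\mathbb{D}$ that belong to $L^p_\omega$, with the norm of $L^p_\omega$. Let $\widetilde\omega(z)=\widehat\omega(z)/(1-|z|)$, let $\Delta(z,r)=\{\zeta\in\mathbb{D}:|(z-\zeta)/(1-\overline z\zeta)|<r\}$ be the pseudohyperbolic disc, let $S(z)=\{\zeta:|z|<|\zeta|<1,\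 |\arg\zeta-\arg z|<(1-|z|)/2\}$ (the difference of arguments taken modulo $2\pi$), and let $\omega(E)=\int_E\omega\,dA$. **Theorem.** Let $0<q<p<\infty$ and $\omega\in\mathcal{D}$, and let $\mu$ be a positive Borel measure on $\mathbb{D}$. Then the following statements are equivalent: (i) $\mu$ is a $q$-Carleson measure for $A^p_\omega$, that is, the identity operator $I:A^p_\omega\to L^q_\mu$ is bounded; (ii) $I:A^p_\omega\to L^q_\mu$ is compact, that is, it maps every bounded sequence to a sequence with a subsequence converging in $L^q_\mu$; (iii) for some $r\in(0,1)$, the function $\Theta_r(z)=\mu(\Delta(z,r))/\omega(S(z))$, $z\in\mathbb{D}\setminus\{0\}$, belongs to $L^{p/(p-q)}_{\widetilde\omega}$; (iv) for every $r\in(0,1)$, the function $\Theta_r$ belongs to $L^{p/(p-q)}_{\widetilde\omega}$. Moreover, for every $r\in(0,1)$ there is a constant $C=C(p,q,\omega,r)>0$, independent of $\mu$, such that $$C^{-1}\,\|\Theta_r\|_{L^{p/(p-q)}_{\widetilde\omega}}\le\|I\|^q_{A^p_\omega\to L^q_\mu}\le C\,\|\Theta_r\|_{L^{p/(p-q)}_{\widetilde\omega}},$$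 where both quantities are allowed to be infinite (and $\|I\|=\infty$ if $I$ is not bounded). -/

import Mathlib

open MeasureTheory Set Filter Topology
open scoped NNReal ENNReal ComplexConjugate

noncomputable section

namespace DoublingBergman

/-- The open unit disc of the complex plane. -/
def disc : Set ℂ := Metric.ball 0 1

/-- The tail integral `ω̂(r) = ∫_r^1 ω(s) ds`; on the disc it is evaluated at `r = ‖z‖`. -/
def hat (ω : ℝ → ℝ) (r : ℝ) : ℝ := ∫ s in r..1, ω s

/-- A radial weight, given by its profile on `[0, 1)`: nonnegative, integrable on `[0, 1)`, and
with strictly positive tail integrals. -/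
structure IsRadialWeight (ω : ℝ → ℝ) : Prop where
  nonneg : ∀ r ∈ Ico (0 : ℝ) 1, 0 ≤ ω r
  integrable : IntegrableOn ω (Ico (0 : ℝ) 1)
  hat_pos : ∀ r ∈ Ico (0 : ℝ) 1, 0 < hat ω r

/-- The upper doubling condition. -/
def UpperDoubling (ω : ℝ → ℝ) : Prop :=
  ∃ C : ℝ, 1 ≤ C ∧ ∀ r ∈ Ico (0 : ℝ) 1, hat ω r ≤ C * hat ω ((1 + r) / 2)

/-- The lower (reverse) doubling condition. -/
def LowerDoubling (ω : ℝ → ℝ) : Prop :=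
  ∃ K C : ℝ, 1 < K ∧ 1 < C ∧ ∀ r ∈ Ico (0 : ℝ) 1, C * hat ω (1 - (1 - r) / K) ≤ hat ω r

/-- The class `𝒟` of two-sided doubling radial weights. -/
structure ClassD (ω : ℝ → ℝ) : Prop where
  weight : IsRadialWeight ω
  upper : UpperDoubling ω
  lower : LowerDoubling ω

/-- The measure `w dA` on the unit disc, where `dA` is the area measure. -/
def weighted (w : ℂ → ℝ) : Measure ℂ :=
  (volume.restrict disc).withDensity fun z => ENNReal.ofReal (w z)

/-- The measure `ω(|z|) dA(z)` on the unit disc induced by a radial weight. -/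
def radialMeasure (ω : ℝ → ℝ) : Measure ℂ := weighted fun z => ω ‖z‖

/-- The auxiliary weight `ω̃(z) = ω̂(z) / (1 - |z|)`. -/
def tilde (ω : ℝ → ℝ) (z : ℂ) : ℝ := hat ω ‖z‖ / (1 - ‖z‖)

/-- The weighted Bergman space `A^p_ω`: functions analytic in the disc that lie in `L^p_ω`. -/
def Bergman (p : ℝ) (ω : ℝ → ℝ) : Set (ℂ → ℂ) :=
  {f | DifferentiableOn ℂ f disc ∧ MemLp f (ENNReal.ofReal p) (radialMeasure ω)}

/-- The (quasi-)norm of `A^p_ω`. -/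
def bergmanNorm (p : ℝ) (ω : ℝ → ℝ) (f : ℂ → ℂ) : ℝ≥0∞ :=
  eLpNorm f (ENNReal.ofReal p) (radialMeasure ω)

/-- `μ` is a `q`-Carleson measure for `A^p_ω`: the identity operator maps `A^p_ω` boundedly
into `L^q_μ`. -/
def IsCarleson (p q : ℝ) (ω : ℝ → ℝ) (μ : Measure ℂ) : Prop :=
  ∃ C : ℝ≥0, ∀ f ∈ Bergman p ω,
    MemLp f (ENNReal.ofReal q) μ ∧ eLpNorm f (ENNReal.ofReal q) μ ≤ C * bergmanNorm p ω f

/-- The identity operator from `A^p_ω` to `L^q_μ` is (well defined and) compact: the image of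
every bounded sequence has a subsequence that converges in `L^q_μ`. -/
def IsCompactEmbedding (p q : ℝ) (ω : ℝ → ℝ) (μ : Measure ℂ) : Prop :=
  (∀ f ∈ Bergman p ω, MemLp f (ENNReal.ofReal q) μ) ∧
  ∀ f : ℕ → ℂ → ℂ, (∀ n, f n ∈ Bergman p ω) →
    (∃ M : ℝ≥0, ∀ n, bergmanNorm p ω (f n) ≤ M) →
    ∃ φ : ℕ → ℕ, StrictMono φ ∧ ∃ g : ℂ → ℂ, MemLp g (ENNReal.ofReal q) μ ∧
      Tendsto (fun n => eLpNorm (fun z => f (φ n) z - g z) (ENNReal.ofReal q) μ) atTop (𝓝 0)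

/-- The operator (quasi-)norm of the identity from `A^p_ω` to `L^q_μ`, infinite if unbounded. -/
def embeddingNorm (p q : ℝ) (ω : ℝ → ℝ) (μ : Measure ℂ) : ℝ≥0∞ :=
  ⨆ f ∈ {f | f ∈ Bergman p ω ∧ bergmanNorm p ω f ≤ 1}, eLpNorm f (ENNReal.ofReal q) μ

/-- The pseudohyperbolic disc `Δ(a, r)`. -/
def pseudoDisc (a : ℂ) (r : ℝ) : Set ℂ :=
  {z | z ∈ disc ∧ ‖(a - z) / (1 - conj a * z)‖ < r}

/-- The Carleson square `S(z)`; `arg (ζ / z)` is the difference of the arguments, reduced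
modulo `2π` to `(-π, π]`. -/
def carlesonSquare (z : ℂ) : Set ℂ :=
  {ζ | ‖z‖ < ‖ζ‖ ∧ ‖ζ‖ < 1 ∧ |Complex.arg (ζ / z)| < (1 - ‖z‖) / 2}

/-- The averaging function `Θ(z) = μ(Δ(z, r)) / ω(S(z))`, with values in `[0, ∞]`. Its value at
the single point `z = 0` is immaterial. -/
def Theta (ω : ℝ → ℝ) (μ : Measure ℂ) (r : ℝ) (z : ℂ) : ℝ≥0∞ :=
  μ (pseudoDisc z r) / radialMeasure ω (carlesonSquare z)

end DoublingBergman

end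

noncomputable section

namespace DoublingBergman

/-! ### Power forms of the doubling conditions -/

section

namespace IsRadialWeight

variable {ω : ℝ → ℝ}

/-! At the hyperbolic scale the weight is described by one quantity, `(1 - |b|) ω̂(b)`, which is
comparable to the mass of the Carleson square at `b`. Iterating the two doubling conditions bounds
`ω̂(s) / ω̂(a)` by `x ^ γ + x ^ β` up to a constant, where `x = (1 - s) / (1 - a)` and `0 < γ ≤ β`
(`ClassD.exists_hat_le`). Hence `ω̂` is essentially constant on hyperbolic discs, and integrals of
kernels against `ω̃` reduce to classical Forelli–Rudin estimates.

The weight `ω` may vanish on large sets, so local averages are taken against `ω̃` instead. This is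
legitimate for analytic functions: their integral means grow with the radius, so only the tails of a
radial weight matter for the norm up to constants, and the tails of `ω` and `ω̃` are comparable
(`ClassD.exists_lintegral_tilde_le`, `ClassD.exists_lintegral_le_tilde`).

Sufficiency: `|f|^q` is subharmonic, so on a small Whitney ball it is at most its area average over
a slightly larger one. Integrating in `μ` and summing over a lattice gives `∫ |f|^q dμ ≲ ∫ |f|^q Θ_r
ω̃ dA`. Hölder with exponents `p/q` and `p/(p-q)` then bounds the embedding by the norm of `Θ_r`
(`ClassD.exists_lintegral_le_mul`).

Necessity: the test functions are `∑ ± a_b ((1-|b|) ω̂(b))^(-1/p) ((1-|b|)/(1 - b̄z))^m` over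
lattice points `b`. For `m` large their `A^p_ω` norms are bounded by the `ℓ^p` norm of the
coefficients, whatever the signs (`ClassD.exists_test_bound`). Summing the embedding inequality over
all signs isolates the contribution of each `b` on its hyperbolic neighbourhood
(`ClassD.exists_sum_nearSet_le`). Duality between `ℓ^(p/q)` and `ℓ^(p/(p-q))` turns this into a
bound for a discrete `L^(p/(p-q))` norm of `μ(neighbourhood) / mass`, which dominates that of `Θ_r`
(`ClassD.exists_lintegral_Theta_le`).

Sufficiency starts from a single `r` and necessity reaches every `r`, so independence of `r` follows
by passing through the embedding norm. For compactness, the sufficiency estimate is applied to the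
part of `μ` near the unit circle. Its averaging function tends to zero in norm by dominated
convergence, while Montel's theorem handles compact subsets. Conversely, a compact embedding is
bounded. -/

theorem intervalIntegrable (h : IsRadialWeight ω) {r t : ℝ} (hr : 0 ≤ r) (hrt : r ≤ t)
    (ht : t ≤ 1) : IntervalIntegrable ω volume r t := by
  rw [intervalIntegrable_iff_integrableOn_Ico_of_le hrt]
  exact h.integrable.mono_set (Ico_subset_Ico hr ht)

theorem hat_eq_add (h : IsRadialWeight ω) {r t : ℝ} (hr : 0 ≤ r) (hrt : r ≤ t) (ht : t ≤ 1) :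
    hat ω r = (∫ s in r..t, ω s) + hat ω t :=
  (intervalIntegral.integral_add_adjacent_intervals (h.intervalIntegrable hr hrt ht)
    (h.intervalIntegrable (hr.trans hrt) ht le_rfl)).symm

theorem hat_anti (h : IsRadialWeight ω) {r t : ℝ} (hr : 0 ≤ r) (hrt : r ≤ t) (ht : t < 1) :
    hat ω t ≤ hat ω r := by
  rw [h.hat_eq_add hr hrt ht.le]
  have : 0 ≤ ∫ s in r..t, ω s :=
    intervalIntegral.integral_nonneg hrt fun s hs => h.nonneg s ⟨hr.trans hs.1, hs.2.trans_lt ht⟩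
  linarith

theorem continuousOn_hat (h : IsRadialWeight ω) : ContinuousOn (hat ω) (Ico 0 1) := by
  have h3 : hat ω = fun r => - ∫ s in (1 : ℝ)..r, ω s := by
    ext r
    rw [hat, intervalIntegral.integral_symm]
  have h4 := intervalIntegral.continuousOn_primitive_interval' (μ := volume) (f := ω) (a := 1)
    (b₁ := 0) (b₂ := 1) (h.intervalIntegrable le_rfl zero_le_one le_rfl)
    (by simp)
  rw [h3]
  exact (h4.mono (by rw [uIcc_of_le zero_le_one]; exact Ico_subset_Icc_self)).neg

end IsRadialWeight

theorem one_sub_div_mem {r K : ℝ} (hr : r ∈ Ico (0 : ℝ) 1) (hK : 1 ≤ K) :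
    1 - (1 - r) / K ∈ Ico (0 : ℝ) 1 := by
  have h1 : 0 < 1 - r := by linarith [hr.2]
  have h2 : (1 - r) / K ≤ 1 - r := div_le_self h1.le hK
  have h3 : 0 < (1 - r) / K := by positivity
  exact ⟨by linarith [hr.1], by linarith⟩

/-- Power form of the upper doubling condition. -/
theorem ClassD.upper_power {ω : ℝ → ℝ} (h : ClassD ω) : ∃ C β : ℝ, 0 < C ∧ 0 < β ∧
    ∀ r t : ℝ, 0 ≤ r → r ≤ t → t < 1 → hat ω r ≤ C * ((1 - r) / (1 - t)) ^ β * hat ω t := by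
  obtain ⟨C₁, hC₁, hup⟩ := h.upper
  -- Enlarging the constant makes it strictly greater than 1, hence the exponent `logb 2 C`
  -- positive.
  set C := C₁ + 1
  have hC : 1 < C := by simp only [C]; linarith
  have hup' : ∀ r ∈ Ico (0 : ℝ) 1, hat ω r ≤ C * hat ω (1 - (1 - r) / 2) := by
    intro r hr
    have := h.weight.hat_pos _ (one_sub_div_mem hr one_le_two)
    have h2 := hup r hr
    rw [show (1 + r) / 2 = 1 - (1 - r) / 2 by ring] at h2
    simp only [C]
    linarith
  have iter : ∀ n : ℕ, ∀ r ∈ Ico (0 : ℝ) 1, hat ω r ≤ C ^ n * hat ω (1 - (1 - r) / 2 ^ n) := by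
    intro n
    induction n with
    | zero => intro r _; simp
    | succ n ih =>
      intro r hr
      refine (ih r hr).trans ?_
      rw [pow_succ, mul_assoc]
      gcongr
      have := hup' _ (one_sub_div_mem hr (one_le_pow₀ one_le_two (n := n)))
      rwa [show 1 - (1 - (1 - (1 - r) / 2 ^ n)) / 2 = 1 - (1 - r) / (2 ^ n * 2) by
        rw [← div_div]; ring] at this
  refine ⟨C, Real.logb 2 C, by linarith, Real.logb_pos (by norm_num) hC, fun r t hr hrt ht => ?_⟩
  have h1t : 0 < 1 - t := by linarith
  have h1r : 0 < 1 - r := by linarith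
  set x := (1 - r) / (1 - t)
  have hx : 1 ≤ x := by rw [one_le_div h1t]; linarith
  have hx0 : 0 < x := by linarith
  -- Enough halvings of `1 - r` to reach or pass `t`; rounding up costs one extra factor `C`.
  set n := ⌈Real.logb 2 x⌉₊
  have hlog : 0 ≤ Real.logb 2 x := Real.logb_nonneg (by norm_num) hx
  have hn1 : Real.logb 2 x ≤ n := Nat.le_ceil _
  have hn2 : (n : ℝ) < Real.logb 2 x + 1 := Nat.ceil_lt_add_one hlog
  have hxn : x ≤ 2 ^ n := by
    rw [Real.logb_le_iff_le_rpow (by norm_num) hx0] at hn1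
    simpa using hn1
  have hrn := one_sub_div_mem ⟨hr, hrt.trans_lt ht⟩ (one_le_pow₀ one_le_two (n := n) (M₀ := ℝ))
  have htn : t ≤ 1 - (1 - r) / 2 ^ n := by
    have : (1 - r) / 2 ^ n ≤ 1 - t := by
      rw [div_le_iff₀ (by positivity)]
      rw [div_le_iff₀ h1t] at hxn
      linarith
    linarith
  have hpos := h.weight.hat_pos t ⟨hr.trans hrt, ht⟩
  calc hat ω r ≤ C ^ n * hat ω (1 - (1 - r) / 2 ^ n) := iter n r ⟨hr, hrt.trans_lt ht⟩
    _ ≤ C ^ n * hat ω t := by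
      gcongr
      exact h.weight.hat_anti (hr.trans hrt) htn hrn.2
    _ ≤ C * x ^ Real.logb 2 C * hat ω t := by
      gcongr
      calc C ^ n = C ^ (n : ℝ) := by simp
        _ ≤ C ^ (Real.logb 2 x + 1) := Real.rpow_le_rpow_of_exponent_le hC.le hn2.le
        _ = C * C ^ Real.logb 2 x := by rw [Real.rpow_add_one (by linarith)]; ring
        _ = C * x ^ Real.logb 2 C := by
          congr 1
          rw [Real.rpow_def_of_pos (by linarith), Real.rpow_def_of_pos hx0, Real.logb, Real.logb]
          congr 1
          ring

/-- Power form of the lower doubling condition. -/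
theorem ClassD.lower_power {ω : ℝ → ℝ} (h : ClassD ω) : ∃ C γ : ℝ, 0 < C ∧ 0 < γ ∧
    ∀ r t : ℝ, 0 ≤ r → r ≤ t → t < 1 → hat ω t ≤ C * ((1 - t) / (1 - r)) ^ γ * hat ω r := by
  obtain ⟨K, C, hK, hC, hlow⟩ := h.lower
  have iter : ∀ n : ℕ, ∀ r ∈ Ico (0 : ℝ) 1, C ^ n * hat ω (1 - (1 - r) / K ^ n) ≤ hat ω r := by
    intro n
    induction n with
    | zero => intro r _; simp
    | succ n ih =>
      intro r hr
      refine le_trans ?_ (ih r hr)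
      rw [pow_succ, mul_assoc]
      gcongr
      have := hlow _ (one_sub_div_mem hr (one_le_pow₀ hK.le (n := n)))
      rwa [show 1 - (1 - (1 - (1 - r) / K ^ n)) / K = 1 - (1 - r) / (K ^ n * K) by
        rw [← div_div]; ring] at this
  refine ⟨C, Real.logb K C, by linarith, Real.logb_pos hK hC, fun r t hr hrt ht => ?_⟩
  have h1t : 0 < 1 - t := by linarith
  have h1r : 0 < 1 - r := by linarith
  set x := (1 - r) / (1 - t)
  have hx : 1 ≤ x := by rw [one_le_div h1t]; linarith
  have hx0 : 0 < x := by linarith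
  -- Rounded down, so that the `n`-th iterate stays to the left of `t`; the lost fraction of a step
  -- is again paid by one factor `C`.
  set n := ⌊Real.logb K x⌋₊
  have hlog : 0 ≤ Real.logb K x := Real.logb_nonneg hK hx
  have hn1 : n ≤ Real.logb K x := Nat.floor_le hlog
  have hn2 : Real.logb K x < n + 1 := Nat.lt_floor_add_one _
  have hxn : K ^ n ≤ x := by
    rw [Real.le_logb_iff_rpow_le hK hx0] at hn1
    simpa using hn1
  have hrn := one_sub_div_mem ⟨hr, hrt.trans_lt ht⟩ (one_le_pow₀ hK.le (n := n))
  have htn : 1 - (1 - r) / K ^ n ≤ t := by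
    have : 1 - t ≤ (1 - r) / K ^ n := by
      rw [le_div_iff₀ (by positivity)]
      rw [le_div_iff₀ h1t] at hxn
      linarith
    linarith
  have hinv : (1 - t) / (1 - r) = x⁻¹ := by simp [x]
  have h1 : C ^ n * hat ω t ≤ hat ω r :=
    le_trans (by gcongr; exact h.weight.hat_anti hrn.1 htn ht) (iter n r ⟨hr, hrt.trans_lt ht⟩)
  have hxp : x ^ Real.logb K C ≤ C ^ n * C := by
    calc x ^ Real.logb K C = C ^ Real.logb K x := by
          rw [Real.rpow_def_of_pos (by linarith), Real.rpow_def_of_pos (by linarith),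
            Real.logb, Real.logb]
          congr 1
          ring
      _ ≤ C ^ ((n : ℝ) + 1) := Real.rpow_le_rpow_of_exponent_le hC.le hn2.le
      _ = C ^ n * C := by rw [Real.rpow_add_one (by linarith)]; simp
  have hpos := h.weight.hat_pos t ⟨hr.trans hrt, ht⟩
  rw [hinv, Real.inv_rpow hx0.le, mul_assoc, mul_comm, mul_assoc, inv_mul_eq_div,
    le_div_iff₀ (by positivity)]
  calc hat ω t * x ^ Real.logb K C ≤ hat ω t * (C ^ n * C) := by gcongr
    _ = (C ^ n * hat ω t) * C := by ring
    _ ≤ hat ω r * C := by gcongr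

/-- The tail integral at `s` is controlled by the one at `a`, with two different powers according
to the position of `s` relative to `a`. -/
theorem ClassD.exists_hat_le {ω : ℝ → ℝ} (h : ClassD ω) : ∃ C γ β : ℝ, 0 < C ∧ 0 < γ ∧ γ ≤ β ∧
    ∀ s ∈ Ico (0 : ℝ) 1, ∀ a ∈ Ico (0 : ℝ) 1,
      hat ω s ≤ C * hat ω a * (((1 - s) / (1 - a)) ^ γ + ((1 - s) / (1 - a)) ^ β) := by
  obtain ⟨C₁, β, hC₁, hβ, h₁⟩ := h.upper_power
  obtain ⟨C₂, γ, hC₂, hγ, h₂⟩ := h.lower_power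
  -- The exponent `β` matters only for `s ≤ a`, where the base is at least 1, so it may be raised to
  -- secure `γ ≤ β`.
  refine ⟨C₁ + C₂, γ, max β γ, by positivity, hγ, le_max_right _ _, fun s hs a ha => ?_⟩
  have h1s : 0 < 1 - s := by linarith [hs.2]
  have h1a : 0 < 1 - a := by linarith [ha.2]
  have hpos := h.weight.hat_pos a ha
  have hx : 0 < (1 - s) / (1 - a) := by positivity
  rcases le_total s a with hsa | hsa
  · calc hat ω s ≤ C₁ * ((1 - s) / (1 - a)) ^ β * hat ω a := h₁ s a hs.1 hsa ha.2
      _ ≤ C₁ * ((1 - s) / (1 - a)) ^ max β γ * hat ω a := by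
        gcongr
        · rw [one_le_div h1a]; linarith
        · exact le_max_left _ _
      _ = C₁ * hat ω a * (0 + ((1 - s) / (1 - a)) ^ max β γ) := by ring
      _ ≤ _ := by gcongr <;> first | positivity | linarith
  · calc hat ω s ≤ C₂ * ((1 - s) / (1 - a)) ^ γ * hat ω a := h₂ a s ha.1 hsa hs.2
      _ = C₂ * hat ω a * (((1 - s) / (1 - a)) ^ γ + 0) := by ring
      _ ≤ _ := by gcongr <;> first | positivity | linarith

end

/-! ### Polar coordinates, radial weights and the mass of Carleson squares -/

theorem measurableSet_disc : MeasurableSet disc := measurableSet_ball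

theorem mem_disc {z : ℂ} : z ∈ disc ↔ ‖z‖ < 1 := by simp [disc]

theorem setLIntegral_Ioi_indicator_Iio {a b : ℝ} (g : ℝ → ℝ≥0∞) :
    ∫⁻ s in Ioi a, (Iio b).indicator g s = ∫⁻ s in Ioo a b, g s := by
  rw [lintegral_indicator measurableSet_Iio, Measure.restrict_restrict measurableSet_Iio]
  congr 2
  ext s
  simp [and_comm]

theorem setLIntegral_Ioo_indicator_Ioi {a b c : ℝ} (hab : a ≤ b) (g : ℝ → ℝ≥0∞) :
    ∫⁻ s in Ioo a c, (Ioi b).indicator g s = ∫⁻ s in Ioo b c, g s := by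
  rw [lintegral_indicator measurableSet_Ioi, Measure.restrict_restrict measurableSet_Ioi]
  congr 2
  ext s
  simp only [mem_inter_iff, mem_Ioi, mem_Ioo]
  exact ⟨fun h => ⟨h.1, h.2.2⟩, fun h => ⟨h.1, hab.trans_lt h.1, h.2⟩⟩

/-- Integration in polar coordinates over a ball centred at the origin. -/
theorem lintegral_ball_eq_polar {R : ℝ} {f : ℂ → ℝ≥0∞}
    (hf : Measurable ((Metric.ball 0 R).indicator f)) :
    ∫⁻ z in Metric.ball 0 R, f z =
      ∫⁻ s in Ioo 0 R, ENNReal.ofReal s * ∫⁻ θ in Ioo (-Real.pi) Real.pi, f (circleMap 0 s θ) := by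
  have key : ∀ p : ℝ × ℝ, Complex.polarCoord.symm p = circleMap 0 p.1 p.2 := fun p => by
    rw [Complex.polarCoord_symm_apply, circleMap, Complex.exp_mul_I]
    push_cast
    ring
  have hcm : Measurable fun p : ℝ × ℝ => circleMap 0 p.1 p.2 := by
    unfold circleMap
    fun_prop
  rw [← lintegral_indicator measurableSet_ball, ← Complex.lintegral_comp_polarCoord_symm,
    polarCoord_target, Measure.volume_eq_prod, ← Measure.prod_restrict, lintegral_prod]
  · simp only [key, smul_eq_mul]
    rw [← setLIntegral_Ioi_indicator_Iio]
    refine setLIntegral_congr_fun measurableSet_Ioi fun s (hs : 0 < s) => ?_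
    by_cases hsR : s < R
    · simp only [indicator, mem_Iio, hsR, if_true, Metric.mem_ball, dist_zero_right,
        norm_circleMap_zero, abs_of_pos hs]
      rw [lintegral_const_mul' _ _ ENNReal.ofReal_ne_top]
    · simp [indicator, hsR, abs_of_pos hs]
  · apply Measurable.aemeasurable
    simp only [key, smul_eq_mul]
    exact (ENNReal.measurable_ofReal.comp measurable_fst).mul (hf.comp hcm)

theorem lintegral_weighted {w : ℂ → ℝ} (hw : AEMeasurable w (volume.restrict disc))
    (g : ℂ → ℝ≥0∞) : ∫⁻ z, g z ∂(weighted w) = ∫⁻ z in disc, ENNReal.ofReal (w z) * g z := by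
  rw [weighted, lintegral_withDensity_eq_lintegral_mul_non_measurable₀ _ hw.ennreal_ofReal
    (by simp)]
  rfl

theorem lintegral_disc_rotate {u : ℂ} (hu : ‖u‖ = 1) (f : ℂ → ℝ≥0∞) :
    ∫⁻ z in disc, f (u * z) = ∫⁻ z in disc, f z := by
  let e := rotation (⟨u, by simp [Submonoid.unitSphere, hu]⟩ : Circle)
  have he : ∀ z, e z = u * z := fun z => rfl
  have h := (e.measurePreserving).setLIntegral_comp_preimage_emb
    e.toHomeomorph.measurableEmbedding f disc
  rw [← h]
  have : e ⁻¹' disc = disc := by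
    ext z
    simp [mem_disc, he, hu]
  rw [this]
  rfl

/-- A radial weight may be assumed Borel measurable and nonnegative. -/
theorem IsRadialWeight.exists_measurable {ω : ℝ → ℝ} (h : IsRadialWeight ω) :
    ∃ ω' : ℝ → ℝ, Measurable ω' ∧ (∀ s, 0 ≤ ω' s) ∧
      ω' =ᵐ[volume.restrict (Ico (0 : ℝ) 1)] ω := by
  have hm := h.integrable.aestronglyMeasurable.aemeasurable
  refine ⟨fun s => max (hm.mk ω s) 0, hm.measurable_mk.max measurable_const,
    fun s => le_max_right _ _, ?_⟩
  filter_upwards [hm.ae_eq_mk, ae_restrict_mem measurableSet_Ico] with s hs hs'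
  rw [← hs, max_eq_left (h.nonneg s hs')]

theorem hat_congr {ω ω' : ℝ → ℝ} (h : ω' =ᵐ[volume.restrict (Ico (0 : ℝ) 1)] ω) {r : ℝ}
    (hr : r ∈ Ico (0 : ℝ) 1) : hat ω' r = hat ω r := by
  apply intervalIntegral.integral_congr_ae_restrict
  rw [uIoc_of_le hr.2.le, ← restrict_Ioo_eq_restrict_Ioc]
  have hsub : Ioo r 1 ⊆ Ico 0 1 := fun x hx => ⟨hr.1.trans hx.1.le, hx.2⟩
  exact ae_restrict_of_ae_restrict_of_subset hsub h

/-- In polar coordinates the preimage of a null set of radii has zero area. This is what lets the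
profile be changed on a null set without changing the measures on the disc. -/
theorem ae_norm_of_ae {P : ℝ → Prop} (h : ∀ᵐ s ∂volume.restrict (Ico (0 : ℝ) 1), P s) :
    ∀ᵐ z ∂volume.restrict disc, P ‖z‖ := by
  set N := toMeasurable (volume.restrict (Ico (0 : ℝ) 1)) {s | ¬ P s}
  have hN : MeasurableSet N := measurableSet_toMeasurable _ _
  have hN0 : volume.restrict (Ico (0 : ℝ) 1) N = 0 := by
    rw [measure_toMeasurable]; exact h
  have hsub : {s | ¬ P s} ⊆ N := subset_toMeasurable _ _
  have h1 : volume.restrict disc (norm ⁻¹' N : Set ℂ) = 0 := by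
    have hmN : MeasurableSet (norm ⁻¹' N : Set ℂ) := measurable_norm hN
    rw [← lintegral_indicator_one hmN, disc, lintegral_ball_eq_polar
      ((measurable_one.indicator hmN).indicator measurableSet_ball)]
    have : ∀ᵐ s ∂volume.restrict (Ioo (0 : ℝ) 1), s ∉ N :=
      ae_restrict_of_ae_restrict_of_subset Ioo_subset_Ico_self
        (measure_eq_zero_iff_ae_notMem.mp hN0)
    refine (lintegral_congr_ae (g := fun _ => 0) ?_).trans lintegral_zero
    filter_upwards [this, ae_restrict_mem measurableSet_Ioo] with s hs hs'
    simp [indicator, hs, abs_of_pos hs'.1]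
  refine measure_mono_null (fun z hz => hsub hz) h1

theorem weighted_congr {w w' : ℂ → ℝ} (h : w =ᵐ[volume.restrict disc] w') :
    weighted w = weighted w' :=
  withDensity_congr_ae (h.mono fun z hz => by simp only [hz])

theorem radialMeasure_congr {ω ω' : ℝ → ℝ} (h : ω' =ᵐ[volume.restrict (Ico (0 : ℝ) 1)] ω) :
    radialMeasure ω' = radialMeasure ω :=
  weighted_congr (ae_norm_of_ae h)

/-- The `ω`-measure of a Carleson square. -/
theorem radialMeasure_carlesonSquare {ω : ℝ → ℝ} (hω : Measurable ω) {z : ℂ} (hz : z ≠ 0)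
    (hz1 : ‖z‖ < 1) : radialMeasure ω (carlesonSquare z) =
      ENNReal.ofReal (1 - ‖z‖) * ∫⁻ s in Ioo ‖z‖ 1, ENNReal.ofReal s * ENNReal.ofReal (ω s) := by
  have hS : MeasurableSet (carlesonSquare z) :=
    (measurableSet_lt measurable_const measurable_norm).inter
      ((measurableSet_lt measurable_norm measurable_const).inter
        (measurableSet_lt (measurable_norm.comp
          (Complex.measurable_arg.comp (measurable_id.div_const z))) measurable_const))
  have hz0 : 0 < ‖z‖ := norm_pos_iff.2 hz
  -- Rotating by `u` moves the square to the positive real axis, where `arg (ζ / z)` is the polar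
  -- angle and the square becomes a rectangle in `(s, θ)`.
  set u : ℂ := z / ‖z‖
  have hu : ‖u‖ = 1 := by simp [u, hz]
  have hmem : ∀ s ∈ Ioo (0 : ℝ) 1, ∀ θ ∈ Ioo (-Real.pi) Real.pi,
      (u * circleMap 0 s θ ∈ carlesonSquare z ↔ ‖z‖ < s ∧ |θ| < (1 - ‖z‖) / 2) := by
    intro s hs θ hθ
    have h1 : u * circleMap 0 s θ / z = ((‖z‖⁻¹ * s : ℝ) : ℂ) * Complex.exp (θ * Complex.I) := by
      have : (‖z‖ : ℂ) ≠ 0 := by exact_mod_cast hz0.ne'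
      simp only [u, circleMap, zero_add]
      push_cast
      field_simp
    have h2 : Complex.arg (u * circleMap 0 s θ / z) = θ := by
      rw [h1, Complex.arg_real_mul _ (mul_pos (inv_pos.2 hz0) hs.1), Complex.arg_exp_mul_I,
        toIocMod_eq_self]
      exact ⟨hθ.1, by linarith [hθ.2]⟩
    simp only [carlesonSquare, mem_ofPred_eq, h2, norm_mul, hu, norm_circleMap_zero, one_mul,
      abs_of_pos hs.1, hs.2, true_and]
  have hωm : Measurable fun ζ : ℂ => ENNReal.ofReal (ω ‖ζ‖) :=
    (hω.comp measurable_norm).ennreal_ofReal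
  rw [← lintegral_indicator_one hS, radialMeasure,
    lintegral_weighted (w := fun z => ω ‖z‖) (hω.comp measurable_norm).aemeasurable, ← lintegral_disc_rotate hu,
    disc, lintegral_ball_eq_polar]
  · rw [← setLIntegral_Ioo_indicator_Ioi hz0.le, ← lintegral_const_mul' _ _ ENNReal.ofReal_ne_top]
    refine setLIntegral_congr_fun measurableSet_Ioo fun s hs => ?_
    have h3 : ∫⁻ θ in Ioo (-Real.pi) Real.pi, ENNReal.ofReal (ω ‖u * circleMap 0 s θ‖) *
        (carlesonSquare z).indicator 1 (u * circleMap 0 s θ) =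
        ∫⁻ θ in Ioo (-Real.pi) Real.pi, ENNReal.ofReal (ω s) * (Ioi ‖z‖).indicator 1 s *
          (Ioo (-((1 - ‖z‖) / 2)) ((1 - ‖z‖) / 2)).indicator 1 θ := by
      refine setLIntegral_congr_fun measurableSet_Ioo fun θ hθ => ?_
      simp only [norm_mul, hu, norm_circleMap_zero, one_mul, abs_of_pos hs.1, indicator,
        hmem s hs θ hθ, mem_Ioi, mem_Ioo, Pi.one_apply, ← abs_lt]
      by_cases h4 : ‖z‖ < s <;> by_cases h5 : |θ| < (1 - ‖z‖) / 2 <;> simp [h4, h5]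
    have hsub : Ioo (-((1 - ‖z‖) / 2)) ((1 - ‖z‖) / 2) ⊆ Ioo (-Real.pi) Real.pi := by
      have := Real.pi_gt_three
      exact Ioo_subset_Ioo (by linarith) (by linarith)
    rw [h3, lintegral_const_mul _ (measurable_one.indicator measurableSet_Ioo),
      lintegral_indicator_one measurableSet_Ioo, Measure.restrict_apply measurableSet_Ioo,
      inter_eq_left.2 hsub, Real.volume_Ioo]
    by_cases h4 : ‖z‖ < s
    · simp only [indicator, mem_Ioi, h4, if_true, Pi.one_apply]
      ring_nf
    · simp [indicator, h4]
  · exact ((hωm.comp (measurable_const_mul u)).mul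
      ((measurable_one.indicator hS).comp (measurable_const_mul u))).indicator measurableSet_ball

/-! ### Monotone comparison, subharmonicity of `|f|^p` and growth of integral means -/

/-- Comparison of integrals of a monotone function against two radial densities with comparable
tails. -/
theorem lintegral_mono_le_of_tail_le {v w : ℝ → ℝ≥0∞} {G : ℝ → ℝ} {C : ℝ≥0∞}
    (hG : MonotoneOn G (Ioo 0 1)) (hG0 : ∀ s ∈ Ioo (0 : ℝ) 1, 0 ≤ G s)
    (hv : Measurable v) (hw : Measurable w)
    (hC : C ≠ ∞)
    (h : ∀ r ∈ Ico (0 : ℝ) 1, ∫⁻ s in Ioo r 1, v s ≤ C * ∫⁻ s in Ioo r 1, w s) :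
    ∫⁻ s in Ioo 0 1, v s * ENNReal.ofReal (G s) ≤
      C * ∫⁻ s in Ioo 0 1, w s * ENNReal.ofReal (G s) := by
  have hGm : AEMeasurable G (volume.restrict (Ioo 0 1)) :=
    aemeasurable_restrict_of_monotoneOn measurableSet_Ioo hG
  -- Layer-cake formula. The superlevel sets of a monotone function are intervals ending at 1, up to
  -- the left endpoint, so the tail hypothesis applies to each level.
  have key : ∀ v : ℝ → ℝ≥0∞, Measurable v → ∫⁻ s in Ioo 0 1, v s * ENNReal.ofReal (G s) =
      ∫⁻ t in Ioi (0 : ℝ), ∫⁻ s in {s | t < G s} ∩ Ioo 0 1, v s := by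
    intro v hv
    have h1 : ∫⁻ s in Ioo 0 1, v s * ENNReal.ofReal (G s) =
        ∫⁻ s, ENNReal.ofReal (G s) ∂(volume.restrict (Ioo 0 1)).withDensity v := by
      rw [lintegral_withDensity_eq_lintegral_mul₀ hv.aemeasurable hGm.ennreal_ofReal]
      rfl
    have hac := withDensity_absolutelyContinuous (volume.restrict (Ioo (0 : ℝ) 1)) v
    rw [h1, lintegral_eq_lintegral_meas_lt _ (hac.ae_le ((ae_restrict_iff' measurableSet_Ioo).2
      (Eventually.of_forall hG0))) (hGm.mono_ac hac)]
    refine lintegral_congr fun t => ?_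
    rw [withDensity_apply', Measure.restrict_restrict' measurableSet_Ioo]
  rw [key v hv, key w hw, ← lintegral_const_mul']
  · refine lintegral_mono fun t => ?_
    set U := {s | t < G s} ∩ Ioo 0 1
    rcases U.eq_empty_or_nonempty with hU | hU
    · simp [hU]
    · have hbdd : BddBelow U := ⟨0, fun s hs => hs.2.1.le⟩
      have hr0 : 0 ≤ sInf U := le_csInf hU fun s hs => hs.2.1.le
      have hr1 : sInf U < 1 := (csInf_lt_iff hbdd hU).2 (by
        obtain ⟨s, hs⟩ := hU
        exact ⟨s, hs, hs.2.2⟩)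
      have h1 : Ioo (sInf U) 1 ⊆ U := by
        intro s hs
        obtain ⟨x, hx, hxs⟩ := (csInf_lt_iff hbdd hU).1 hs.1
        have hs' : s ∈ Ioo (0 : ℝ) 1 := ⟨hr0.trans_lt hs.1, hs.2⟩
        exact ⟨lt_of_lt_of_le hx.1 (hG hx.2 hs' hxs.le), hs'⟩
      have h2 : U ⊆ Ico (sInf U) 1 := fun s hs => ⟨csInf_le hbdd hs, hs.2.2⟩
      have h3 : U =ᵐ[volume] Ioo (sInf U) 1 :=
        (h2.eventuallyLE.trans Ioo_ae_eq_Ico.symm.le).antisymm h1.eventuallyLE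
      rw [setLIntegral_congr h3, setLIntegral_congr h3]
      exact h _ ⟨hr0, hr1⟩
  · exact hC

/-- The sub-mean value property of `|f|^p` on circles. -/
theorem norm_rpow_le_circleAverage {f : ℂ → ℂ} {c : ℂ} {R p : ℝ} (hR : 0 < R) (hp : 0 < p)
    (hf : AnalyticOnNhd ℂ f (Metric.closedBall c R)) :
    ‖f c‖ ^ p ≤ Real.circleAverage (fun z => ‖f z‖ ^ p) c R := by
  have hRa : |R| = R := abs_of_pos hR
  by_cases h0 : f c = 0
  · rw [h0, norm_zero, Real.zero_rpow hp.ne']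
    exact Real.circleAverage_nonneg_of_nonneg fun z _ => by positivity
  have ha : 0 < ‖f c‖ := norm_pos_iff.2 h0
  set a := ‖f c‖
  have hsph : Metric.sphere c |R| ⊆ Metric.closedBall c R := by
    rw [hRa]; exact Metric.sphere_subset_closedBall
  -- `Real.log 0 = 0` would spoil the inequality below at zeros of `f`. With `log a - 1 / p` there,
  -- the tangent line used below takes exactly the value `0 = |f|^p`, and only a discrete set is
  -- affected.
  set h : ℂ → ℝ := fun z => if f z = 0 then Real.log a - 1 / p else Real.log ‖f z‖
  have hcod : (fun z => Real.log ‖f z‖) =ᶠ[codiscreteWithin (Metric.sphere c |R|)] h := by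
    rcases hf.eqOn_zero_or_eventually_ne_zero_of_preconnected
      (convex_closedBall c R).isPreconnected with h1 | h1
    · exact absurd (h1 (Metric.mem_closedBall_self hR.le)) h0
    · filter_upwards [codiscreteWithin_mono hsph h1] with z hz
      simp only [h, hz, if_false]
  have hlogint : CircleIntegrable (fun z => Real.log ‖f z‖) c R :=
    MeromorphicOn.circleIntegrable_log_norm (hf.mono hsph).meromorphicOn
  have hint : CircleIntegrable h c R := hlogint.congr_codiscreteWithin hcod
  have hcont : ContinuousOn (fun z => ‖f z‖ ^ p) (Metric.sphere c R) :=
    (hf.continuousOn.mono Metric.sphere_subset_closedBall).norm.rpow_const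
      fun _ _ => Or.inr hp.le
  have hci : CircleIntegrable (fun z => ‖f z‖ ^ p) c R := hcont.circleIntegrable hR.le
  -- Jensen's formula: the zeros of `f` contribute nonnegative terms.
  have hjen : Real.log a ≤ Real.circleAverage (fun z => Real.log ‖f z‖) c R := by
    rw [AnalyticOnNhd.circleAverage_log_norm hR.ne' (by rwa [hRa]) h0]
    refine le_add_of_nonneg_left (finsum_nonneg fun u => ?_)
    by_cases hu : u ∈ Metric.closedBall c |R|
    · refine mul_nonneg ?_ ?_
      · exact_mod_cast MeromorphicOn.AnalyticOnNhd.divisor_nonneg (by rwa [hRa]) u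
      · rcases eq_or_ne c u with rfl | hcu
        · simp
        · apply Real.log_nonneg
          rw [hRa, Metric.mem_closedBall, dist_comm, dist_eq_norm] at hu
          rw [← div_eq_mul_inv, one_le_div (norm_pos_iff.2 (sub_ne_zero.2 hcu))]
          exact hu
    · simp [hu]
  rw [Real.circleAverage_congr_codiscreteWithin hcod hR.ne'] at hjen
  -- The exponential lies above its tangent line: `|f|^p ≥ a^p (1 + p (log |f| - log a))`. Averaging
  -- this and using Jensen's inequality for `log |f|` gives the claim.
  have hle : ∀ z ∈ Metric.sphere c |R|,
      a ^ p * (p * h z) + a ^ p * (1 - p * Real.log a) ≤ ‖f z‖ ^ p := by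
    intro z _
    by_cases hz : f z = 0
    · simp only [h, hz, if_true, norm_zero, Real.zero_rpow hp.ne']
      apply le_of_eq
      field_simp
      ring
    · have hz' : 0 < ‖f z‖ := norm_pos_iff.2 hz
      simp only [h, hz, if_false]
      have h1 := Real.add_one_le_exp (p * (Real.log ‖f z‖ - Real.log a))
      have h2 : ‖f z‖ ^ p = a ^ p * Real.exp (p * (Real.log ‖f z‖ - Real.log a)) := by
        rw [Real.rpow_def_of_pos hz', Real.rpow_def_of_pos ha, ← Real.exp_add]
        ring_nf
      rw [h2, ← mul_add]
      gcongr
      linarith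
  have hmono := Real.circleAverage_mono
    (f₁ := fun z => (a ^ p * p) • h z + a ^ p * (1 - p * Real.log a))
    ((CircleIntegrable.const_fun_smul hint).add (circleIntegrable_const _ _ _)) hci
    (fun z hz => by have := hle z hz; simp only [smul_eq_mul]; linarith)
  rw [Real.circleAverage_fun_add (CircleIntegrable.const_fun_smul hint)
    (circleIntegrable_const _ _ _),
    Real.circleAverage_fun_smul, Real.circleAverage_const, smul_eq_mul] at hmono
  have : a ^ p * p * Real.log a ≤ a ^ p * p * Real.circleAverage h c R := by gcongr
  linarith

theorem analyticOnNhd_disc {f : ℂ → ℂ} (hf : DifferentiableOn ℂ f disc) :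
    AnalyticOnNhd ℂ f disc := hf.analyticOnNhd Metric.isOpen_ball

theorem continuousOn_norm_rpow {f : ℂ → ℂ} {p : ℝ} (hp : 0 < p) (hf : DifferentiableOn ℂ f disc) :
    ContinuousOn (fun z => ‖f z‖ ^ p) disc :=
  hf.continuousOn.norm.rpow_const fun _ _ => Or.inr hp.le

/-- Circle averages over circles centred at the origin, as averages over rotations. -/
theorem circleAverage_norm_eq (u : ℂ → ℝ) (z : ℂ) :
    Real.circleAverage u 0 ‖z‖ = Real.circleAverage (fun w => u (w * z)) 0 1 := by
  rw [Real.circleAverage_eq_integral_add (Complex.arg z), Real.circleAverage]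
  congr 2
  ext θ
  congr 1
  conv_rhs => rw [← Complex.norm_mul_exp_arg_mul_I z]
  simp only [circleMap, zero_add, Complex.ofReal_add, add_mul, Complex.exp_add,
    Complex.ofReal_one, one_mul]
  ring

/-- Each rotate `z ↦ f (w z)` satisfies the sub-mean value inequality at `z₀`; averaging over `|w| =
1` and exchanging the two averages shows that the integral mean, as a radial function, is itself
subharmonic. -/
theorem circleAverage_le_circleAverage_norm {f : ℂ → ℂ} {p d : ℝ} {z₀ : ℂ} (hp : 0 < p)
    (hd : 0 < d) (hz : ‖z₀‖ + d < 1) (hf : DifferentiableOn ℂ f disc) :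
    Real.circleAverage (fun z => ‖f z‖ ^ p) 0 ‖z₀‖ ≤
      Real.circleAverage (fun z => Real.circleAverage (fun w => ‖f w‖ ^ p) 0 ‖z‖) z₀ d := by
  have hu := continuousOn_norm_rpow hp hf
  have hmem : ∀ φ θ : ℝ, circleMap 0 1 φ * circleMap z₀ d θ ∈ disc := by
    intro φ θ
    rw [mem_disc, norm_mul, norm_circleMap_zero, abs_one, one_mul]
    refine lt_of_le_of_lt ?_ hz
    rw [circleMap]
    refine (norm_add_le _ _).trans ?_
    simp [abs_of_pos hd]
  have hcont : Continuous fun x : ℝ × ℝ =>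
      ‖f (circleMap 0 1 x.1 * circleMap z₀ d x.2)‖ ^ p := by
    refine hu.comp_continuous ?_ fun x => hmem x.1 x.2
    unfold circleMap
    fun_prop
  simp only [circleAverage_norm_eq (fun w => ‖f w‖ ^ p)]
  have hswap : Real.circleAverage (fun z => Real.circleAverage (fun w => ‖f (w * z)‖ ^ p) 0 1) z₀ d
      = Real.circleAverage (fun w => Real.circleAverage (fun z => ‖f (w * z)‖ ^ p) z₀ d) 0 1 := by
    simp only [Real.circleAverage, intervalIntegral.integral_smul]
    rw [intervalIntegral_intervalIntegral_swap]
    exact ((hcont.comp continuous_swap).continuousOn.integrableOn_compact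
      (isCompact_uIcc.prod isCompact_uIcc)).mono_set
      (prod_mono uIoc_subset_uIcc uIoc_subset_uIcc)
  rw [hswap]
  have hc1 : Continuous fun φ => ‖f (circleMap 0 1 φ * z₀)‖ ^ p := by
    refine hu.comp_continuous ?_ fun φ => ?_
    · unfold circleMap
      fun_prop
    · rw [mem_disc, norm_mul, norm_circleMap_zero, abs_one, one_mul]
      linarith
  refine Real.circleAverage_mono ?_ ?_ fun w hw => ?_
  · exact hc1.intervalIntegrable _ _
  · have : Continuous fun φ => ∫ θ in (0 : ℝ)..2 * Real.pi,
        ‖f (circleMap 0 1 φ * circleMap z₀ d θ)‖ ^ p :=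
      intervalIntegral.continuous_parametric_intervalIntegral_of_continuous' hcont _ _
    exact (this.const_smul ((2 * Real.pi)⁻¹)).intervalIntegrable _ _
  · refine norm_rpow_le_circleAverage (f := fun z => f (w * z)) hd hp fun z hz' => ?_
    have hw1 : ‖w‖ = 1 := by simpa using hw
    have : w * z ∈ disc := by
      rw [mem_disc, norm_mul, hw1, one_mul]
      have h2 : ‖z - z₀‖ ≤ d := by simpa [dist_eq_norm] using hz'
      have h3 := norm_add_le (z - z₀) z₀
      rw [sub_add_cancel] at h3
      linarith
    exact (analyticOnNhd_disc hf _ this).comp (by fun_prop)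

/-- The integral means of an analytic function increase with the radius. -/
theorem circleAverage_mono_radius {f : ℂ → ℂ} {p : ℝ} (hp : 0 < p)
    (hf : DifferentiableOn ℂ f disc) {r s : ℝ} (hr : 0 ≤ r) (hrs : r ≤ s) (hs : s < 1) :
    Real.circleAverage (fun z => ‖f z‖ ^ p) 0 r ≤ Real.circleAverage (fun z => ‖f z‖ ^ p) 0 s := by
  set G := Real.circleAverage (fun z => ‖f z‖ ^ p) 0
  have hG : ContinuousOn G (Ico 0 1) := by
    refine Real.ContinuousOn.circleAverage ?_ fun r hr => hr.1
    exact (continuousOn_norm_rpow hp hf).mono fun z hz => by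
      rw [mem_disc]; simpa using hz.2
  have hGs : ContinuousOn G (Icc 0 s) := hG.mono fun x hx => ⟨hx.1, hx.2.trans_lt hs⟩
  obtain ⟨t₁, ht₁, hmax⟩ := isCompact_Icc.exists_isMaxOn ⟨r, hr, hrs⟩ hGs
  have hA : IsCompact (Icc 0 s ∩ G ⁻¹' {G t₁}) :=
    isCompact_Icc.of_isClosed_subset (hGs.preimage_isClosed_of_isClosed isClosed_Icc
      isClosed_singleton) inter_subset_left
  -- Maximum principle at the last maximum point `t₀`. If `t₀ < s`, the circle of radius `s - t₀`
  -- about `t₀` stays within radius `s` and touches it at angle 0, where `G` is strictly smaller.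
  -- Its average of `G` then falls below `G t₀`, against the sub-mean value property.
  obtain ⟨t₀, ht₀, hgr⟩ := hA.exists_isGreatest ⟨t₁, ht₁, rfl⟩
  have hm : ∀ t ∈ Icc 0 s, G t ≤ G t₀ := fun t ht => by
    rw [show G t₀ = G t₁ from ht₀.2]; exact hmax ht
  rcases ht₀.1.2.eq_or_lt with h | h
  · rw [← h]; exact hm r ⟨hr, hrs⟩
  exfalso
  set d := s - t₀
  have hd : 0 < d := sub_pos.2 h
  have ht0n : ‖(t₀ : ℂ)‖ = t₀ := by rw [Complex.norm_real, Real.norm_of_nonneg ht₀.1.1]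
  have h1 := circleAverage_le_circleAverage_norm (z₀ := (t₀ : ℂ)) hp hd
    (by rw [ht0n]; simp only [d]; linarith) hf
  rw [ht0n] at h1
  change G t₀ ≤ Real.circleAverage (fun z => G ‖z‖) t₀ d at h1
  have hnorm : ∀ θ, ‖circleMap (t₀ : ℂ) d θ‖ ∈ Icc 0 s := fun θ => by
    refine ⟨norm_nonneg _, ?_⟩
    rw [circleMap]
    refine (norm_add_le _ _).trans ?_
    rw [ht0n, norm_mul, Complex.norm_exp_ofReal_mul_I, mul_one, Complex.norm_real,
      Real.norm_of_nonneg hd.le]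
    simp [d]
  have hc : Continuous fun θ => G ‖circleMap (t₀ : ℂ) d θ‖ :=
    hGs.comp_continuous (by unfold circleMap; fun_prop) hnorm
  have hlt : G ‖circleMap (t₀ : ℂ) d 0‖ < G t₀ := by
    have h0 : ‖circleMap (t₀ : ℂ) d 0‖ = s := by
      simp only [circleMap, Complex.ofReal_zero, zero_mul, Complex.exp_zero, mul_one]
      rw [← Complex.ofReal_add, Complex.norm_real, Real.norm_of_nonneg]
      · simp [d]
      · linarith [ht₀.1.1]
    rw [h0]
    refine lt_of_le_of_ne (hm s ⟨hr.trans hrs, le_rfl⟩) fun he => ?_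
    have := hgr ⟨⟨hr.trans hrs, le_rfl⟩, by
      rw [mem_preimage, he]; exact ht₀.2⟩
    linarith
  have hint := intervalIntegral.integral_lt_integral_of_continuousOn_of_le_of_exists_lt
    (f := fun θ => G ‖circleMap (t₀ : ℂ) d θ‖) (g := fun _ => G t₀) Real.two_pi_pos
    hc.continuousOn continuousOn_const (fun θ _ => hm _ (hnorm θ))
    ⟨0, ⟨le_rfl, Real.two_pi_pos.le⟩, hlt⟩
  rw [intervalIntegral.integral_const, sub_zero, smul_eq_mul] at hint
  rw [Real.circleAverage, smul_eq_mul, inv_mul_eq_div, le_div_iff₀ Real.two_pi_pos] at h1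
  linarith

theorem lintegral_circle_eq {u : ℂ → ℝ} {c : ℂ} {R : ℝ} (hR : 0 ≤ R)
    (hu : ContinuousOn u (Metric.sphere c R)) (hu0 : ∀ z, 0 ≤ u z) :
    ∫⁻ θ in Ioo (-Real.pi) Real.pi, ENNReal.ofReal (u (circleMap c R θ)) =
      ENNReal.ofReal (2 * Real.pi * Real.circleAverage u c R) := by
  have hcont : Continuous fun θ => u (circleMap c R θ) :=
    hu.comp_continuous (continuous_circleMap c R) fun θ => circleMap_mem_sphere c hR θ
  have hπ : -Real.pi ≤ Real.pi := by linarith [Real.pi_pos]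
  rw [← ofReal_integral_eq_lintegral_ofReal]
  · congr 1
    rw [← integral_Ioc_eq_integral_Ioo, ← intervalIntegral.integral_of_le hπ,
      Real.circleAverage, smul_eq_mul, mul_inv_cancel_left₀ Real.two_pi_pos.ne']
    have hper : Function.Periodic (fun θ => u (circleMap c R θ)) (2 * Real.pi) := fun x => by
      simp [periodic_circleMap c R x]
    have := hper.intervalIntegral_add_eq (-Real.pi) 0
    rwa [zero_add, show -Real.pi + 2 * Real.pi = Real.pi by ring] at this
  · exact (hcont.integrableOn_Icc (a := -Real.pi) (b := Real.pi)).mono_set Ioo_subset_Icc_self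
  · exact Eventually.of_forall fun θ => hu0 _

theorem enorm_rpow_eq {p : ℝ} (hp : 0 ≤ p) (w : ℂ) : ‖w‖ₑ ^ p = ENNReal.ofReal (‖w‖ ^ p) := by
  rw [← ofReal_norm, ENNReal.ofReal_rpow_of_nonneg (norm_nonneg _) hp]

theorem measurable_indicator_disc {f : ℂ → ℂ} (hf : ContinuousOn f disc) :
    Measurable (disc.indicator f) := by
  classical
  rw [← piecewise_eq_indicator]
  exact hf.measurable_piecewise continuousOn_const measurableSet_disc

/-- The sub-mean value property of `|f|^p` with respect to area. -/
theorem enorm_rpow_le_lintegral_ball {f : ℂ → ℂ} {c : ℂ} {R p : ℝ} (hR : 0 < R) (hp : 0 < p)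
    (hc : ‖c‖ + R ≤ 1) (hf : DifferentiableOn ℂ f disc) :
    ENNReal.ofReal (Real.pi * R ^ 2) * ‖f c‖ₑ ^ p ≤ ∫⁻ z in Metric.ball c R, ‖f z‖ₑ ^ p := by
  have hsub : ∀ w ∈ Metric.ball (0 : ℂ) R, c + w ∈ disc := fun w hw => by
    rw [mem_disc]
    have h1 : ‖w‖ < R := by simpa using hw
    linarith [norm_add_le c w]
  have htrans : ∫⁻ z in Metric.ball c R, ‖f z‖ₑ ^ p =
      ∫⁻ w in Metric.ball 0 R, ‖f (c + w)‖ₑ ^ p := by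
    have h := (measurePreserving_add_left volume c).setLIntegral_comp_preimage_emb
      (measurableEmbedding_addLeft c) (fun z => ‖f z‖ₑ ^ p) (Metric.ball c R)
    rw [← h]
    congr 2
    ext w
    simp
  have hmeas : Measurable ((Metric.ball (0 : ℂ) R).indicator fun w => ‖f (c + w)‖ₑ ^ p) := by
    have h1 : (Metric.ball (0 : ℂ) R).indicator (fun w => ‖f (c + w)‖ₑ ^ p) =
        (Metric.ball (0 : ℂ) R).indicator fun w => ‖disc.indicator f (c + w)‖ₑ ^ p := by
      refine indicator_congr fun w hw => ?_
      rw [indicator_of_mem (hsub w hw)]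
    rw [h1]
    exact ((((measurable_indicator_disc hf.continuousOn).comp
      (measurable_const_add c)).enorm).pow_const p).indicator measurableSet_ball
  rw [htrans, lintegral_ball_eq_polar hmeas]
  calc ENNReal.ofReal (Real.pi * R ^ 2) * ‖f c‖ₑ ^ p
      = ∫⁻ s in Ioo 0 R, ENNReal.ofReal s * (ENNReal.ofReal (2 * Real.pi) * ‖f c‖ₑ ^ p) := by
        rw [lintegral_mul_const _ ENNReal.measurable_ofReal,
          ← ofReal_integral_eq_lintegral_ofReal, ← integral_Ioc_eq_integral_Ioo,
          ← intervalIntegral.integral_of_le hR.le, integral_id, ← mul_assoc,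
          ← ENNReal.ofReal_mul' Real.two_pi_pos.le]
        · congr 2
          ring
        · exact (continuous_id.integrableOn_Icc).mono_set Ioo_subset_Icc_self
        · exact (ae_restrict_iff' measurableSet_Ioo).2 (Eventually.of_forall fun s hs => hs.1.le)
    _ ≤ _ := by
        refine setLIntegral_mono' measurableSet_Ioo fun s hs => ?_
        gcongr
        have hball : Metric.closedBall c s ⊆ disc := fun z hz => by
          rw [mem_disc]
          have h2 : ‖z - c‖ ≤ s := by simpa [dist_eq_norm] using hz
          have h3 := norm_add_le (z - c) c
          rw [sub_add_cancel] at h3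
          linarith [hs.2]
        have h4 : ∀ θ, c + circleMap 0 s θ = circleMap c s θ := fun θ => by simp [circleMap]
        simp only [h4, enorm_rpow_eq hp.le]
        rw [lintegral_circle_eq (u := fun z => ‖f z‖ ^ p) hs.1.le
          ((continuousOn_norm_rpow hp hf).mono (Metric.sphere_subset_closedBall.trans hball)) (fun z => by positivity),
          ← ENNReal.ofReal_mul (by positivity)]
        gcongr
        exact norm_rpow_le_circleAverage hs.1 hp ((analyticOnNhd_disc hf).mono hball)

/-! ### Comparable tails, and norms with respect to `ω` and `ω̃` -/

section

theorem lintegral_Ioo_reflect (g : ℝ → ℝ≥0∞) (r : ℝ) :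
    ∫⁻ s in Ioo r 1, g (1 - s) = ∫⁻ x in Ioo 0 (1 - r), g x := by
  have h := (Measure.measurePreserving_sub_left volume (1 : ℝ)).setLIntegral_comp_preimage_emb
    (MeasurableEquiv.subLeft (1 : ℝ)).measurableEmbedding g (Ioo 0 (1 - r))
  rw [← h]
  congr 2
  ext s
  simp

theorem lintegral_rpow_Ioo {α h : ℝ} (hα : -1 < α) (hh : 0 ≤ h) :
    ∫⁻ x in Ioo 0 h, ENNReal.ofReal (x ^ α) = ENNReal.ofReal (h ^ (α + 1) / (α + 1)) := by
  rw [← ofReal_integral_eq_lintegral_ofReal, ← integral_Ioc_eq_integral_Ioo,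
    ← intervalIntegral.integral_of_le hh, integral_rpow (Or.inl hα), Real.zero_rpow (by linarith),
    sub_zero]
  · have := intervalIntegral.intervalIntegrable_rpow' (a := 0) (b := h) hα
    rw [intervalIntegrable_iff_integrableOn_Ioo_of_le hh] at this
    exact this
  · exact (ae_restrict_iff' measurableSet_Ioo).2
      (Eventually.of_forall fun s hs => Real.rpow_nonneg hs.1.le _)

/-- The profile of `ω̃`, extended by zero. -/
def tildeProfile (ω : ℝ → ℝ) : ℝ → ℝ := (Ico 0 1).indicator fun s => hat ω s / (1 - s)

variable {ω : ℝ → ℝ}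

theorem tildeProfile_of_mem {s : ℝ} (hs : s ∈ Ico (0 : ℝ) 1) :
    tildeProfile ω s = hat ω s / (1 - s) := indicator_of_mem hs _

theorem IsRadialWeight.measurable_tildeProfile (h : IsRadialWeight ω) :
    Measurable (tildeProfile ω) := by
  classical
  have : ContinuousOn (fun s => hat ω s / (1 - s)) (Ico 0 1) :=
    h.continuousOn_hat.div (by fun_prop) fun s hs => by linarith [hs.2]
  rw [tildeProfile, ← piecewise_eq_indicator]
  exact this.measurable_piecewise continuousOn_const measurableSet_Ico

theorem norm_mem_Ico {z : ℂ} (hz : z ∈ disc) : ‖z‖ ∈ Ico (0 : ℝ) 1 :=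
  ⟨norm_nonneg _, mem_disc.1 hz⟩

theorem IsRadialWeight.tilde_pos (h : IsRadialWeight ω) {z : ℂ} (hz : z ∈ disc) :
    0 < tilde ω z :=
  div_pos (h.hat_pos _ (norm_mem_Ico hz)) (by linarith [mem_disc.1 hz])

theorem weighted_tilde_eq (ω : ℝ → ℝ) : weighted (tilde ω) = radialMeasure (tildeProfile ω) :=
  weighted_congr ((ae_restrict_iff' measurableSet_disc).2 (Eventually.of_forall fun z hz => by
    simp only [tildeProfile_of_mem (norm_mem_Ico hz), tilde]))

theorem lintegral_radialMeasure (hm : Measurable ω) (g : ℂ → ℝ≥0∞) :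
    ∫⁻ z, g z ∂(radialMeasure ω) = ∫⁻ z in disc, ENNReal.ofReal (ω ‖z‖) * g z :=
  lintegral_weighted (w := fun z => ω ‖z‖) (hm.comp measurable_norm).aemeasurable g

theorem IsRadialWeight.lintegral_tilde (h : IsRadialWeight ω) (g : ℂ → ℝ≥0∞) :
    ∫⁻ z, g z ∂(weighted (tilde ω)) = ∫⁻ z in disc, ENNReal.ofReal (tilde ω z) * g z := by
  rw [weighted_tilde_eq, lintegral_radialMeasure h.measurable_tildeProfile]
  refine setLIntegral_congr_fun measurableSet_disc fun z hz => ?_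
  simp only [tildeProfile_of_mem (norm_mem_Ico hz), tilde]

/-- The `L^p` integral of an analytic function with respect to a radial weight, in terms of its
integral means. -/
theorem lintegral_enorm_radialMeasure {f : ℂ → ℂ} {p : ℝ} (hp : 0 < p) (hm : Measurable ω)
    (hf : DifferentiableOn ℂ f disc) :
    ∫⁻ z, ‖f z‖ₑ ^ p ∂(radialMeasure ω) = ∫⁻ s in Ioo 0 1,
      (ENNReal.ofReal s * ENNReal.ofReal (ω s)) *
        ENNReal.ofReal (2 * Real.pi * Real.circleAverage (fun z => ‖f z‖ ^ p) 0 s) := by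
  rw [lintegral_radialMeasure hm, disc, lintegral_ball_eq_polar]
  · refine setLIntegral_congr_fun measurableSet_Ioo fun s hs => ?_
    simp only [norm_circleMap_zero, abs_of_pos hs.1]
    rw [lintegral_const_mul' _ _ ENNReal.ofReal_ne_top, mul_assoc]
    simp only [enorm_rpow_eq hp.le]
    rw [lintegral_circle_eq (u := fun z => ‖f z‖ ^ p) hs.1.le
      ((continuousOn_norm_rpow hp hf).mono fun z hz => ?_) fun z => by positivity]
    rw [mem_disc]
    simp only [mem_sphere_iff_norm, sub_zero] at hz
    rw [hz]
    exact hs.2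
  · have h1 : (Metric.ball (0 : ℂ) 1).indicator
        (fun z => ENNReal.ofReal (ω ‖z‖) * ‖f z‖ₑ ^ p) =
        (Metric.ball (0 : ℂ) 1).indicator
        (fun z => ENNReal.ofReal (ω ‖z‖) * ‖disc.indicator f z‖ₑ ^ p) :=
      indicator_congr fun z hz => by rw [indicator_of_mem (s := disc) hz]
    rw [h1]
    exact ((hm.comp measurable_norm).ennreal_ofReal.mul
      ((measurable_indicator_disc hf.continuousOn).enorm.pow_const p)).indicator measurableSet_ball

/-- Weights with comparable tails give comparable norms of analytic functions. -/
theorem lintegral_radialMeasure_le_of_tail_le {v w : ℝ → ℝ} (hv : Measurable v)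
    (hw : Measurable w) {C : ℝ≥0∞} (hC : C ≠ ∞)
    (h : ∀ r ∈ Ico (0 : ℝ) 1, ∫⁻ s in Ioo r 1, ENNReal.ofReal s * ENNReal.ofReal (v s) ≤
      C * ∫⁻ s in Ioo r 1, ENNReal.ofReal s * ENNReal.ofReal (w s))
    {f : ℂ → ℂ} {p : ℝ} (hp : 0 < p) (hf : DifferentiableOn ℂ f disc) :
    ∫⁻ z, ‖f z‖ₑ ^ p ∂(radialMeasure v) ≤ C * ∫⁻ z, ‖f z‖ₑ ^ p ∂(radialMeasure w) := by
  rw [lintegral_enorm_radialMeasure hp hv hf, lintegral_enorm_radialMeasure hp hw hf]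
  refine lintegral_mono_le_of_tail_le
    (G := fun s => 2 * Real.pi * Real.circleAverage (fun z => ‖f z‖ ^ p) 0 s) ?_ ?_
    (ENNReal.measurable_ofReal.mul hv.ennreal_ofReal)
    (ENNReal.measurable_ofReal.mul hw.ennreal_ofReal) hC h
  · intro r hr s hs hrs
    have := circleAverage_mono_radius hp hf hr.1.le hrs hs.2
    have := Real.pi_pos
    dsimp only
    gcongr
  · intro s _
    have : 0 ≤ Real.circleAverage (fun z => ‖f z‖ ^ p) 0 s :=
      Real.circleAverage_nonneg_of_nonneg fun z _ => by positivity
    have := Real.pi_pos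
    positivity

theorem IsRadialWeight.lintegral_Ioo (h : IsRadialWeight ω) {r : ℝ} (hr : r ∈ Ico (0 : ℝ) 1) :
    ∫⁻ s in Ioo r 1, ENNReal.ofReal (ω s) = ENNReal.ofReal (hat ω r) := by
  have hsub : Ioo r 1 ⊆ Ico 0 1 := fun x hx => ⟨hr.1.trans hx.1.le, hx.2⟩
  rw [← ofReal_integral_eq_lintegral_ofReal, ← integral_Ioc_eq_integral_Ioo,
    ← intervalIntegral.integral_of_le hr.2.le]
  · rfl
  · exact h.integrable.mono_set hsub
  · exact (ae_restrict_iff' measurableSet_Ioo).2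
      (Eventually.of_forall fun s hs => h.nonneg s (hsub hs))

theorem IsRadialWeight.tail_le (h : IsRadialWeight ω) {r : ℝ} (hr : r ∈ Ico (0 : ℝ) 1) :
    ∫⁻ s in Ioo r 1, ENNReal.ofReal s * ENNReal.ofReal (ω s) ≤ ENNReal.ofReal (hat ω r) := by
  rw [← h.lintegral_Ioo hr]
  refine setLIntegral_mono' measurableSet_Ioo fun s hs => mul_le_of_le_one_left' ?_
  exact ENNReal.ofReal_le_one.2 hs.2.le

/-- The polar Jacobian `s` degenerates only at the origin. Upper doubling lets the tail start at `(1
+ r) / 2`, where `s ≥ 1/2`. -/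
theorem ClassD.le_tail (h : ClassD ω) : ∃ C : ℝ, 0 < C ∧ ∀ r ∈ Ico (0 : ℝ) 1,
    ENNReal.ofReal (hat ω r) ≤
      ENNReal.ofReal C * ∫⁻ s in Ioo r 1, ENNReal.ofReal s * ENNReal.ofReal (ω s) := by
  obtain ⟨C, β, hC, hβ, hup⟩ := h.upper_power
  refine ⟨C * 2 ^ β * 2, by positivity, fun r hr => ?_⟩
  have h1 : (1 + r) / 2 ∈ Ico (0 : ℝ) 1 := ⟨by linarith [hr.1], by linarith [hr.2]⟩
  have h2 := hup r ((1 + r) / 2) hr.1 (by linarith [hr.2]) h1.2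
  have h3 : (1 - r) / (1 - (1 + r) / 2) = 2 := by
    have : 1 - r ≠ 0 := by linarith [hr.2]
    rw [show 1 - (1 + r) / 2 = (1 - r) / 2 by ring]
    field_simp
  rw [h3] at h2
  calc ENNReal.ofReal (hat ω r)
      ≤ ENNReal.ofReal (C * 2 ^ β) * ENNReal.ofReal (hat ω ((1 + r) / 2)) := by
        rw [← ENNReal.ofReal_mul (by positivity)]
        exact ENNReal.ofReal_le_ofReal h2
    _ = ENNReal.ofReal (C * 2 ^ β) *
        ∫⁻ s in Ioo ((1 + r) / 2) 1, ENNReal.ofReal (ω s) := by rw [h.weight.lintegral_Ioo h1]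
    _ ≤ ENNReal.ofReal (C * 2 ^ β) * ∫⁻ s in Ioo ((1 + r) / 2) 1,
        ENNReal.ofReal 2 * (ENNReal.ofReal s * ENNReal.ofReal (ω s)) := by
        gcongr ENNReal.ofReal (C * 2 ^ β) * ?_
        refine setLIntegral_mono' measurableSet_Ioo fun s hs => ?_
        rw [← mul_assoc, ← ENNReal.ofReal_mul zero_le_two]
        refine le_mul_of_one_le_left' ?_
        rw [ENNReal.one_le_ofReal]
        linarith [hs.1, hr.1]
    _ ≤ _ := by
        rw [lintegral_const_mul' _ _ ENNReal.ofReal_ne_top, ← mul_assoc,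
          ← ENNReal.ofReal_mul (by positivity)]
        gcongr
        linarith [hr.2]

/-- Lower doubling dominates `ω̂(s) / (1 - s)` by a multiple of `(1 - s)^(γ - 1)`, which is
integrable up to 1 because `γ > 0`. -/
theorem ClassD.tilde_tail_le (h : ClassD ω) : ∃ C : ℝ, 0 < C ∧ ∀ r ∈ Ico (0 : ℝ) 1,
    ∫⁻ s in Ioo r 1, ENNReal.ofReal s * ENNReal.ofReal (tildeProfile ω s) ≤
      ENNReal.ofReal C * ENNReal.ofReal (hat ω r) := by
  obtain ⟨C, γ, hC, hγ, hlow⟩ := h.lower_power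
  refine ⟨C / γ, by positivity, fun r hr => ?_⟩
  have h1r : 0 < 1 - r := by linarith [hr.2]
  have hpos := h.weight.hat_pos r hr
  calc ∫⁻ s in Ioo r 1, ENNReal.ofReal s * ENNReal.ofReal (tildeProfile ω s)
      ≤ ∫⁻ s in Ioo r 1, ENNReal.ofReal (C * hat ω r / (1 - r) ^ γ) *
          ENNReal.ofReal ((1 - s) ^ (γ - 1)) := by
        refine setLIntegral_mono' measurableSet_Ioo fun s hs => ?_
        have hs' : s ∈ Ico (0 : ℝ) 1 := ⟨hr.1.trans hs.1.le, hs.2⟩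
        have h1s : 0 < 1 - s := by linarith [hs.2]
        rw [← ENNReal.ofReal_mul (p := C * hat ω r / (1 - r) ^ γ) (by positivity)]
        refine (mul_le_of_le_one_left' (ENNReal.ofReal_le_one.2 hs.2.le)).trans ?_
        refine ENNReal.ofReal_le_ofReal ?_
        rw [tildeProfile_of_mem hs', Real.rpow_sub_one h1s.ne', ← mul_div_assoc]
        gcongr
        have := hlow r s hr.1 hs.1.le hs.2
        rw [Real.div_rpow h1s.le h1r.le] at this
        calc hat ω s ≤ _ := this
          _ = _ := by ring
    _ = ENNReal.ofReal (C * hat ω r / (1 - r) ^ γ) * ENNReal.ofReal ((1 - r) ^ γ / γ) := by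
        rw [lintegral_const_mul' _ _ ENNReal.ofReal_ne_top,
          lintegral_Ioo_reflect (fun x => ENNReal.ofReal (x ^ (γ - 1))),
          lintegral_rpow_Ioo (by linarith) h1r.le, sub_add_cancel]
    _ ≤ _ := by
        rw [← ENNReal.ofReal_mul (by positivity), ← ENNReal.ofReal_mul (by positivity)]
        apply le_of_eq
        congr 1
        have : (1 - r) ^ γ ≠ 0 := (Real.rpow_pos_of_pos h1r _).ne'
        field_simp

/-- It suffices to keep the interval from `(1 + r) / 2` to `(3 + r) / 4`, of length `(1 - r) / 4`:
there `s / (1 - s) ≥ 1 / (1 - r)`, and upper doubling makes `ω̂` comparable to `ω̂(r)`. -/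
theorem ClassD.le_tilde_tail (h : ClassD ω) : ∃ C : ℝ, 0 < C ∧ ∀ r ∈ Ico (0 : ℝ) 1,
    ENNReal.ofReal (hat ω r) ≤
      ENNReal.ofReal C * ∫⁻ s in Ioo r 1, ENNReal.ofReal s * ENNReal.ofReal (tildeProfile ω s) := by
  obtain ⟨C, β, hC, hβ, hup⟩ := h.upper_power
  refine ⟨C * 4 ^ β * 4, by positivity, fun r hr => ?_⟩
  have h1r : 0 < 1 - r := by linarith [hr.2]
  set a := (1 + r) / 2
  set b := (3 + r) / 4
  have hb : b ∈ Ico (0 : ℝ) 1 := ⟨by simp only [b]; linarith [hr.1], by simp only [b]; linarith⟩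
  have h2 := hup r b hr.1 (by simp only [b]; linarith) hb.2
  have h3 : (1 - r) / (1 - b) = 4 := by
    rw [show 1 - b = (1 - r) / 4 by simp only [b]; ring]
    field_simp
  rw [h3] at h2
  have hpos := h.weight.hat_pos b hb
  calc ENNReal.ofReal (hat ω r)
      ≤ ENNReal.ofReal (C * 4 ^ β * hat ω b) := ENNReal.ofReal_le_ofReal h2
    _ = ENNReal.ofReal (C * 4 ^ β * 4) *
          ∫⁻ s in Ioo a b, ENNReal.ofReal (hat ω b / (1 - r)) := by
        rw [lintegral_const, Measure.restrict_apply_univ, Real.volume_Ioo,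
          ← ENNReal.ofReal_mul (by positivity), ← ENNReal.ofReal_mul (by positivity)]
        congr 1
        simp only [a, b]
        field_simp
        ring
    _ ≤ ENNReal.ofReal (C * 4 ^ β * 4) *
          ∫⁻ s in Ioo a b, ENNReal.ofReal s * ENNReal.ofReal (tildeProfile ω s) := by
        gcongr ENNReal.ofReal (C * 4 ^ β * 4) * ?_
        refine setLIntegral_mono' measurableSet_Ioo fun s hs => ?_
        have hsa : (1 + r) / 2 < s := hs.1
        have hs' : s ∈ Ico (0 : ℝ) 1 := ⟨by linarith [hr.1], hs.2.trans hb.2⟩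
        have h1s : 0 < 1 - s := by linarith [hs'.2]
        rw [tildeProfile_of_mem hs', ← ENNReal.ofReal_mul hs'.1]
        refine ENNReal.ofReal_le_ofReal ?_
        have h4 := h.weight.hat_anti hs'.1 hs.2.le hb.2
        rw [← mul_div_assoc, div_le_div_iff₀ h1r h1s]
        have h5 : hat ω b * (1 - s) ≤ hat ω s * (1 - s) := by gcongr
        have h6 : 1 - s ≤ s * (1 - r) := by nlinarith [hr.1, hs'.1]
        have h7 : hat ω s * (1 - s) ≤ hat ω s * (s * (1 - r)) := by
          have := hpos.trans_le h4
          gcongr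
        linarith
    _ ≤ _ := by
        gcongr
        · simp only [a]; linarith [hr.2]
        · exact hb.2.le

/-- For analytic functions, the `L^p` norms with respect to `ω` and `ω̃` are comparable. -/
theorem ClassD.exists_lintegral_tilde_le (h : ClassD ω) (hm : Measurable ω) :
    ∃ C : ℝ≥0, 0 < C ∧ ∀ (f : ℂ → ℂ) (p : ℝ), 0 < p → DifferentiableOn ℂ f disc →
      ∫⁻ z, ‖f z‖ₑ ^ p ∂(weighted (tilde ω)) ≤ C * ∫⁻ z, ‖f z‖ₑ ^ p ∂(radialMeasure ω) := by
  obtain ⟨C₁, hC₁, h₁⟩ := h.tilde_tail_le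
  obtain ⟨C₂, hC₂, h₂⟩ := h.le_tail
  refine ⟨(C₁ * C₂).toNNReal, Real.toNNReal_pos.2 (by positivity), fun f p hp hf => ?_⟩
  rw [weighted_tilde_eq]
  refine lintegral_radialMeasure_le_of_tail_le h.weight.measurable_tildeProfile hm (by simp)
    (fun r hr => ?_) hp hf
  refine (h₁ r hr).trans ?_
  change _ ≤ ENNReal.ofReal (C₁ * C₂) * _
  rw [ENNReal.ofReal_mul hC₁.le, mul_assoc]
  gcongr
  exact h₂ r hr

theorem ClassD.exists_lintegral_le_tilde (h : ClassD ω) (hm : Measurable ω) :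
    ∃ C : ℝ≥0, 0 < C ∧ ∀ (f : ℂ → ℂ) (p : ℝ), 0 < p → DifferentiableOn ℂ f disc →
      ∫⁻ z, ‖f z‖ₑ ^ p ∂(radialMeasure ω) ≤ C * ∫⁻ z, ‖f z‖ₑ ^ p ∂(weighted (tilde ω)) := by
  obtain ⟨C₂, hC₂, h₂⟩ := h.le_tilde_tail
  refine ⟨C₂.toNNReal, Real.toNNReal_pos.2 (by positivity), fun f p hp hf => ?_⟩
  rw [weighted_tilde_eq]
  exact lintegral_radialMeasure_le_of_tail_le hm h.weight.measurable_tildeProfile (by simp)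
    (fun r hr => (h.weight.tail_le hr).trans (h₂ r hr)) hp hf

/-- The `ω`-measure of a Carleson square is comparable to `(1 - |z|) ω̂(z)`. -/
theorem ClassD.exists_carlesonSquare (h : ClassD ω) (hm : Measurable ω) :
    ∃ C : ℝ, 0 < C ∧ ∀ z : ℂ, z ≠ 0 → ‖z‖ < 1 →
      radialMeasure ω (carlesonSquare z) ≤ ENNReal.ofReal ((1 - ‖z‖) * hat ω ‖z‖) ∧
      ENNReal.ofReal ((1 - ‖z‖) * hat ω ‖z‖) ≤
        ENNReal.ofReal C * radialMeasure ω (carlesonSquare z) := by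
  obtain ⟨C, hC, h₁⟩ := h.le_tail
  refine ⟨C, hC, fun z hz hz1 => ?_⟩
  have hmem : ‖z‖ ∈ Ico (0 : ℝ) 1 := ⟨norm_nonneg _, hz1⟩
  rw [radialMeasure_carlesonSquare hm hz hz1, ENNReal.ofReal_mul (by linarith)]
  constructor
  · gcongr
    exact h.weight.tail_le hmem
  · rw [mul_left_comm]
    gcongr
    exact h₁ _ hmem

end

/-! ### The kernel `|1 - āz|` -/

theorem norm_one_sub_conj_mul_comm (a z : ℂ) : ‖1 - conj a * z‖ = ‖1 - conj z * a‖ := by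
  rw [← Complex.norm_conj (1 - conj a * z)]
  simp [mul_comm]

theorem one_sub_norm_le_kernel {a z : ℂ} (ha : a ∈ disc) :
    1 - ‖z‖ ≤ ‖1 - conj a * z‖ := by
  have h1 := norm_sub_norm_le (1 : ℂ) (conj a * z)
  rw [norm_one, norm_mul, Complex.norm_conj] at h1
  have h2 : ‖a‖ * ‖z‖ ≤ 1 * ‖z‖ := by gcongr; exact (mem_disc.1 ha).le
  linarith

theorem one_sub_norm_le_kernel' {a z : ℂ} (hz : z ∈ disc) :
    1 - ‖a‖ ≤ ‖1 - conj a * z‖ := by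
  rw [norm_one_sub_conj_mul_comm]
  exact one_sub_norm_le_kernel hz

theorem one_sub_norm_pos {z : ℂ} (hz : z ∈ disc) : 0 < 1 - ‖z‖ := by linarith [mem_disc.1 hz]

theorem kernel_pos {a z : ℂ} (ha : a ∈ disc) (hz : z ∈ disc) : 0 < ‖1 - conj a * z‖ :=
  (one_sub_norm_pos hz).trans_le (one_sub_norm_le_kernel ha)

theorem kernel_sq_sub (a z : ℂ) :
    ‖1 - conj a * z‖ ^ 2 - ‖a - z‖ ^ 2 = (1 - ‖a‖ ^ 2) * (1 - ‖z‖ ^ 2) := by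
  simp only [← Complex.normSq_eq_norm_sq, Complex.normSq_apply, Complex.sub_re, Complex.sub_im,
    Complex.mul_re, Complex.mul_im, Complex.conj_re, Complex.conj_im, Complex.one_re,
    Complex.one_im]
  ring

theorem norm_sub_le_kernel {a z : ℂ} (ha : a ∈ disc) (hz : z ∈ disc) :
    ‖a - z‖ ≤ ‖1 - conj a * z‖ := by
  have ha' := mem_disc.1 ha
  have hz' := mem_disc.1 hz
  have h1 : 0 ≤ (1 - ‖a‖ ^ 2) * (1 - ‖z‖ ^ 2) := by
    apply mul_nonneg <;> nlinarith [norm_nonneg a, norm_nonneg z]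
  rw [← kernel_sq_sub] at h1
  exact le_of_sq_le_sq (by linarith) (norm_nonneg _)

/-- Write `1 - āz = (1 - āw) + ā(w - z)` and use `|w - z| ≤ |1 - w̄z|`. The kernel thus behaves like
a distance, which makes `Near` transitive up to constants. -/
theorem kernel_triangle {a w z : ℂ} (ha : a ∈ disc) (hw : w ∈ disc) (hz : z ∈ disc) :
    ‖1 - conj a * z‖ ≤ ‖1 - conj a * w‖ + ‖1 - conj w * z‖ := by
  have h1 : 1 - conj a * z = (1 - conj a * w) + conj a * (w - z) := by ring
  rw [h1]
  refine (norm_add_le _ _).trans ?_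
  gcongr
  rw [norm_mul, Complex.norm_conj]
  have h2 := norm_sub_le_kernel hw hz
  have h3 : ‖a‖ * ‖w - z‖ ≤ 1 * ‖w - z‖ := by gcongr; exact (mem_disc.1 ha).le
  linarith

/-- `a` and `z` are comparable points of the disc: their hyperbolic distance is bounded in terms
of `N`. -/
def Near (N : ℝ) (a z : ℂ) : Prop :=
  ‖1 - conj a * z‖ ≤ N * (1 - ‖a‖) ∧ ‖1 - conj a * z‖ ≤ N * (1 - ‖z‖)

theorem Near.symm {N : ℝ} {a z : ℂ} (h : Near N a z) : Near N z a := by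
  rw [Near, norm_one_sub_conj_mul_comm z a]
  exact ⟨h.2, h.1⟩

theorem Near.le_left {N : ℝ} {a z : ℂ} (ha : a ∈ disc) (h : Near N a z) :
    1 - ‖z‖ ≤ N * (1 - ‖a‖) := (one_sub_norm_le_kernel ha).trans h.1

theorem Near.le_right {N : ℝ} {a z : ℂ} (hz : z ∈ disc) (h : Near N a z) :
    1 - ‖a‖ ≤ N * (1 - ‖z‖) := h.symm.le_left hz

theorem Near.nonneg {N : ℝ} {a z : ℂ} (ha : a ∈ disc) (h : Near N a z) : 0 ≤ N := by
  have h1 := (norm_nonneg _).trans h.1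
  exact nonneg_of_mul_nonneg_left h1 (one_sub_norm_pos ha)

theorem Near.trans {N M : ℝ} {a w z : ℂ} (ha : a ∈ disc) (hw : w ∈ disc) (hz : z ∈ disc)
    (h₁ : Near N a w) (h₂ : Near M w z) : Near ((N + M) * max N M) a z := by
  have hN := h₁.nonneg ha
  have hM := h₂.nonneg hw
  have h3 : ‖1 - conj a * z‖ ≤ (N + M) * (1 - ‖w‖) := by
    have := kernel_triangle ha hw hz
    linarith [h₁.2, h₂.1]
  have hpa := one_sub_norm_pos ha
  have hpz := one_sub_norm_pos hz
  constructor
  · calc ‖1 - conj a * z‖ ≤ (N + M) * (1 - ‖w‖) := h3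
      _ ≤ (N + M) * (max N M * (1 - ‖a‖)) := by
        gcongr
        exact (h₁.le_left ha).trans (by gcongr; exact le_max_left _ _)
      _ = _ := by ring
  · calc ‖1 - conj a * z‖ ≤ (N + M) * (1 - ‖w‖) := h3
      _ ≤ (N + M) * (max N M * (1 - ‖z‖)) := by
        gcongr
        exact (h₂.le_right hz).trans (by gcongr; exact le_max_right _ _)
      _ = _ := by ring

theorem mem_disc_of_norm_sub_le {b z : ℂ} {t : ℝ} (hb : b ∈ disc) (ht : t < 1)
    (hz : ‖z - b‖ ≤ t * (1 - ‖b‖)) : z ∈ disc := by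
  have h1 := norm_sub_norm_le z b
  have := one_sub_norm_pos hb
  rw [mem_disc]
  nlinarith

/-- The constant comes from `|1 - b̄z| ≤ (1 - |b|²) + |z - b| ≤ (5/2)(1 - |b|)`, together with `1 -
|z| ≥ (1 - |b|) / 2`. -/
theorem near_of_norm_sub_le {b z : ℂ} {t : ℝ} (hb : b ∈ disc) (ht : t ≤ 1 / 2)
    (hz : ‖z - b‖ ≤ t * (1 - ‖b‖)) : Near 5 b z := by
  have hpos := one_sub_norm_pos hb
  have hb' := mem_disc.1 hb
  have h1 := norm_sub_norm_le z b
  have h2 : ‖1 - conj b * z‖ ≤ 5 / 2 * (1 - ‖b‖) := by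
    have h3 : 1 - conj b * z = ((1 - ‖b‖ ^ 2 : ℝ) : ℂ) - conj b * (z - b) := by
      rw [← Complex.normSq_eq_norm_sq]
      push_cast
      rw [Complex.normSq_eq_conj_mul_self]
      ring
    rw [h3]
    refine (norm_sub_le _ _).trans ?_
    rw [norm_mul, Complex.norm_conj, Complex.norm_real, Real.norm_of_nonneg
      (by nlinarith [norm_nonneg b])]
    have h4 : ‖b‖ * ‖z - b‖ ≤ 1 * ‖z - b‖ := by gcongr
    nlinarith [norm_nonneg b]
  exact ⟨by linarith, by nlinarith⟩

/-- The identity `kernel_sq_sub` gives `(1 - r²)|1 - āz|² ≤ 4(1 - |a|)(1 - |z|)`; dividing by `|1 -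
āz|`, which dominates both factors on the right, yields the two inequalities. -/
theorem near_of_mem_pseudoDisc {a z : ℂ} {r : ℝ} (ha : a ∈ disc) (hr : r ∈ Ioo (0 : ℝ) 1)
    (hz : z ∈ pseudoDisc a r) : Near (4 / (1 - r ^ 2)) a z := by
  obtain ⟨hz1, hz2⟩ := hz
  have hX := kernel_pos ha hz1
  have hr2 : 0 < 1 - r ^ 2 := by nlinarith [hr.1, hr.2]
  rw [norm_div, div_lt_iff₀ hX] at hz2
  have h1 := kernel_sq_sub a z
  have hpa := one_sub_norm_pos ha
  have hpz := one_sub_norm_pos hz1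
  have h2 : ‖a - z‖ ^ 2 ≤ (r * ‖1 - conj a * z‖) ^ 2 := by gcongr
  have h3 : (1 - r ^ 2) * ‖1 - conj a * z‖ ^ 2 ≤ 4 * ((1 - ‖a‖) * (1 - ‖z‖)) := by
    have h4 : (1 - ‖a‖ ^ 2) * (1 - ‖z‖ ^ 2) ≤ (2 * (1 - ‖a‖)) * (2 * (1 - ‖z‖)) := by
      apply mul_le_mul <;> nlinarith [norm_nonneg a, norm_nonneg z]
    nlinarith
  constructor
  · rw [div_mul_eq_mul_div, le_div_iff₀ hr2]
    have h5 := one_sub_norm_le_kernel (z := z) ha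
    have h6 : (1 - ‖a‖) * (1 - ‖z‖) ≤ (1 - ‖a‖) * ‖1 - conj a * z‖ := by gcongr
    refine le_of_mul_le_mul_right ?_ hX
    nlinarith
  · rw [div_mul_eq_mul_div, le_div_iff₀ hr2]
    have h5 := one_sub_norm_le_kernel' (a := a) hz1
    have h6 : (1 - ‖a‖) * (1 - ‖z‖) ≤ ‖1 - conj a * z‖ * (1 - ‖z‖) := by gcongr
    refine le_of_mul_le_mul_right ?_ hX
    nlinarith

theorem mem_pseudoDisc_of_norm_sub_lt {a z : ℂ} {r : ℝ} (ha : a ∈ disc) (hz : z ∈ disc)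
    (h : ‖a - z‖ < r * (1 - ‖z‖)) (hr : 0 ≤ r) : z ∈ pseudoDisc a r := by
  refine ⟨hz, ?_⟩
  rw [norm_div, div_lt_iff₀ (kernel_pos ha hz)]
  refine h.trans_le ?_
  gcongr
  exact one_sub_norm_le_kernel ha

/-! ### Forelli–Rudin type estimates -/

/-- Split at `x = h`: below, `(h + x)^(-M)` is at most `h^(-M)`, and above, at most `x^(-M)`. The
hypotheses on the exponents are integrability at 0 and at infinity. -/
theorem exists_lintegral_rpow_mul_add_rpow_le {α M : ℝ} (hα : -1 < α) (hM : α + 1 < M) :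
    ∃ C : ℝ, 0 < C ∧ ∀ h : ℝ, 0 < h →
      ∫⁻ x in Ioi 0, ENNReal.ofReal (x ^ α * (h + x) ^ (-M)) ≤
        ENNReal.ofReal (C * h ^ (α + 1 - M)) := by
  have h1 : 0 < α + 1 := by linarith
  have h2 : 0 < M - α - 1 := by linarith
  refine ⟨1 / (α + 1) + 1 / (M - α - 1), by positivity, fun h hh => ?_⟩
  have hM0 : 0 < M := by linarith
  calc ∫⁻ x in Ioi 0, ENNReal.ofReal (x ^ α * (h + x) ^ (-M))
      ≤ ∫⁻ x in Ioo 0 h ∪ Ici h, ENNReal.ofReal (x ^ α * (h + x) ^ (-M)) := by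
        refine lintegral_mono_set fun x hx => ?_
        rcases lt_or_ge x h with h' | h'
        · exact Or.inl ⟨hx, h'⟩
        · exact Or.inr h'
    _ ≤ (∫⁻ x in Ioo 0 h, ENNReal.ofReal (x ^ α * (h + x) ^ (-M))) +
        ∫⁻ x in Ici h, ENNReal.ofReal (x ^ α * (h + x) ^ (-M)) := lintegral_union_le _ _ _
    _ ≤ (∫⁻ x in Ioo 0 h, ENNReal.ofReal (h ^ (-M)) * ENNReal.ofReal (x ^ α)) +
        ∫⁻ x in Ici h, ENNReal.ofReal (x ^ (α - M)) := by
        gcongr ?_ + ?_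
        · refine setLIntegral_mono' measurableSet_Ioo fun x hx => ?_
          rw [← ENNReal.ofReal_mul (by positivity), mul_comm]
          refine ENNReal.ofReal_le_ofReal ?_
          have := Real.rpow_nonneg hx.1.le α
          gcongr ?_ * _
          exact Real.rpow_le_rpow_of_nonpos hh (by linarith [hx.1]) (by linarith)
        · refine setLIntegral_mono' measurableSet_Ici fun x (hx : h ≤ x) => ?_
          have hx0 : 0 < x := hh.trans_le hx
          refine ENNReal.ofReal_le_ofReal ?_
          rw [sub_eq_add_neg, Real.rpow_add hx0]
          gcongr ?_ * ?_
          exact Real.rpow_le_rpow_of_nonpos hx0 (by linarith) (by linarith)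
    _ = ENNReal.ofReal ((1 / (α + 1) + 1 / (M - α - 1)) * h ^ (α + 1 - M)) := by
        rw [lintegral_const_mul' _ _ ENNReal.ofReal_ne_top, lintegral_rpow_Ioo hα hh.le,
          setLIntegral_congr Ioi_ae_eq_Ici.symm,
          ← ofReal_integral_eq_lintegral_ofReal, integral_Ioi_rpow_of_lt (by linarith) hh,
          ← ENNReal.ofReal_mul (by positivity), ← ENNReal.ofReal_add]
        · congr 1
          have e : h ^ (-M) * h ^ (α + 1) = h ^ (α + 1 - M) := by
            rw [← Real.rpow_add hh]
            congr 1
            ring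
          rw [← mul_div_assoc, e, neg_div, ← div_neg, show α - M + 1 = α + 1 - M by ring,
            show -(α + 1 - M) = M - α - 1 by ring]
          ring
        · positivity
        · rw [neg_div, ← div_neg]
          apply div_nonneg
          · positivity
          · linarith
        · exact integrableOn_Ioi_rpow_of_lt (by linarith) hh
        · exact (ae_restrict_iff' measurableSet_Ioi).2
            (Eventually.of_forall fun x hx => Real.rpow_nonneg (hh.le.trans (le_of_lt hx)) _)

/-- From `|1 - ρe^(iθ)|² = (1 - ρ)² + 2ρ(1 - cos θ)` and `1 - cos θ ≥ 2θ²/π²`. When `ρ` is small the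
first term takes over, since `θ` is bounded; the constant 7 is not optimal. -/
theorem abs_div_le_norm_one_sub {ρ θ : ℝ} (hρ : 0 ≤ ρ) (hρ1 : ρ ≤ 1) (hθ : |θ| ≤ Real.pi) :
    |θ| / 7 ≤ ‖1 - circleMap 0 ρ θ‖ := by
  have h1 : ‖1 - circleMap 0 ρ θ‖ ^ 2 = (1 - ρ) ^ 2 + 2 * ρ * (1 - Real.cos θ) := by
    rw [← Complex.normSq_eq_norm_sq, Complex.normSq_apply]
    simp only [circleMap, zero_add, Complex.sub_re, Complex.sub_im, Complex.one_re,
      Complex.one_im, Complex.re_ofReal_mul, Complex.im_ofReal_mul, Complex.exp_ofReal_mul_I_re,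
      Complex.exp_ofReal_mul_I_im]
    nlinarith [Real.sin_sq_add_cos_sq θ]
  have h2 := Real.cos_le_one_sub_mul_cos_sq hθ
  have hπ := Real.pi_gt_three
  have hπ2 := Real.pi_lt_d2
  have h3 : θ ^ 2 / 5 ≤ 2 / Real.pi ^ 2 * θ ^ 2 := by
    rw [div_mul_eq_mul_div, div_le_div_iff₀ (by norm_num) (by positivity)]
    have : θ ^ 2 * Real.pi ^ 2 ≤ θ ^ 2 * 10 := by
      gcongr
      nlinarith
    linarith
  have h4 : θ ^ 2 ≤ 10 := by
    rw [← sq_abs]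
    nlinarith [abs_nonneg θ]
  apply le_of_sq_le_sq _ (norm_nonneg _)
  rw [h1, div_pow, sq_abs]
  have h5 : 2 * ρ * (θ ^ 2 / 5) ≤ 2 * ρ * (1 - Real.cos θ) := by
    gcongr
    linarith
  nlinarith [sq_nonneg (1 - ρ), sq_nonneg θ]

theorem setLIntegral_abs_le (g : ℝ → ℝ≥0∞) (c : ℝ) :
    ∫⁻ θ in Ioo (-c) c, g |θ| ≤ 2 * ∫⁻ x in Ioi 0, g x := by
  have h1 : ∫⁻ θ in Iio (0 : ℝ), g |θ| = ∫⁻ x in Ioi 0, g x := by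
    have h := (Measure.measurePreserving_neg (volume : Measure ℝ)).setLIntegral_comp_preimage_emb
      (MeasurableEquiv.neg ℝ).measurableEmbedding g (Ioi 0)
    rw [← h]
    have : (Neg.neg ⁻¹' Ioi 0 : Set ℝ) = Iio 0 := by ext; simp
    rw [this]
    exact setLIntegral_congr_fun measurableSet_Iio fun x hx => by
      simp only [abs_of_neg (show x < 0 from hx)]
  have h2 : ∫⁻ θ in Ici (0 : ℝ), g |θ| = ∫⁻ x in Ioi 0, g x := by
    rw [setLIntegral_congr Ioi_ae_eq_Ici.symm]
    exact setLIntegral_congr_fun measurableSet_Ioi fun x hx => by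
      simp only [abs_of_pos (show 0 < x from hx)]
  calc ∫⁻ θ in Ioo (-c) c, g |θ| ≤ ∫⁻ θ in Iio 0 ∪ Ici 0, g |θ| :=
        lintegral_mono_set fun x _ => lt_or_ge x 0
    _ ≤ _ := lintegral_union_le _ _ _
    _ = _ := by rw [h1, h2, two_mul]

/-- The Forelli–Rudin estimate. -/
theorem exists_forelliRudin {α N : ℝ} (hα : -1 < α) (hN : α + 2 < N) :
    ∃ C : ℝ, 0 < C ∧ ∀ a ∈ disc,
      ∫⁻ z in disc, ENNReal.ofReal ((1 - ‖z‖) ^ α * ‖1 - conj a * z‖ ^ (-N)) ≤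
        ENNReal.ofReal (C * (1 - ‖a‖) ^ (α + 2 - N)) := by
  -- The surplus of `N` is shared equally, `N = (α + 1 + ε) + (1 + ε)`, so that the bound factors
  -- into a convergent radial integral and a convergent angular one.
  set ε := (N - α - 2) / 2
  have hε : 0 < ε := by simp only [ε]; linarith
  obtain ⟨C₁, hC₁, h₁⟩ := exists_lintegral_rpow_mul_add_rpow_le (α := 0) (M := 1 + ε)
    (by norm_num) (by linarith)
  obtain ⟨C₂, hC₂, h₂⟩ := exists_lintegral_rpow_mul_add_rpow_le (α := α) (M := α + 1 + ε)
    hα (by linarith)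
  refine ⟨8 ^ N * (2 * C₁) * C₂, by positivity, fun a ha => ?_⟩
  have hh := one_sub_norm_pos ha
  set h := 1 - ‖a‖
  -- A rotation reduces to the case where the parameter is real and nonnegative.
  obtain ⟨u, hu, hau⟩ : ∃ u : ℂ, ‖u‖ = 1 ∧ conj a * u = ‖a‖ := by
    rcases eq_or_ne a 0 with rfl | h0
    · exact ⟨1, by simp, by simp⟩
    · have hn : (‖a‖ : ℂ) ≠ 0 := by exact_mod_cast (norm_pos_iff.2 h0).ne'
      refine ⟨a / ‖a‖, by simp [h0], ?_⟩
      rw [← mul_div_assoc, ← Complex.normSq_eq_conj_mul_self, Complex.normSq_eq_norm_sq]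
      push_cast
      field_simp
  have hmeas : Measurable ((Metric.ball (0 : ℂ) 1).indicator fun z =>
      ENNReal.ofReal ((1 - ‖u * z‖) ^ α * ‖1 - conj a * (u * z)‖ ^ (-N))) := by
    refine Measurable.indicator ?_ measurableSet_ball
    fun_prop
  have hpt : ∀ s ∈ Ioo (0 : ℝ) 1, ∀ θ ∈ Ioo (-Real.pi) Real.pi,
      (1 - ‖u * circleMap 0 s θ‖) ^ α * ‖1 - conj a * (u * circleMap 0 s θ)‖ ^ (-N) ≤
        8 ^ N * ((1 - s) ^ α * (h + (1 - s)) ^ (-(α + 1 + ε))) *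
          (|θ| ^ (0 : ℝ) * (h + |θ|) ^ (-(1 + ε))) := by
    intro s hs θ hθ
    have hs1 : 0 < 1 - s := by linarith [hs.2]
    have hcm : circleMap 0 s θ ∈ disc := by
      rw [mem_disc, norm_circleMap_zero, abs_of_pos hs.1]; exact hs.2
    have hucm : u * circleMap 0 s θ ∈ disc := by
      rw [mem_disc, norm_mul, hu, one_mul]; exact mem_disc.1 hcm
    have hnorm : ‖u * circleMap 0 s θ‖ = s := by
      rw [norm_mul, hu, one_mul, norm_circleMap_zero, abs_of_pos hs.1]
    set X := ‖1 - conj a * (u * circleMap 0 s θ)‖ with hX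
    have hX1 : 1 - s ≤ X := by
      rw [← hnorm]; exact one_sub_norm_le_kernel ha
    have hX2 : h ≤ X := one_sub_norm_le_kernel' hucm
    have hX3 : |θ| / 7 ≤ X := by
      have h3 : conj a * (u * circleMap 0 s θ) = circleMap 0 (‖a‖ * s) θ := by
        rw [← mul_assoc, hau]
        simp [circleMap, mul_assoc]
      rw [hX, h3]
      refine abs_div_le_norm_one_sub (by have := hs.1; positivity) ?_ (abs_le.2 ⟨hθ.1.le, hθ.2.le⟩)
      have := (mem_disc.1 ha).le
      have := hs.2.le
      have := hs.1.le
      exact mul_le_one₀ (by assumption) (by assumption) (by assumption)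
    have hXpos : 0 < X := hh.trans_le hX2
    rw [hnorm, Real.rpow_zero, one_mul]
    have e1 : X ^ (-N) = X ^ (-(α + 1 + ε)) * X ^ (-(1 + ε)) := by
      rw [← Real.rpow_add hXpos]
      congr 1
      simp only [ε]
      ring
    have e2 : (8 : ℝ) ^ N = 8 ^ (α + 1 + ε) * 8 ^ (1 + ε) := by
      rw [← Real.rpow_add (by norm_num)]
      congr 1
      simp only [ε]
      ring
    -- Here 8 = 1 + 7: the kernel `X` dominates `h` and `|θ| / 7`, hence `h + |θ| ≤ 8X`; also `h +
    -- (1 - s) ≤ 2X`.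
    have k : ∀ y M : ℝ, 0 < y → 0 ≤ M → y ≤ 8 * X → X ^ (-M) ≤ 8 ^ M * y ^ (-M) := by
      intro y M hy hM hyX
      rw [Real.rpow_neg hXpos.le, Real.rpow_neg hy.le, ← div_eq_mul_inv, ← Real.div_rpow
        (by norm_num) hy.le, ← Real.inv_rpow hXpos.le]
      refine Real.rpow_le_rpow (by positivity) ?_ hM
      rw [inv_eq_one_div, div_le_div_iff₀ hXpos hy]
      linarith
    have k1 := k (h + (1 - s)) (α + 1 + ε) (by positivity) (by linarith) (by linarith)
    have k2 := k (h + |θ|) (1 + ε) (by positivity) (by linarith) (by linarith)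
    have hsα := Real.rpow_nonneg hs1.le α
    rw [e1, e2]
    calc (1 - s) ^ α * (X ^ (-(α + 1 + ε)) * X ^ (-(1 + ε)))
        ≤ (1 - s) ^ α * ((8 ^ (α + 1 + ε) * (h + (1 - s)) ^ (-(α + 1 + ε))) *
          (8 ^ (1 + ε) * (h + |θ|) ^ (-(1 + ε)))) := by gcongr
      _ = _ := by ring
  rw [← lintegral_disc_rotate hu, disc, lintegral_ball_eq_polar hmeas]
  calc ∫⁻ s in Ioo 0 1, ENNReal.ofReal s * ∫⁻ θ in Ioo (-Real.pi) Real.pi,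
        ENNReal.ofReal ((1 - ‖u * circleMap 0 s θ‖) ^ α *
          ‖1 - conj a * (u * circleMap 0 s θ)‖ ^ (-N))
      ≤ ∫⁻ s in Ioo 0 1, ENNReal.ofReal (8 ^ N) *
          ENNReal.ofReal ((1 - s) ^ α * (h + (1 - s)) ^ (-(α + 1 + ε))) *
            ENNReal.ofReal (2 * (C₁ * h ^ (-ε))) := by
        refine setLIntegral_mono' measurableSet_Ioo fun s hs => ?_
        have hs1 : 0 < 1 - s := by linarith [hs.2]
        have hsα := Real.rpow_nonneg hs1.le α
        refine (mul_le_of_le_one_left' (ENNReal.ofReal_le_one.2 hs.2.le)).trans ?_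
        calc _ ≤ ∫⁻ θ in Ioo (-Real.pi) Real.pi,
              ENNReal.ofReal (8 ^ N * ((1 - s) ^ α * (h + (1 - s)) ^ (-(α + 1 + ε)))) *
              ENNReal.ofReal (|θ| ^ (0 : ℝ) * (h + |θ|) ^ (-(1 + ε))) := by
              refine setLIntegral_mono' measurableSet_Ioo fun θ hθ => ?_
              rw [← ENNReal.ofReal_mul (by positivity)]
              exact ENNReal.ofReal_le_ofReal (hpt s hs θ hθ)
          _ ≤ ENNReal.ofReal (8 ^ N * ((1 - s) ^ α * (h + (1 - s)) ^ (-(α + 1 + ε)))) *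
              (2 * ENNReal.ofReal (C₁ * h ^ (0 + 1 - (1 + ε)))) := by
              rw [lintegral_const_mul' _ _ ENNReal.ofReal_ne_top]
              gcongr
              refine (setLIntegral_abs_le (fun x =>
                ENNReal.ofReal (x ^ (0 : ℝ) * (h + x) ^ (-(1 + ε)))) _).trans ?_
              gcongr
              exact h₁ h hh
          _ = _ := by
              rw [show (0 : ℝ) + 1 - (1 + ε) = -ε by ring, ENNReal.ofReal_mul (by positivity),
                ENNReal.ofReal_mul zero_le_two, ENNReal.ofReal_ofNat]
    _ ≤ ENNReal.ofReal (8 ^ N) * ENNReal.ofReal (C₂ * h ^ (-ε)) *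
          ENNReal.ofReal (2 * (C₁ * h ^ (-ε))) := by
        rw [lintegral_mul_const' _ _ ENNReal.ofReal_ne_top,
          lintegral_const_mul' _ _ ENNReal.ofReal_ne_top]
        gcongr
        rw [lintegral_Ioo_reflect
          (fun x => ENNReal.ofReal (x ^ α * (h + x) ^ (-(α + 1 + ε))))]
        refine (lintegral_mono_set fun x hx => hx.1).trans ((h₂ h hh).trans_eq ?_)
        rw [show α + 1 - (α + 1 + ε) = -ε by ring]
    _ = _ := by
        rw [← ENNReal.ofReal_mul (by positivity), ← ENNReal.ofReal_mul (by positivity)]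
        congr 1
        rw [show α + 2 - N = -ε + -ε by simp only [ε]; ring, Real.rpow_add hh]
        ring

/-! ### Kernel integrals against `ω̃`, and lattices -/

section

variable {ω : ℝ → ℝ}

/-- Integrals of powers of the normalised kernel against `ω̃`. -/
theorem ClassD.exists_kernel_integral (h : ClassD ω) : ∃ γ β : ℝ, 0 < γ ∧ γ ≤ β ∧
    ∀ η N : ℝ, η < γ → β - η + 1 < N → ∃ C : ℝ, 0 < C ∧ ∀ b ∈ disc,
      ∫⁻ z, ENNReal.ofReal ((1 - ‖z‖) ^ (-η) * ((1 - ‖b‖) / ‖1 - conj b * z‖) ^ N)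
        ∂(weighted (tilde ω)) ≤
      ENNReal.ofReal (C * ((1 - ‖b‖) * hat ω ‖b‖) * (1 - ‖b‖) ^ (-η)) := by
  obtain ⟨C, γ, β, hC, hγ, hγβ, hhat⟩ := h.exists_hat_le
  -- Replacing `ω̂(z)` by `ω̂(b)` times two powers leaves two Forelli–Rudin integrals. The condition
  -- `η < γ` is integrability at the boundary for the smaller power, and `β - η + 1 < N` is decay of
  -- the kernel for the larger.
  refine ⟨γ, β, hγ, hγβ, fun η N hη hN => ?_⟩
  obtain ⟨C₁, hC₁, h₁⟩ := exists_forelliRudin (α := γ - 1 - η) (N := N) (by linarith) (by linarith)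
  obtain ⟨C₂, hC₂, h₂⟩ := exists_forelliRudin (α := β - 1 - η) (N := N) (by linarith) (by linarith)
  refine ⟨C * (C₁ + C₂), by positivity, fun b hb => ?_⟩
  have hh := one_sub_norm_pos hb
  have hhb := h.weight.hat_pos _ (norm_mem_Ico hb)
  set x := 1 - ‖b‖
  rw [h.weight.lintegral_tilde]
  have key : ∀ κ : ℝ, ∀ z ∈ disc, C * hat ω ‖b‖ * ((1 - ‖z‖) / x) ^ κ / (1 - ‖z‖) *
      ((1 - ‖z‖) ^ (-η) * (x / ‖1 - conj b * z‖) ^ N) =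
      C * hat ω ‖b‖ * x ^ (N - κ) * ((1 - ‖z‖) ^ (κ - 1 - η) * ‖1 - conj b * z‖ ^ (-N)) := by
    intro κ z hz
    have hz' := one_sub_norm_pos hz
    have hX := kernel_pos hb hz
    rw [Real.div_rpow hz'.le hh.le, Real.div_rpow hh.le hX.le, Real.rpow_neg hX.le,
      Real.rpow_sub hh, show κ - 1 - η = κ + (-1) + (-η) by ring, Real.rpow_add hz',
      Real.rpow_add hz', Real.rpow_neg_one]
    field_simp
  have hcalc : ∀ κ C' : ℝ, x ^ (N - κ) * (C' * x ^ (κ - 1 - η + 2 - N)) = C' * x * x ^ (-η) := by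
    intro κ C'
    have : x ^ (N - κ) * x ^ (κ - 1 - η + 2 - N) = x * x ^ (-η) := by
      have e : x * x ^ (-η) = x ^ (1 + -η) := by rw [Real.rpow_add hh, Real.rpow_one]
      rw [← Real.rpow_add hh, e]
      congr 1
      ring
    calc _ = C' * (x ^ (N - κ) * x ^ (κ - 1 - η + 2 - N)) := by ring
      _ = _ := by rw [this]; ring
  calc ∫⁻ z in disc, ENNReal.ofReal (tilde ω z) *
        ENNReal.ofReal ((1 - ‖z‖) ^ (-η) * (x / ‖1 - conj b * z‖) ^ N)
      ≤ ∫⁻ z in disc, (ENNReal.ofReal (C * hat ω ‖b‖ * x ^ (N - γ)) *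
          ENNReal.ofReal ((1 - ‖z‖) ^ (γ - 1 - η) * ‖1 - conj b * z‖ ^ (-N)) +
          ENNReal.ofReal (C * hat ω ‖b‖ * x ^ (N - β)) *
          ENNReal.ofReal ((1 - ‖z‖) ^ (β - 1 - η) * ‖1 - conj b * z‖ ^ (-N))) := by
        refine setLIntegral_mono' measurableSet_disc fun z hz => ?_
        have hz' := one_sub_norm_pos hz
        have hX := kernel_pos hb hz
        rw [← ENNReal.ofReal_mul (h.weight.tilde_pos hz).le, ← ENNReal.ofReal_mul (by positivity),
          ← ENNReal.ofReal_mul (by positivity), ← ENNReal.ofReal_add (by positivity)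
          (by positivity), ← key γ z hz, ← key β z hz]
        refine ENNReal.ofReal_le_ofReal ?_
        rw [← add_mul, ← add_div, ← mul_add, tilde]
        gcongr
        exact hhat _ (norm_mem_Ico hz) _ (norm_mem_Ico hb)
    _ ≤ ENNReal.ofReal (C * hat ω ‖b‖ * x ^ (N - γ)) *
          ENNReal.ofReal (C₁ * x ^ (γ - 1 - η + 2 - N)) +
          ENNReal.ofReal (C * hat ω ‖b‖ * x ^ (N - β)) *
          ENNReal.ofReal (C₂ * x ^ (β - 1 - η + 2 - N)) := by
        rw [lintegral_add_left, lintegral_const_mul' _ _ ENNReal.ofReal_ne_top,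
          lintegral_const_mul' _ _ ENNReal.ofReal_ne_top]
        · gcongr
          · exact h₁ b hb
          · exact h₂ b hb
        · fun_prop
    _ = _ := by
        rw [← ENNReal.ofReal_mul (by positivity), ← ENNReal.ofReal_mul (by positivity),
          ← ENNReal.ofReal_add (by positivity) (by positivity)]
        congr 1
        rw [mul_assoc, hcalc γ, mul_assoc (C * hat ω ‖b‖) (x ^ (N - β)), hcalc β]
        ring

/-! ### Lattices in the disc -/

/-- A `c`-lattice: Whitney balls of relative radius `c` around its points are disjoint, and those
of relative radius `5c` cover the disc. -/
structure IsLattice (c : ℝ) (u : Set ℂ) : Prop where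
  subset : u ⊆ disc
  countable : u.Countable
  disjoint : u.PairwiseDisjoint fun b => Metric.closedBall b (c * (1 - ‖b‖))
  cover : ∀ z ∈ disc, ∃ b ∈ u, ‖z - b‖ ≤ 5 * c * (1 - ‖b‖)

/-- Vitali's covering lemma with radii `c (1 - |b|)`. Disjoint balls with nonempty interior are
countable in number, and the enlargement factor 5 is the one in the covering property. -/
theorem exists_isLattice {c : ℝ} (hc : 0 < c) : ∃ u, IsLattice c u := by
  obtain ⟨u, hu, hd, hcov⟩ := Vitali.exists_disjoint_subfamily_covering_enlargement_closedBall
    disc (fun b : ℂ => b) (fun b => c * (1 - ‖b‖)) c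
    (fun b hb => mul_le_of_le_one_right hc.le (by linarith [norm_nonneg b])) 5 (by norm_num)
  have hpos : ∀ b ∈ disc, 0 < c * (1 - ‖b‖) := fun b hb => mul_pos hc (one_sub_norm_pos hb)
  refine ⟨u, hu, ?_, hd, fun z hz => ?_⟩
  · refine hd.countable_of_nonempty_interior fun b hb => ?_
    exact ⟨b, interior_mono Metric.ball_subset_closedBall (by
      rw [Metric.isOpen_ball.interior_eq]
      exact Metric.mem_ball_self (hpos b (hu hb)))⟩
  · obtain ⟨b, hb, hsub⟩ := hcov z hz
    refine ⟨b, hb, ?_⟩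
    have := hsub (Metric.mem_closedBall_self (hpos z hz).le)
    rw [Metric.mem_closedBall, dist_eq_norm] at this
    linarith

theorem volume_closedBall_eq (b : ℂ) {r : ℝ} (hr : 0 ≤ r) :
    volume (Metric.closedBall b r) = ENNReal.ofReal (Real.pi * r ^ 2) := by
  rw [Complex.volume_closedBall, mul_comm Real.pi, ENNReal.ofReal_mul (by positivity),
    ENNReal.ofReal_pow hr, ← NNReal.coe_real_pi, ENNReal.ofReal_coe_nnreal]

/-- Kernel sums over a lattice. -/
theorem IsLattice.exists_sum_le {c δ : ℝ} (hc : 0 < c) (hc1 : c < 1) {u : Set ℂ}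
    (hu : IsLattice c u) (hδ : 0 < δ) (hδ1 : δ < 1) : ∃ C : ℝ, 0 < C ∧
      ∀ F : Finset ℂ, ↑F ⊆ u → ∀ z ∈ disc,
        ∑ b ∈ F, (1 - ‖b‖) ^ (-δ) * ((1 - ‖b‖) / ‖1 - conj b * z‖) ^ (2 : ℝ) ≤
          C * (1 - ‖z‖) ^ (-δ) := by
  -- The sum is a Riemann sum for this integral over disjoint balls. Convergence needs `δ < 1` for
  -- the weight and `δ > 0` for the kernel exponent 2.
  obtain ⟨C, hC, hFR⟩ := exists_forelliRudin (α := -δ) (N := 2) (by linarith) (by linarith)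
  refine ⟨8 * C / (Real.pi * c ^ 2), by have := Real.pi_pos; positivity, fun F hF z hz => ?_⟩
  have hπ := Real.pi_pos
  have hFd : ∀ b ∈ F, b ∈ disc := fun b hb => hu.subset (hF hb)
  have hz' := one_sub_norm_pos hz
  -- On the ball about `b`, both `1 - |w|` and `|1 - z̄w|` are at most twice their values at `b`.
  -- Their negative powers cost a factor 2 and a factor 4, hence the 8.
  have hterm : ∀ b ∈ F, ENNReal.ofReal (Real.pi * c ^ 2 / 8 * ((1 - ‖b‖) ^ (-δ) *
      ((1 - ‖b‖) / ‖1 - conj b * z‖) ^ (2 : ℝ))) ≤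
      ∫⁻ w in Metric.closedBall b (c * (1 - ‖b‖)),
        ENNReal.ofReal ((1 - ‖w‖) ^ (-δ) * ‖1 - conj z * w‖ ^ (-2 : ℝ)) := by
    intro b hb
    have hbd := hFd b hb
    have hb' := one_sub_norm_pos hbd
    have hX := kernel_pos hbd hz
    calc ENNReal.ofReal (Real.pi * c ^ 2 / 8 * ((1 - ‖b‖) ^ (-δ) *
          ((1 - ‖b‖) / ‖1 - conj b * z‖) ^ (2 : ℝ)))
        = ∫⁻ w in Metric.closedBall b (c * (1 - ‖b‖)),
            ENNReal.ofReal (1 / 8 * (1 - ‖b‖) ^ (-δ) * ‖1 - conj b * z‖ ^ (-2 : ℝ)) := by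
          rw [setLIntegral_const, volume_closedBall_eq _ (by positivity),
            ← ENNReal.ofReal_mul (by positivity)]
          congr 1
          rw [Real.div_rpow hb'.le hX.le, Real.rpow_neg hX.le, Real.rpow_two]
          ring
      _ ≤ _ := by
          refine setLIntegral_mono' measurableSet_closedBall fun w hw => ?_
          rw [Metric.mem_closedBall, dist_eq_norm] at hw
          have hwd := mem_disc_of_norm_sub_le hbd hc1 hw
          have hw' := one_sub_norm_pos hwd
          have hXw := kernel_pos hz hwd
          have e1 : 1 - ‖w‖ ≤ 2 * (1 - ‖b‖) := by
            have := norm_sub_norm_le b w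
            rw [norm_sub_rev] at this
            nlinarith
          have e2 : ‖1 - conj z * w‖ ≤ 2 * ‖1 - conj b * z‖ := by
            have e3 : 1 - conj z * w = (1 - conj z * b) - conj z * (w - b) := by ring
            rw [e3, norm_one_sub_conj_mul_comm b z]
            refine (norm_sub_le _ _).trans ?_
            rw [norm_mul, Complex.norm_conj]
            have e4 : ‖z‖ * ‖w - b‖ ≤ 1 * ‖w - b‖ := by gcongr; exact (mem_disc.1 hz).le
            have e5 := one_sub_norm_le_kernel (z := b) hz
            nlinarith
          refine ENNReal.ofReal_le_ofReal ?_
          have e6 : 1 / 2 * (1 - ‖b‖) ^ (-δ) ≤ (1 - ‖w‖) ^ (-δ) := by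
            calc 1 / 2 * (1 - ‖b‖) ^ (-δ) ≤ 2 ^ (-δ) * (1 - ‖b‖) ^ (-δ) := by
                  gcongr
                  rw [one_div, ← Real.rpow_neg_one]
                  exact Real.rpow_le_rpow_of_exponent_le (by norm_num) (by linarith)
              _ = (2 * (1 - ‖b‖)) ^ (-δ) := by rw [Real.mul_rpow zero_le_two hb'.le]
              _ ≤ _ := Real.rpow_le_rpow_of_nonpos hw' e1 (by linarith)
          have e7 : 1 / 4 * ‖1 - conj b * z‖ ^ (-2 : ℝ) ≤ ‖1 - conj z * w‖ ^ (-2 : ℝ) := by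
            calc 1 / 4 * ‖1 - conj b * z‖ ^ (-2 : ℝ) = (2 * ‖1 - conj b * z‖) ^ (-2 : ℝ) := by
                  rw [Real.mul_rpow zero_le_two hX.le]
                  norm_num
              _ ≤ _ := Real.rpow_le_rpow_of_nonpos hXw e2 (by norm_num)
          calc 1 / 8 * (1 - ‖b‖) ^ (-δ) * ‖1 - conj b * z‖ ^ (-2 : ℝ)
              = (1 / 2 * (1 - ‖b‖) ^ (-δ)) * (1 / 4 * ‖1 - conj b * z‖ ^ (-2 : ℝ)) := by ring
            _ ≤ _ := by gcongr
  have hsum : ENNReal.ofReal (Real.pi * c ^ 2 / 8 * ∑ b ∈ F, (1 - ‖b‖) ^ (-δ) *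
      ((1 - ‖b‖) / ‖1 - conj b * z‖) ^ (2 : ℝ)) ≤ ENNReal.ofReal (C * (1 - ‖z‖) ^ (-δ)) := by
    rw [Finset.mul_sum, ENNReal.ofReal_sum_of_nonneg fun b hb => by
      have := one_sub_norm_pos (hFd b hb)
      positivity]
    refine (Finset.sum_le_sum hterm).trans ?_
    rw [← lintegral_biUnion_finset (fun b hb b' hb' hbb' => hu.disjoint (hF hb) (hF hb') hbb')
      fun b _ => measurableSet_closedBall]
    refine (lintegral_mono_set ?_).trans ((hFR z hz).trans_eq (by
      rw [show -δ + 2 - 2 = -δ by ring]))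
    refine iUnion₂_subset fun b hb w hw => ?_
    rw [Metric.mem_closedBall, dist_eq_norm] at hw
    exact mem_disc_of_norm_sub_le (hFd b hb) hc1 hw
  rw [ENNReal.ofReal_le_ofReal_iff (by positivity)] at hsum
  rw [div_mul_eq_mul_div, le_div_iff₀ (by positivity)]
  linarith

/-- Only boundedly many points of a lattice are near a given point. -/
theorem IsLattice.exists_card_le {c : ℝ} (hc : 0 < c) (hc1 : c < 1) {u : Set ℂ}
    (hu : IsLattice c u) {N : ℝ} (hN : 0 < N) : ∃ M : ℕ,
      ∀ F : Finset ℂ, ↑F ⊆ u → ∀ z ∈ disc, (∀ b ∈ F, Near N b z) → F.card ≤ M := by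
  obtain ⟨C, hC, h⟩ := hu.exists_sum_le hc hc1 (δ := 1 / 2) (by norm_num) (by norm_num)
  refine ⟨⌈C * N ^ (1 / 2 : ℝ) * N ^ (2 : ℝ)⌉₊, fun F hF z hz hnear => ?_⟩
  have hz' := one_sub_norm_pos hz
  -- Every lattice point near `z` contributes a fixed fraction of `(1 - |z|)^(-1/2)` to a sum which
  -- is bounded by a multiple of that same power.
  have hlow : ∀ b ∈ F, N ^ (-(1 / 2) : ℝ) * (1 - ‖z‖) ^ (-(1 / 2) : ℝ) * N ^ (-2 : ℝ) ≤
      (1 - ‖b‖) ^ (-(1 / 2) : ℝ) * ((1 - ‖b‖) / ‖1 - conj b * z‖) ^ (2 : ℝ) := by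
    intro b hb
    have hbd := hu.subset (hF hb)
    have hb' := one_sub_norm_pos hbd
    have hX := kernel_pos hbd hz
    have hn := hnear b hb
    gcongr ?_ * ?_
    · rw [← Real.mul_rpow hN.le hz'.le]
      exact Real.rpow_le_rpow_of_nonpos hb' (hn.le_right hz) (by norm_num)
    · rw [Real.rpow_neg hN.le, ← Real.inv_rpow hN.le]
      refine Real.rpow_le_rpow (by positivity) ?_ (by norm_num)
      rw [inv_eq_one_div, div_le_div_iff₀ hN hX, one_mul, mul_comm (1 - ‖b‖)]
      exact hn.1
  have h1 := (Finset.sum_le_sum hlow).trans (h F hF z hz)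
  rw [Finset.sum_const, nsmul_eq_mul] at h1
  have h2 : (F.card : ℝ) ≤ C * N ^ (1 / 2 : ℝ) * N ^ (2 : ℝ) := by
    have hzp : 0 < (1 - ‖z‖) ^ (-(1 / 2) : ℝ) := Real.rpow_pos_of_pos hz' _
    have hp1 : 0 < N ^ (1 / 2 : ℝ) := Real.rpow_pos_of_pos hN _
    have hp2 : 0 < N ^ (2 : ℝ) := Real.rpow_pos_of_pos hN _
    rw [Real.rpow_neg hN.le, Real.rpow_neg hN.le] at h1
    refine le_of_mul_le_mul_right ?_ hzp
    calc (F.card : ℝ) * (1 - ‖z‖) ^ (-(1 / 2) : ℝ)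
        = (F.card * ((N ^ (1 / 2 : ℝ))⁻¹ * (1 - ‖z‖) ^ (-(1 / 2) : ℝ) * (N ^ (2 : ℝ))⁻¹)) *
          (N ^ (1 / 2 : ℝ) * N ^ (2 : ℝ)) := by field_simp
      _ ≤ (C * (1 - ‖z‖) ^ (-(1 / 2) : ℝ)) * (N ^ (1 / 2 : ℝ) * N ^ (2 : ℝ)) := by gcongr
      _ = _ := by ring
  exact_mod_cast h2.trans (Nat.le_ceil _)

end

/-! ### Measurability of the averaging function, and the sufficiency estimate -/

section

variable {ω : ℝ → ℝ}

/-- The measure of the sections of a relatively compact open family is lower semicontinuous. -/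
theorem lowerSemicontinuous_measure_section (μ : Measure ℂ) {E : Set (ℂ × ℂ)} (hE : IsOpen E)
    {R : ℝ} (hR : ∀ x ∈ E, ‖x.2‖ ≤ R) : LowerSemicontinuous fun z => μ {ζ | (z, ζ) ∈ E} := by
  intro z t ht
  have hop : IsOpen {ζ | (z, ζ) ∈ E} := hE.preimage (by fun_prop)
  -- An open section is exhausted by increasing closed sets, compact because bounded. By the tube
  -- lemma, one with mass above `t` lies in all nearby sections.
  obtain ⟨K, hKc, hKs, hKU, hKm⟩ := hop.exists_iUnion_isClosed
  have hlim := tendsto_measure_iUnion_atTop (μ := μ) hKm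
  rw [hKU] at hlim
  obtain ⟨n, hn⟩ := (hlim.eventually (lt_mem_nhds ht)).exists
  have hcomp : IsCompact (K n) :=
    (isCompact_closedBall (0 : ℂ) R).of_isClosed_subset (hKc n) fun ζ hζ => by
      simpa using hR _ (hKs n hζ)
  obtain ⟨U, V, hU, -, hzU, hKV, hUV⟩ := generalized_tube_lemma (isCompact_singleton (x := z))
    hcomp hE (by
      rintro ⟨a, ζ⟩ ⟨ha, hζ⟩
      rw [show a = z from ha]
      exact hKs n hζ)
  filter_upwards [hU.mem_nhds (hzU rfl)] with z' hz'
  exact hn.trans_le (measure_mono fun ζ hζ => hUV ⟨hz', hKV hζ⟩)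

theorem mem_pseudoDisc_iff {a z : ℂ} {r : ℝ} (ha : a ∈ disc) :
    z ∈ pseudoDisc a r ↔ z ∈ disc ∧ ‖a - z‖ < r * ‖1 - conj a * z‖ := by
  refine and_congr_right fun hz => ?_
  rw [norm_div, div_lt_iff₀ (kernel_pos ha hz)]

theorem isOpen_pseudoDisc {a : ℂ} (ha : a ∈ disc) (r : ℝ) : IsOpen (pseudoDisc a r) := by
  have : pseudoDisc a r = disc ∩ {z | ‖a - z‖ < r * ‖1 - conj a * z‖} := by
    ext z
    exact mem_pseudoDisc_iff ha
  rw [this]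
  exact Metric.isOpen_ball.inter (isOpen_lt (by fun_prop) (by fun_prop))

theorem ae_ne_zero_disc : ∀ᵐ z ∂volume.restrict disc, z ≠ 0 :=
  ae_restrict_of_ae (by simp [ae_iff])

theorem weighted_absolutelyContinuous (w : ℂ → ℝ) : weighted w ≪ volume.restrict disc :=
  withDensity_absolutelyContinuous _ _

/-- The measure `μ` need not be σ-finite, so measurability of sections is not taken from Tonelli:
the numerator is lower semicontinuous, and the denominator is explicit and radial away from the
origin. -/
theorem aemeasurable_Theta (hm : Measurable ω) (μ : Measure ℂ) (r : ℝ) :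
    AEMeasurable (Theta ω μ r) (volume.restrict disc) := by
  set E : Set (ℂ × ℂ) := {x | (x.1 ∈ disc ∧ x.2 ∈ disc) ∧ ‖x.1 - x.2‖ < r * ‖1 - conj x.1 * x.2‖}
  have hE : IsOpen E := by
    have h1 : Continuous fun x : ℂ × ℂ => conj x.1 := Complex.continuous_conj.comp continuous_fst
    have h2 : Continuous fun x : ℂ × ℂ => r * ‖1 - conj x.1 * x.2‖ := by fun_prop
    have h3 : Continuous fun x : ℂ × ℂ => ‖x.1 - x.2‖ := by fun_prop
    exact ((Metric.isOpen_ball.preimage continuous_fst).inter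
      (Metric.isOpen_ball.preimage continuous_snd)).inter (isOpen_lt h3 h2)
  have hnum := (lowerSemicontinuous_measure_section μ hE (R := 1)
    fun x hx => (mem_disc.1 hx.1.2).le).measurable
  have hanti : Antitone fun t : ℝ =>
      ∫⁻ s in Ioo t 1, ENNReal.ofReal s * ENNReal.ofReal (ω s) := fun t t' htt' =>
    lintegral_mono_set (Ioo_subset_Ioo_left htt')
  have hden : Measurable fun z : ℂ => ENNReal.ofReal (1 - ‖z‖) *
      ∫⁻ s in Ioo ‖z‖ 1, ENNReal.ofReal s * ENNReal.ofReal (ω s) :=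
    (by fun_prop : Measurable fun z : ℂ => ENNReal.ofReal (1 - ‖z‖)).mul
      (hanti.measurable.comp measurable_norm)
  refine ⟨_, hnum.div hden, ?_⟩
  filter_upwards [ae_ne_zero_disc, ae_restrict_mem measurableSet_disc] with z hz hzd
  rw [Theta, radialMeasure_carlesonSquare hm hz (mem_disc.1 hzd)]
  congr 2
  ext ζ
  rw [mem_pseudoDisc_iff hzd]
  simp [E, hzd]

theorem ClassD.carlesonSquare_ne_zero (h : ClassD ω) (hm : Measurable ω) {z : ℂ} (hz : z ≠ 0)
    (hzd : z ∈ disc) : radialMeasure ω (carlesonSquare z) ≠ 0 := by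
  obtain ⟨C, hC, hS⟩ := h.exists_carlesonSquare hm
  intro h0
  have h1 := (hS z hz (mem_disc.1 hzd)).2
  rw [h0, mul_zero, nonpos_iff_eq_zero, ENNReal.ofReal_eq_zero] at h1
  exact h1.not_gt (mul_pos (one_sub_norm_pos hzd) (h.weight.hat_pos _ (norm_mem_Ico hzd)))

theorem ClassD.measure_pseudoDisc_le (h : ClassD ω) (hm : Measurable ω) (μ : Measure ℂ) (r : ℝ)
    {z : ℂ} (hz : z ≠ 0) (hzd : z ∈ disc) : μ (pseudoDisc z r) ≤
      Theta ω μ r z * ENNReal.ofReal ((1 - ‖z‖) * hat ω ‖z‖) := by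
  obtain ⟨C, hC, hS⟩ := h.exists_carlesonSquare hm
  have h1 := (hS z hz (mem_disc.1 hzd)).1
  calc μ (pseudoDisc z r) = Theta ω μ r z * radialMeasure ω (carlesonSquare z) := by
        rw [Theta, ENNReal.div_mul_cancel (h.carlesonSquare_ne_zero hm hz hzd)
          (h1.trans_lt ENNReal.ofReal_lt_top).ne]
    _ ≤ _ := by gcongr

theorem aemeasurable_enorm_rpow {f : ℂ → ℂ} (hf : DifferentiableOn ℂ f disc) (q : ℝ)
    {μ : Measure ℂ} : AEMeasurable (fun z => ‖f z‖ₑ ^ q) (μ.restrict disc) :=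
  (hf.continuousOn.aemeasurable measurableSet_disc).enorm.pow_const q

/-- The integral of `|f|^q` against `μ` is controlled by the averaging function. -/
theorem ClassD.exists_lintegral_le_Theta (h : ClassD ω) (hm : Measurable ω) {r : ℝ}
    (hr : r ∈ Ioo (0 : ℝ) 1) : ∃ C : ℝ≥0, 0 < C ∧
      ∀ μ : Measure ℂ, μ discᶜ = 0 → ∀ (f : ℂ → ℂ) (q : ℝ), 0 < q → DifferentiableOn ℂ f disc →
        ∫⁻ z, ‖f z‖ₑ ^ q ∂μ ≤ C * ∫⁻ z, ‖f z‖ₑ ^ q * Theta ω μ r z ∂(weighted (tilde ω)) := by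
  -- Points of `B b` and `B' b` are at distance at most `11c(1 - |b|)`, less than `(r/2)(1 - |b|) ≤
  -- r(1 - |z|)` for `z ∈ B b`; so `B b` lies in `Δ(ζ, r)` for every `ζ ∈ B' b`.
  set c := r / 30
  have hc : 0 < c := by have := hr.1; positivity
  have hcr : c = r / 30 := rfl
  have hc30 : c < 1 / 30 := by rw [hcr]; linarith [hr.2]
  obtain ⟨u, hu⟩ := exists_isLattice hc
  obtain ⟨M, hM⟩ := hu.exists_card_le hc (by linarith) (N := 5) (by norm_num)
  refine ⟨(4 / (Real.pi * c ^ 2)).toNNReal * (M + 1), ?_, fun μ hμ f q hq hf => ?_⟩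
  · have := Real.pi_pos
    have : 0 < (4 / (Real.pi * c ^ 2)).toNNReal := Real.toNNReal_pos.2 (by positivity)
    positivity
  have hπ := Real.pi_pos
  set B : ℂ → Set ℂ := fun b => Metric.closedBall b (5 * c * (1 - ‖b‖))
  set B' : ℂ → Set ℂ := fun b => Metric.closedBall b (6 * c * (1 - ‖b‖))
  have hB' : ∀ b ∈ u, B' b ⊆ disc := fun b hb z hz => by
    refine mem_disc_of_norm_sub_le (hu.subset hb) (t := 6 * c) (by linarith) ?_
    rwa [← dist_eq_norm]
  set g : ℂ → ℝ≥0∞ := fun z => ‖f z‖ₑ ^ q * Theta ω μ r z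
  have hloc : ∀ b ∈ u, ∫⁻ z in B b, ‖f z‖ₑ ^ q ∂μ ≤
      ENNReal.ofReal (4 / (Real.pi * c ^ 2)) *
        ∫⁻ z in B' b, ENNReal.ofReal (tilde ω z) * g z := by
    intro b hb
    have hbd := hu.subset hb
    have hb' := one_sub_norm_pos hbd
    have hpt : ∀ z ∈ B b, ‖f z‖ₑ ^ q ≤ ENNReal.ofReal (1 / (Real.pi * (c * (1 - ‖b‖)) ^ 2)) *
        ∫⁻ w in B' b, ‖f w‖ₑ ^ q := by
      intro z hz
      have hzb : ‖z - b‖ ≤ 5 * c * (1 - ‖b‖) := by rwa [← dist_eq_norm]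
      have h1 : ‖z‖ + c * (1 - ‖b‖) ≤ 1 := by
        have := norm_sub_norm_le z b
        nlinarith
      have h2 := enorm_rpow_le_lintegral_ball (mul_pos hc hb') hq h1 hf
      have h3 : Metric.ball z (c * (1 - ‖b‖)) ⊆ B' b := by
        refine (Metric.ball_subset_closedBall).trans (Metric.closedBall_subset_closedBall' ?_)
        rw [dist_eq_norm]
        linarith
      have h4 : 0 < Real.pi * (c * (1 - ‖b‖)) ^ 2 := by positivity
      calc ‖f z‖ₑ ^ q = ENNReal.ofReal (1 / (Real.pi * (c * (1 - ‖b‖)) ^ 2)) *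
            (ENNReal.ofReal (Real.pi * (c * (1 - ‖b‖)) ^ 2) * ‖f z‖ₑ ^ q) := by
            rw [← mul_assoc, ← ENNReal.ofReal_mul (by positivity), one_div_mul_cancel h4.ne',
              ENNReal.ofReal_one, one_mul]
        _ ≤ _ := by
            gcongr
            exact h2.trans (lintegral_mono_set h3)
    -- The whole mass `μ (B b)` is charged to each point `ζ` of the larger ball, so it can be moved
    -- inside the area integral of `|f|^q`; the factor `(1 - |b|)²` cancels the normalisation of the
    -- average.
    have hmu : ∀ ζ ∈ B' b, ζ ≠ 0 → μ (B b) ≤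
        ENNReal.ofReal (4 * (1 - ‖b‖) ^ 2) * (ENNReal.ofReal (tilde ω ζ) * Theta ω μ r ζ) := by
      intro ζ hζ hζ0
      have hζd := hB' b hb hζ
      have hζ' := one_sub_norm_pos hζd
      have hζb : ‖ζ - b‖ ≤ 6 * c * (1 - ‖b‖) := by rwa [← dist_eq_norm]
      have h1 : B b ⊆ pseudoDisc ζ r := by
        intro z hz
        have hzb : ‖z - b‖ ≤ 5 * c * (1 - ‖b‖) := by rwa [← dist_eq_norm]
        have hzd : z ∈ disc := mem_disc_of_norm_sub_le hbd (by linarith) hzb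
        refine mem_pseudoDisc_of_norm_sub_lt hζd hzd ?_ hr.1.le
        have h2 : ‖ζ - z‖ ≤ ‖ζ - b‖ + ‖z - b‖ := by
          rw [← sub_sub_sub_cancel_right ζ z b]
          exact norm_sub_le _ _
        have h3 := norm_sub_norm_le z b
        have h4 : (1 - ‖b‖) / 2 ≤ 1 - ‖z‖ := by nlinarith
        have h5 : r * ((1 - ‖b‖) / 2) ≤ r * (1 - ‖z‖) := by
          have := hr.1.le
          gcongr
        have h6 : 0 < r * (1 - ‖b‖) := mul_pos hr.1 hb'
        have h7 : c * (1 - ‖b‖) = r * (1 - ‖b‖) / 30 := by rw [hcr]; ring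
        linarith
      have h2 : (1 - ‖ζ‖) * hat ω ‖ζ‖ ≤ 4 * (1 - ‖b‖) ^ 2 * tilde ω ζ := by
        have h3 := norm_sub_norm_le b ζ
        rw [norm_sub_rev] at h3
        have h4 : 1 - ‖ζ‖ ≤ 2 * (1 - ‖b‖) := by nlinarith
        have h5 : (1 - ‖ζ‖) * hat ω ‖ζ‖ = (1 - ‖ζ‖) ^ 2 * tilde ω ζ := by
          rw [tilde]; field_simp
        rw [h5]
        have := (h.weight.tilde_pos hζd).le
        gcongr
        nlinarith
      calc μ (B b) ≤ μ (pseudoDisc ζ r) := measure_mono h1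
        _ ≤ Theta ω μ r ζ * ENNReal.ofReal ((1 - ‖ζ‖) * hat ω ‖ζ‖) :=
          h.measure_pseudoDisc_le hm μ r hζ0 hζd
        _ ≤ Theta ω μ r ζ * (ENNReal.ofReal (4 * (1 - ‖b‖) ^ 2) * ENNReal.ofReal (tilde ω ζ)) := by
          rw [← ENNReal.ofReal_mul (by positivity)]
          gcongr
        _ = _ := by ring
    calc ∫⁻ z in B b, ‖f z‖ₑ ^ q ∂μ
        ≤ ∫⁻ _ in B b, (ENNReal.ofReal (1 / (Real.pi * (c * (1 - ‖b‖)) ^ 2)) *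
            ∫⁻ w in B' b, ‖f w‖ₑ ^ q) ∂μ := setLIntegral_mono' measurableSet_closedBall hpt
      _ = ENNReal.ofReal (1 / (Real.pi * (c * (1 - ‖b‖)) ^ 2)) *
            (μ (B b) * ∫⁻ w in B' b, ‖f w‖ₑ ^ q) := by
          rw [setLIntegral_const]
          ring
      _ ≤ ENNReal.ofReal (1 / (Real.pi * (c * (1 - ‖b‖)) ^ 2)) *
            ∫⁻ w in B' b, ENNReal.ofReal (4 * (1 - ‖b‖) ^ 2) *
              (ENNReal.ofReal (tilde ω w) * g w) := by
          gcongr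
          refine (lintegral_const_mul_le _ _).trans (lintegral_mono_ae ?_)
          have h0 : ∀ᵐ w ∂volume.restrict (B' b), w ≠ 0 :=
            ae_restrict_of_ae_restrict_of_subset (hB' b hb) ae_ne_zero_disc
          filter_upwards [h0, ae_restrict_mem measurableSet_closedBall] with w hw hwB
          calc μ (B b) * ‖f w‖ₑ ^ q ≤ ENNReal.ofReal (4 * (1 - ‖b‖) ^ 2) *
                (ENNReal.ofReal (tilde ω w) * Theta ω μ r w) * ‖f w‖ₑ ^ q := by
                gcongr
                exact hmu w hwB hw
            _ = _ := by simp only [g]; ring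
      _ = _ := by
          rw [lintegral_const_mul' _ _ ENNReal.ofReal_ne_top, ← mul_assoc,
            ← ENNReal.ofReal_mul (by positivity)]
          congr 2
          field_simp
  have hgm : AEMeasurable (fun z => ENNReal.ofReal (tilde ω z) * g z) (volume.restrict disc) := by
    refine AEMeasurable.mul ?_ ((aemeasurable_enorm_rpow hf q).mul (aemeasurable_Theta hm μ r))
    refine AEMeasurable.ennreal_ofReal ((ContinuousOn.div ?_ ?_ ?_).aemeasurable measurableSet_disc)
    · exact h.weight.continuousOn_hat.comp continuous_norm.continuousOn fun z hz => norm_mem_Ico hz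
    · fun_prop
    · exact fun z hz => (one_sub_norm_pos hz).ne'
  have := hu.countable.to_subtype
  rw [h.weight.lintegral_tilde]
  calc ∫⁻ z, ‖f z‖ₑ ^ q ∂μ = ∫⁻ z in disc, ‖f z‖ₑ ^ q ∂μ := by
        rw [← lintegral_add_compl _ measurableSet_disc, Measure.restrict_eq_zero.2 hμ,
          lintegral_zero_measure, add_zero]
    _ ≤ ∫⁻ z in ⋃ b : u, B b, ‖f z‖ₑ ^ q ∂μ := by
        refine lintegral_mono_set fun z hz => ?_
        obtain ⟨b, hb, hzb⟩ := hu.cover z hz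
        refine mem_iUnion.2 ⟨⟨b, hb⟩, ?_⟩
        simp only [B]
        rwa [Metric.mem_closedBall, dist_eq_norm]
    _ ≤ ∑' b : u, ∫⁻ z in B b, ‖f z‖ₑ ^ q ∂μ := lintegral_iUnion_le _ _
    _ ≤ ∑' b : u, ENNReal.ofReal (4 / (Real.pi * c ^ 2)) *
          ∫⁻ z in B' b, ENNReal.ofReal (tilde ω z) * g z :=
        ENNReal.tsum_le_tsum fun b => hloc b b.2
    _ = ENNReal.ofReal (4 / (Real.pi * c ^ 2)) * ∑' b : u,
          ∫⁻ z in disc, (B' b).indicator (fun z => ENNReal.ofReal (tilde ω z) * g z) z := by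
        rw [ENNReal.tsum_mul_left]
        congr 2
        ext b
        rw [lintegral_indicator measurableSet_closedBall,
          Measure.restrict_restrict_of_subset (hB' b b.2)]
    _ = ENNReal.ofReal (4 / (Real.pi * c ^ 2)) * ∫⁻ z in disc,
          ∑' b : u, (B' b).indicator (fun z => ENNReal.ofReal (tilde ω z) * g z) z := by
        rw [lintegral_tsum fun b => hgm.indicator measurableSet_closedBall]
    _ ≤ ENNReal.ofReal (4 / (Real.pi * c ^ 2)) * ∫⁻ z in disc,
          ((M + 1 : ℝ≥0) : ℝ≥0∞) * (ENNReal.ofReal (tilde ω z) * g z) := by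
        gcongr ENNReal.ofReal (4 / (Real.pi * c ^ 2)) * ?_
        refine setLIntegral_mono' measurableSet_disc fun z hz => ?_
        rw [ENNReal.tsum_eq_iSup_sum]
        refine iSup_le fun F => ?_
        classical
        set F' := F.filter fun b : u => z ∈ B' b
        have hsum : ∑ b ∈ F, (B' (b : ℂ)).indicator
            (fun z => ENNReal.ofReal (tilde ω z) * g z) z =
            F'.card * (ENNReal.ofReal (tilde ω z) * g z) := by
          rw [← nsmul_eq_mul, ← Finset.sum_const, Finset.sum_filter]
          rfl
        have hcard : F'.card ≤ M := by
          rw [← Finset.card_map (Function.Embedding.subtype _)]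
          refine hM _ ?_ z hz ?_
          · intro x hx
            simp only [Finset.coe_map, mem_image] at hx
            obtain ⟨y, -, rfl⟩ := hx
            exact y.2
          · intro b hb
            simp only [Finset.mem_map, F', Finset.mem_filter] at hb
            obtain ⟨y, ⟨-, hy⟩, rfl⟩ := hb
            refine near_of_norm_sub_le (hu.subset y.2) (t := 6 * c) (by linarith) ?_
            rw [← dist_eq_norm]
            exact hy
        rw [hsum]
        gcongr
        push_cast
        exact (Nat.cast_le.2 hcard).trans le_self_add
    _ = _ := by
        rw [lintegral_const_mul' _ _ ENNReal.coe_ne_top, ← mul_assoc, ENNReal.coe_mul]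
        rfl

/-- The sufficiency estimate: Hölder's inequality applied to the previous bound. -/
theorem ClassD.exists_lintegral_le_mul (h : ClassD ω) (hm : Measurable ω) {r p q : ℝ}
    (hr : r ∈ Ioo (0 : ℝ) 1) (hq : 0 < q) (hqp : q < p) : ∃ C : ℝ≥0, 0 < C ∧
      ∀ μ : Measure ℂ, μ discᶜ = 0 → ∀ f : ℂ → ℂ, DifferentiableOn ℂ f disc →
        ∫⁻ z, ‖f z‖ₑ ^ q ∂μ ≤
          C * (∫⁻ z, Theta ω μ r z ^ (p / (p - q)) ∂(weighted (tilde ω))) ^ ((p - q) / p) *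
            (∫⁻ z, ‖f z‖ₑ ^ p ∂(radialMeasure ω)) ^ (q / p) := by
  obtain ⟨C₁, hC₁, h₁⟩ := h.exists_lintegral_le_Theta hm hr
  obtain ⟨C₂, hC₂, h₂⟩ := h.exists_lintegral_tilde_le hm
  have hp : 0 < p := hq.trans hqp
  have hpq : 0 < p - q := sub_pos.2 hqp
  refine ⟨C₁ * C₂ ^ (q / p), by positivity, fun μ hμ f hf => (h₁ μ hμ f q hq hf).trans ?_⟩
  have hac := weighted_absolutelyContinuous (tilde ω)
  have hconj : (p / q).HolderConjugate (p / (p - q)) := by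
    rw [Real.holderConjugate_iff]
    refine ⟨(one_lt_div hq).2 hqp, ?_⟩
    field_simp
    ring
  have hH := ENNReal.lintegral_mul_le_Lp_mul_Lq (weighted (tilde ω)) hconj
    ((aemeasurable_enorm_rpow hf q).mono_ac hac) ((aemeasurable_Theta hm μ r).mono_ac hac)
  have e1 : ∀ z, (‖f z‖ₑ ^ q) ^ (p / q) = ‖f z‖ₑ ^ p := fun z => by
    rw [← ENNReal.rpow_mul, mul_div_cancel₀ _ hq.ne']
  simp only [e1, one_div_div, Pi.mul_apply] at hH
  calc (C₁ : ℝ≥0∞) * ∫⁻ z, ‖f z‖ₑ ^ q * Theta ω μ r z ∂(weighted (tilde ω))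
      ≤ C₁ * ((C₂ * ∫⁻ z, ‖f z‖ₑ ^ p ∂(radialMeasure ω)) ^ (q / p) *
          (∫⁻ z, Theta ω μ r z ^ (p / (p - q)) ∂(weighted (tilde ω))) ^ ((p - q) / p)) := by
        gcongr
        refine hH.trans ?_
        gcongr
        exact h₂ f p hp hf
    _ = _ := by
        rw [ENNReal.mul_rpow_of_nonneg _ _ (by positivity), ENNReal.coe_mul,
          ← ENNReal.coe_rpow_of_nonneg _ (by positivity)]
        ring

end

/-! ### Test functions: kernel sums over a lattice -/

section

variable {ω : ℝ → ℝ}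

/-- The normalised kernel `(1 - |b|) / |1 - b̄z|`. -/
def kernelRatio (b z : ℂ) : ℝ := (1 - ‖b‖) / ‖1 - conj b * z‖

theorem kernelRatio_pos {b z : ℂ} (hb : b ∈ disc) (hz : z ∈ disc) : 0 < kernelRatio b z :=
  div_pos (one_sub_norm_pos hb) (kernel_pos hb hz)

/-- The quantity `(1 - |b|) ω̂(b)`, comparable to the mass of the Carleson square at `b`. -/
def squareMass (ω : ℝ → ℝ) (b : ℂ) : ℝ := (1 - ‖b‖) * hat ω ‖b‖

theorem IsRadialWeight.squareMass_pos (h : IsRadialWeight ω) {b : ℂ} (hb : b ∈ disc) :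
    0 < squareMass ω b :=
  mul_pos (one_sub_norm_pos hb) (h.hat_pos _ (norm_mem_Ico hb))

/-- Hölder's inequality with the measure of weights `w`. It replaces subadditivity of the `p`-th
power when `p ≥ 1`. -/
theorem sum_mul_rpow_le {ι : Type*} (F : Finset ι) {p : ℝ} (hp : 1 ≤ p) {w y : ι → ℝ}
    (hw : ∀ i ∈ F, 0 ≤ w i) (hy : ∀ i ∈ F, 0 ≤ y i) :
    (∑ i ∈ F, w i * y i) ^ p ≤ (∑ i ∈ F, w i) ^ (p - 1) * ∑ i ∈ F, w i * y i ^ p := by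
  have hp0 : 0 < p := by linarith
  have h := Real.inner_le_weight_mul_Lp_of_nonneg F hp (fun i => |w i|) (fun i => |y i|)
    (fun i => abs_nonneg _) (fun i => abs_nonneg _)
  have e1 : ∑ i ∈ F, |w i| * |y i| = ∑ i ∈ F, w i * y i :=
    Finset.sum_congr rfl fun i hi => by rw [abs_of_nonneg (hw i hi), abs_of_nonneg (hy i hi)]
  have e2 : ∑ i ∈ F, |w i| = ∑ i ∈ F, w i :=
    Finset.sum_congr rfl fun i hi => abs_of_nonneg (hw i hi)
  have e3 : ∑ i ∈ F, |w i| * |y i| ^ p = ∑ i ∈ F, w i * y i ^ p :=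
    Finset.sum_congr rfl fun i hi => by rw [abs_of_nonneg (hw i hi), abs_of_nonneg (hy i hi)]
  rw [e1, e2, e3] at h
  have h1 : 0 ≤ ∑ i ∈ F, w i * y i := Finset.sum_nonneg fun i hi => mul_nonneg (hw i hi) (hy i hi)
  have h2 : 0 ≤ ∑ i ∈ F, w i := Finset.sum_nonneg hw
  have h3 : 0 ≤ ∑ i ∈ F, w i * y i ^ p :=
    Finset.sum_nonneg fun i hi => mul_nonneg (hw i hi) (Real.rpow_nonneg (hy i hi) _)
  calc (∑ i ∈ F, w i * y i) ^ p
      ≤ ((∑ i ∈ F, w i) ^ (1 - p⁻¹) * (∑ i ∈ F, w i * y i ^ p) ^ p⁻¹) ^ p := by gcongr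
    _ = _ := by
      rw [Real.mul_rpow (by positivity) (by positivity), ← Real.rpow_mul h2, ← Real.rpow_mul h3,
        inv_mul_cancel₀ hp0.ne', Real.rpow_one, sub_mul, inv_mul_cancel₀ hp0.ne', one_mul]

/-- A pointwise bound for the `p`-th power of a sum of kernels over a lattice. -/
theorem IsLattice.exists_sum_rpow_le {c : ℝ} (hc : 0 < c) (hc1 : c < 1) {u : Set ℂ}
    (hu : IsLattice c u) {p γ β : ℝ} (hp : 0 < p) (hγ : 0 < γ) :
    ∃ (m : ℕ) (η N C : ℝ), η < γ ∧ β - η + 1 < N ∧ 0 < C ∧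
      ∀ F : Finset ℂ, ↑F ⊆ u → ∀ a : ℂ → ℝ, (∀ b ∈ F, 0 ≤ a b) → ∀ z ∈ disc,
        (∑ b ∈ F, a b * kernelRatio b z ^ m) ^ p ≤
          C * ∑ b ∈ F, a b ^ p * (1 - ‖b‖) ^ η *
            ((1 - ‖z‖) ^ (-η) * kernelRatio b z ^ N) := by
  -- The power `m` is taken so large that the kernel exponent left after the weighting below still
  -- exceeds `β - η + 1`, as the kernel integral requires.
  obtain ⟨m, hm⟩ := exists_nat_gt ((|β| + 1) / p + 2)
  have hm2 : 2 < (m : ℝ) := by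
    have : 0 ≤ (|β| + 1) / p := by positivity
    linarith
  have hmp : |β| + 1 < (m - 2) * p := by
    rw [← div_lt_iff₀ hp]
    linarith
  have hβ := le_abs_self β
  rcases le_total p 1 with hp1 | hp1
  · refine ⟨m, 0, m * p, 1, hγ, by nlinarith, one_pos, fun F hF a ha z hz => ?_⟩
    have hx : ∀ b ∈ F, 0 ≤ a b * kernelRatio b z ^ m := fun b hb => by
      have := kernelRatio_pos (hu.subset (hF hb)) hz
      have := ha b hb
      positivity
    calc (∑ b ∈ F, a b * kernelRatio b z ^ m) ^ p ≤ ∑ b ∈ F, (a b * kernelRatio b z ^ m) ^ p := by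
          clear hm hm2 hmp
          induction F using Finset.cons_induction with
          | empty => simp [Real.zero_rpow hp.ne']
          | cons b F hb ih =>
            rw [Finset.sum_cons, Finset.sum_cons]
            have h1 : 0 ≤ a b * kernelRatio b z ^ m := hx b (Finset.mem_cons_self b F)
            have h2 : ∀ b ∈ F, 0 ≤ a b * kernelRatio b z ^ m := fun b' hb' =>
              hx b' (Finset.mem_cons_of_mem hb')
            have h3 := ih (fun b' hb' => hF (Finset.mem_cons_of_mem hb'))
              (fun b' hb' => ha b' (Finset.mem_cons_of_mem hb')) h2
            exact (Real.rpow_add_le_add_rpow h1 (Finset.sum_nonneg h2) hp.le hp1).trans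
              (by gcongr)
      _ = _ := by
          rw [one_mul]
          refine Finset.sum_congr rfl fun b hb => ?_
          have hK := kernelRatio_pos (hu.subset (hF hb)) hz
          rw [Real.mul_rpow (ha b hb) (by positivity), neg_zero, Real.rpow_zero, Real.rpow_zero,
            Real.rpow_mul hK.le, Real.rpow_natCast]
          ring
  -- A Schur-type argument: the weights `(1 - |b|)^(-δ) K²` have controlled lattice sums, and `δ` is
  -- small enough that the resulting `η = δ(p - 1)` stays below `γ`. For `p ≤ 1` no weight was
  -- needed.
  · set δ := min (1 / 2) (γ / (2 * p))
    have hδ : 0 < δ := lt_min (by norm_num) (by positivity)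
    have hδ1 : δ < 1 := (min_le_left _ _).trans_lt (by norm_num)
    have hδγ : δ * (p - 1) < γ := by
      have h1 : δ * (p - 1) ≤ γ / (2 * p) * p := by
        refine mul_le_mul (min_le_right _ _) (by linarith) (by linarith) (by positivity)
      have h2 : γ / (2 * p) * p = γ / 2 := by field_simp
      linarith
    obtain ⟨C, hC, hsum⟩ := hu.exists_sum_le hc hc1 hδ hδ1
    have hδp : 0 ≤ δ * (p - 1) := mul_nonneg hδ.le (by linarith)
    refine ⟨m, δ * (p - 1), 2 + (m - 2) * p, C ^ (p - 1), hδγ, by linarith, by positivity,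
      fun F hF a ha z hz => ?_⟩
    have hz' := one_sub_norm_pos hz
    set w : ℂ → ℝ := fun b => (1 - ‖b‖) ^ (-δ) * kernelRatio b z ^ (2 : ℝ)
    set y : ℂ → ℝ := fun b => a b * (1 - ‖b‖) ^ δ * kernelRatio b z ^ ((m : ℝ) - 2)
    have hw : ∀ b ∈ F, 0 ≤ w b := fun b hb => by
      have := kernelRatio_pos (hu.subset (hF hb)) hz
      have := one_sub_norm_pos (hu.subset (hF hb))
      positivity
    have hy : ∀ b ∈ F, 0 ≤ y b := fun b hb => by
      have := kernelRatio_pos (hu.subset (hF hb)) hz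
      have := one_sub_norm_pos (hu.subset (hF hb))
      have := ha b hb
      positivity
    have hwy : ∀ b ∈ F, a b * kernelRatio b z ^ m = w b * y b := fun b hb => by
      have hK := kernelRatio_pos (hu.subset (hF hb)) hz
      have hb' := one_sub_norm_pos (hu.subset (hF hb))
      have e1 : (1 - ‖b‖) ^ (-δ) * (1 - ‖b‖) ^ δ = 1 := by
        rw [← Real.rpow_add hb', neg_add_cancel, Real.rpow_zero]
      have e2 : kernelRatio b z ^ (2 : ℝ) * kernelRatio b z ^ ((m : ℝ) - 2) =
          kernelRatio b z ^ m := by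
        rw [← Real.rpow_add hK, add_sub_cancel, Real.rpow_natCast]
      calc a b * kernelRatio b z ^ m = ((1 - ‖b‖) ^ (-δ) * (1 - ‖b‖) ^ δ) * a b *
            (kernelRatio b z ^ (2 : ℝ) * kernelRatio b z ^ ((m : ℝ) - 2)) := by
            rw [e1, e2]; ring
        _ = _ := by simp only [w, y]; ring
    have hW : ∑ b ∈ F, w b ≤ C * (1 - ‖z‖) ^ (-δ) := hsum F hF z hz
    have hWn : 0 ≤ ∑ b ∈ F, w b := Finset.sum_nonneg hw
    have hwyp : ∀ b ∈ F, w b * y b ^ p = a b ^ p * (1 - ‖b‖) ^ (δ * (p - 1)) *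
        kernelRatio b z ^ (2 + (m - 2) * p) := fun b hb => by
      have hK := kernelRatio_pos (hu.subset (hF hb)) hz
      have hb' := one_sub_norm_pos (hu.subset (hF hb))
      have hab := ha b hb
      simp only [w, y]
      rw [Real.mul_rpow (by positivity) (by positivity), Real.mul_rpow hab (by positivity),
        ← Real.rpow_mul hb'.le, ← Real.rpow_mul hK.le, Real.rpow_add hK,
        show δ * (p - 1) = -δ + δ * p by ring, Real.rpow_add hb']
      ring
    have hzδ : (C * (1 - ‖z‖) ^ (-δ)) ^ (p - 1) =
        C ^ (p - 1) * (1 - ‖z‖) ^ (-(δ * (p - 1))) := by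
      rw [Real.mul_rpow hC.le (by positivity), ← Real.rpow_mul hz'.le, neg_mul]
    calc (∑ b ∈ F, a b * kernelRatio b z ^ m) ^ p = (∑ b ∈ F, w b * y b) ^ p := by
          rw [Finset.sum_congr rfl hwy]
      _ ≤ (∑ b ∈ F, w b) ^ (p - 1) * ∑ b ∈ F, w b * y b ^ p := sum_mul_rpow_le F hp1 hw hy
      _ ≤ (C * (1 - ‖z‖) ^ (-δ)) ^ (p - 1) * ∑ b ∈ F, w b * y b ^ p := by
          have : 0 ≤ ∑ b ∈ F, w b * y b ^ p := Finset.sum_nonneg fun b hb =>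
            mul_nonneg (hw b hb) (Real.rpow_nonneg (hy b hb) _)
          gcongr
      _ = _ := by
          rw [hzδ, mul_assoc, Finset.mul_sum]
          congr 1
          refine Finset.sum_congr rfl fun b hb => ?_
          rw [hwyp b hb]
          ring

theorem continuousOn_kernelRatio {b : ℂ} (hb : b ∈ disc) : ContinuousOn (kernelRatio b) disc := by
  unfold kernelRatio
  refine ContinuousOn.div (by fun_prop) (by fun_prop) fun z hz => (kernel_pos hb hz).ne'

/-- The `L^p` norm of sums of normalised kernels over a lattice. -/
theorem ClassD.exists_test_bound (h : ClassD ω) {c : ℝ} (hc : 0 < c) (hc1 : c < 1) {u : Set ℂ}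
    (hu : IsLattice c u) {p : ℝ} (hp : 0 < p) : ∃ (m : ℕ) (C : ℝ), 0 < C ∧
      ∀ F : Finset ℂ, ↑F ⊆ u → ∀ a : ℂ → ℝ, (∀ b ∈ F, 0 ≤ a b) →
        ∫⁻ z, ENNReal.ofReal ((∑ b ∈ F, a b * squareMass ω b ^ (-p⁻¹) * kernelRatio b z ^ m) ^ p)
          ∂(weighted (tilde ω)) ≤ ENNReal.ofReal (C * ∑ b ∈ F, a b ^ p) := by
  obtain ⟨γ, β, hγ, -, hint⟩ := h.exists_kernel_integral
  obtain ⟨m, η, N, C₁, hη, hN, hC₁, hpt⟩ := hu.exists_sum_rpow_le hc hc1 (β := β) hp hγ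
  obtain ⟨C₂, hC₂, h₂⟩ := hint η N hη hN
  refine ⟨m, C₁ * C₂, by positivity, fun F hF a ha => ?_⟩
  have hFd : ∀ b ∈ F, b ∈ disc := fun b hb => hu.subset (hF hb)
  have hA : ∀ b ∈ F, 0 < squareMass ω b := fun b hb => h.weight.squareMass_pos (hFd b hb)
  have ha' : ∀ b ∈ F, 0 ≤ a b * squareMass ω b ^ (-p⁻¹) := fun b hb =>
    mul_nonneg (ha b hb) (Real.rpow_nonneg (hA b hb).le _)
  have hap : ∀ b ∈ F, (a b * squareMass ω b ^ (-p⁻¹)) ^ p = a b ^ p * (squareMass ω b)⁻¹ :=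
    fun b hb => by
      rw [Real.mul_rpow (ha b hb) (Real.rpow_nonneg (hA b hb).le _), ← Real.rpow_mul (hA b hb).le,
        neg_mul, inv_mul_cancel₀ hp.ne', Real.rpow_neg_one]
  have hcoef : ∀ b ∈ F, 0 ≤ (a b * squareMass ω b ^ (-p⁻¹)) ^ p * (1 - ‖b‖) ^ η := fun b hb =>
    mul_nonneg (Real.rpow_nonneg (ha' b hb) _)
      (Real.rpow_nonneg (one_sub_norm_pos (hFd b hb)).le _)
  have hae : ∀ᵐ z ∂(weighted (tilde ω)), z ∈ disc :=
    (weighted_absolutelyContinuous _).ae_le (ae_restrict_mem measurableSet_disc)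
  calc ∫⁻ z, ENNReal.ofReal ((∑ b ∈ F, a b * squareMass ω b ^ (-p⁻¹) * kernelRatio b z ^ m) ^ p)
          ∂(weighted (tilde ω))
      ≤ ∫⁻ z, ∑ b ∈ F, ENNReal.ofReal (C₁ * ((a b * squareMass ω b ^ (-p⁻¹)) ^ p *
          (1 - ‖b‖) ^ η)) * ENNReal.ofReal ((1 - ‖z‖) ^ (-η) * kernelRatio b z ^ N)
          ∂(weighted (tilde ω)) := by
        refine lintegral_mono_ae ?_
        filter_upwards [hae] with z hz
        have hz' := one_sub_norm_pos hz
        refine (ENNReal.ofReal_le_ofReal (hpt F hF _ ha' z hz)).trans_eq ?_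
        rw [Finset.mul_sum, ENNReal.ofReal_sum_of_nonneg]
        · refine Finset.sum_congr rfl fun b hb => ?_
          rw [← ENNReal.ofReal_mul (mul_nonneg hC₁.le (hcoef b hb))]
          congr 1
          ring
        · intro b hb
          have := kernelRatio_pos (hFd b hb) hz
          have := hcoef b hb
          positivity
    _ = ∑ b ∈ F, ENNReal.ofReal (C₁ * ((a b * squareMass ω b ^ (-p⁻¹)) ^ p *
          (1 - ‖b‖) ^ η)) * ∫⁻ z, ENNReal.ofReal ((1 - ‖z‖) ^ (-η) * kernelRatio b z ^ N)
          ∂(weighted (tilde ω)) := by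
        rw [lintegral_finsetSum']
        · refine Finset.sum_congr rfl fun b hb => ?_
          rw [lintegral_const_mul' _ _ ENNReal.ofReal_ne_top]
        · intro b hb
          refine AEMeasurable.const_mul ?_ _
          refine AEMeasurable.mono_ac ?_ (weighted_absolutelyContinuous _)
          refine (AEMeasurable.mul (by fun_prop) (AEMeasurable.pow_const ?_ _)).ennreal_ofReal
          exact (continuousOn_kernelRatio (hFd b hb)).aemeasurable measurableSet_disc
    _ ≤ ∑ b ∈ F, ENNReal.ofReal (C₁ * C₂ * a b ^ p) := by
        refine Finset.sum_le_sum fun b hb => ?_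
        refine (mul_le_mul_right (h₂ b (hFd b hb)) _).trans_eq ?_
        rw [← ENNReal.ofReal_mul (mul_nonneg hC₁.le (hcoef b hb)), hap b hb]
        congr 1
        have e1 : (1 - ‖b‖) ^ η * (1 - ‖b‖) ^ (-η) = 1 := by
          rw [← Real.rpow_add (one_sub_norm_pos (hFd b hb)), add_neg_cancel, Real.rpow_zero]
        have e2 : (squareMass ω b)⁻¹ * ((1 - ‖b‖) * hat ω ‖b‖) = 1 :=
          inv_mul_cancel₀ (hA b hb).ne'
        calc _ = C₁ * C₂ * a b ^ p * ((squareMass ω b)⁻¹ * ((1 - ‖b‖) * hat ω ‖b‖)) *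
              ((1 - ‖b‖) ^ η * (1 - ‖b‖) ^ (-η)) := by ring
          _ = _ := by rw [e1, e2]; ring
    _ = _ := by
        rw [← ENNReal.ofReal_sum_of_nonneg fun b hb => by
          have := Real.rpow_nonneg (ha b hb) p
          positivity, Finset.mul_sum]

/-- Averages over random signs dominate each individual term. -/
theorem sum_signs_ge {ι : Type*} [DecidableEq ι] (F : Finset ι) (v : ι → ℂ) {q : ℝ} (hq : 0 < q)
    {i : ι} (hi : i ∈ F) :
    2 ^ (F.card - 1) * ‖v i‖ₑ ^ q ≤
      ∑ S ∈ F.powerset, ‖∑ j ∈ F, (if j ∈ S then 1 else -1) * v j‖ₑ ^ q := by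
  -- Choices of signs are paired according to the sign at `i`: one of `t - v i`, `t + v i` has
  -- modulus at least `|v i|`, and there are `2 ^ (F.card - 1)` pairs.
  obtain ⟨F', hiF, rfl⟩ : ∃ F', i ∉ F' ∧ F = insert i F' :=
    ⟨F.erase i, Finset.notMem_erase i F, (Finset.insert_erase hi).symm⟩
  rw [Finset.sum_powerset_insert hiF, ← Finset.sum_add_distrib, Finset.card_insert_of_notMem hiF,
    Nat.add_sub_cancel, ← Nat.cast_ofNat, ← Nat.cast_pow, ← Finset.card_powerset,
    ← nsmul_eq_mul]
  refine Finset.card_nsmul_le_sum _ _ _ fun S hS => ?_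
  have hiS : i ∉ S := fun h => hiF (Finset.mem_powerset.1 hS h)
  set t : ℂ := ∑ j ∈ F', (if j ∈ S then 1 else -1) * v j
  have e1 : ∑ j ∈ insert i F', (if j ∈ S then 1 else -1) * v j = t - v i := by
    rw [Finset.sum_insert hiF, if_neg hiS]
    ring
  have e2 : ∑ j ∈ insert i F', (if j ∈ insert i S then 1 else -1) * v j = t + v i := by
    rw [Finset.sum_insert hiF, if_pos (Finset.mem_insert_self _ _)]
    have : ∑ j ∈ F', (if j ∈ insert i S then 1 else -1) * v j = t := by
      refine Finset.sum_congr rfl fun j hj => ?_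
      have hji : j ≠ i := fun h => hiF (h ▸ hj)
      simp [Finset.mem_insert, hji]
    rw [this]
    ring
  rw [e1, e2]
  have h2 : ‖v i‖ ≤ max ‖t - v i‖ ‖t + v i‖ := by
    have h3 := norm_sub_le (t + v i) (t - v i)
    rw [show t + v i - (t - v i) = 2 * v i by ring, norm_mul, Complex.norm_ofNat] at h3
    rcases le_total ‖t - v i‖ ‖t + v i‖ with h4 | h4
    · rw [max_eq_right h4]; linarith
    · rw [max_eq_left h4]; linarith
  rw [enorm_rpow_eq hq.le, enorm_rpow_eq hq.le, enorm_rpow_eq hq.le]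
  rcases le_max_iff.1 h2 with h3 | h3
  · exact (ENNReal.ofReal_le_ofReal (by gcongr)).trans le_self_add
  · exact (ENNReal.ofReal_le_ofReal (by gcongr)).trans le_add_self

end

/-! ### Testing the embedding on all choices of signs -/

section

variable {ω : ℝ → ℝ}

theorem eLpNorm_ofReal_eq {ε : Type*} [ENorm ε] {α : Type*} [MeasurableSpace α] {p : ℝ}
    (hp : 0 < p) (f : α → ε) (μ : Measure α) :
    eLpNorm f (ENNReal.ofReal p) μ = (∫⁻ z, ‖f z‖ₑ ^ p ∂μ) ^ (1 / p) := by
  rw [eLpNorm_eq_lintegral_rpow_enorm_toReal (by simpa using hp) ENNReal.ofReal_ne_top,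
    ENNReal.toReal_ofReal hp.le]

theorem aestronglyMeasurable_radialMeasure {f : ℂ → ℂ} (hf : DifferentiableOn ℂ f disc)
    (ω : ℝ → ℝ) : AEStronglyMeasurable f (radialMeasure ω) :=
  (hf.continuousOn.aestronglyMeasurable measurableSet_disc).mono_ac
    (weighted_absolutelyContinuous _)

theorem restrict_disc_eq {μ : Measure ℂ} (hμ : μ discᶜ = 0) : μ.restrict disc = μ :=
  Measure.restrict_eq_self_of_ae_mem (by rw [ae_iff]; exact hμ)

/-- The embedding norm bounds the `L^q_μ` integral of each analytic function. -/
theorem lintegral_le_embeddingNorm {p q : ℝ} (hp : 0 < p) (hq : 0 < q) {μ : Measure ℂ}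
    {f : ℂ → ℂ} (hf : DifferentiableOn ℂ f disc) {t : ℝ} (ht : 0 < t)
    (hft : ∫⁻ z, ‖f z‖ₑ ^ p ∂(radialMeasure ω) ≤ ENNReal.ofReal t) :
    ∫⁻ z, ‖f z‖ₑ ^ q ∂μ ≤ embeddingNorm p q ω μ ^ q * ENNReal.ofReal t ^ (q / p) := by
  set c : ℝ := t ^ (-(1 / p))
  -- The factor `c = t^(-1/p)` scales `f` into the unit ball of `A^p_ω`; the positivity of `t` makes
  -- this possible.
  have hc : 0 < c := by positivity
  have hcp : ENNReal.ofReal c ^ p * ENNReal.ofReal t = 1 := by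
    rw [ENNReal.ofReal_rpow_of_pos hc, ← ENNReal.ofReal_mul (by positivity), ← Real.rpow_mul ht.le,
      neg_mul, one_div, inv_mul_cancel₀ hp.ne', Real.rpow_neg_one, inv_mul_cancel₀ ht.ne',
      ENNReal.ofReal_one]
  have hcq : ENNReal.ofReal c ^ q * ENNReal.ofReal t ^ (q / p) = 1 := by
    rw [show q = p * (q / p) by field_simp, ENNReal.rpow_mul, mul_div_cancel_left₀ _ hp.ne',
      ← ENNReal.mul_rpow_of_nonneg _ _ (by positivity), hcp, ENNReal.one_rpow]
  have hg : ∀ (s : ℝ), 0 < s → ∀ z, ‖(c : ℂ) * f z‖ₑ ^ s = ENNReal.ofReal c ^ s * ‖f z‖ₑ ^ s := by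
    intro s hs z
    rw [enorm_mul, ENNReal.mul_rpow_of_nonneg _ _ hs.le]
    congr 2
    rw [← ofReal_norm, Complex.norm_real, Real.norm_of_nonneg hc.le]
  have hgd : DifferentiableOn ℂ (fun z => (c : ℂ) * f z) disc := hf.const_mul _
  have hle : bergmanNorm p ω (fun z => (c : ℂ) * f z) ≤ 1 := by
    rw [bergmanNorm, eLpNorm_ofReal_eq hp]
    refine ENNReal.rpow_le_one ?_ (by positivity)
    simp only [hg p hp]
    rw [lintegral_const_mul' _ _ (by finiteness), ← hcp]
    gcongr
  have hmem : (fun z => (c : ℂ) * f z) ∈ Bergman p ω :=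
    ⟨hgd, aestronglyMeasurable_radialMeasure hgd ω, hle.trans_lt ENNReal.one_lt_top⟩
  have hE : eLpNorm (fun z => (c : ℂ) * f z) (ENNReal.ofReal q) μ ≤ embeddingNorm p q ω μ :=
    le_iSup₂_of_le (f := fun f (_ : f ∈ {f | f ∈ Bergman p ω ∧ bergmanNorm p ω f ≤ 1}) =>
      eLpNorm f (ENNReal.ofReal q) μ) _ ⟨hmem, hle⟩ le_rfl
  rw [eLpNorm_ofReal_eq hq, one_div, ENNReal.rpow_inv_le_iff hq] at hE
  simp only [hg q hq] at hE
  rw [lintegral_const_mul' _ _ (by finiteness)] at hE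
  calc ∫⁻ z, ‖f z‖ₑ ^ q ∂μ =
      (ENNReal.ofReal c ^ q * ∫⁻ z, ‖f z‖ₑ ^ q ∂μ) * ENNReal.ofReal t ^ (q / p) := by
        rw [mul_right_comm, hcq, one_mul]
    _ ≤ _ := by gcongr

/-- The set of points of the disc at bounded hyperbolic distance from `b`. -/
def nearSet (N : ℝ) (b : ℂ) : Set ℂ := {z | z ∈ disc ∧ Near N b z}

theorem measurableSet_nearSet (N : ℝ) (b : ℂ) : MeasurableSet (nearSet N b) := by
  have h1 : IsClosed {z : ℂ | Near N b z} := by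
    have e : {z : ℂ | Near N b z} = {z | ‖1 - conj b * z‖ ≤ N * (1 - ‖b‖)} ∩
        {z | ‖1 - conj b * z‖ ≤ N * (1 - ‖z‖)} := rfl
    rw [e]
    exact (isClosed_le (by fun_prop) (by fun_prop)).inter (isClosed_le (by fun_prop) (by fun_prop))
  exact measurableSet_disc.inter h1.measurableSet

/-- Testing the embedding on random sums of kernels. -/
theorem ClassD.exists_sum_nearSet_le (h : ClassD ω) (hm : Measurable ω) {c : ℝ} (hc : 0 < c)
    (hc1 : c < 1) {u : Set ℂ} (hu : IsLattice c u) {N : ℝ} (hN : 0 < N) {p q : ℝ} (hp : 0 < p)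
    (hq : 0 < q) : ∃ C : ℝ≥0, 0 < C ∧ ∀ μ : Measure ℂ, μ discᶜ = 0 →
      ∀ F : Finset ℂ, ↑F ⊆ u → ∀ a : ℂ → ℝ, (∀ b ∈ F, 0 ≤ a b) → 0 < ∑ b ∈ F, a b ^ p →
        ∑ b ∈ F, ENNReal.ofReal (a b * squareMass ω b ^ (-p⁻¹)) ^ q * μ (nearSet N b) ≤
          C * embeddingNorm p q ω μ ^ q * ENNReal.ofReal (∑ b ∈ F, a b ^ p) ^ (q / p) := by
  classical
  obtain ⟨m, C₁, hC₁, h₁⟩ := h.exists_test_bound hc hc1 hu hp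
  obtain ⟨C₂, hC₂, h₂⟩ := h.exists_lintegral_le_tilde hm
  obtain ⟨M, hM⟩ := hu.exists_card_le hc hc1 hN
  set κ : ℝ≥0 := (N.toNNReal ^ m) ^ q
  refine ⟨κ * (2 * (M + 1)) * (C₂ * C₁.toNNReal) ^ (q / p), ?_, fun μ hμ F hF a ha hT => ?_⟩
  · have : 0 < N.toNNReal := Real.toNNReal_pos.2 hN
    have : 0 < C₁.toNNReal := Real.toNNReal_pos.2 hC₁
    positivity
  have hFd : ∀ b ∈ F, b ∈ disc := fun b hb => hu.subset (hF hb)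
  set w : ℂ → ℝ := fun b => a b * squareMass ω b ^ (-p⁻¹)
  have hw : ∀ b ∈ F, 0 ≤ w b := fun b hb =>
    mul_nonneg (ha b hb) (Real.rpow_nonneg (h.weight.squareMass_pos (hFd b hb)).le _)
  set v : ℂ → ℂ → ℂ := fun b z => (w b : ℂ) * (((1 - ‖b‖ : ℝ) : ℂ) / (1 - conj b * z)) ^ m
  have hvn : ∀ b ∈ F, ∀ z ∈ disc, ‖v b z‖ = w b * kernelRatio b z ^ m := by
    intro b hb z hz
    rw [norm_mul, norm_pow, norm_div, Complex.norm_real, Complex.norm_real,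
      Real.norm_of_nonneg (hw b hb), Real.norm_of_nonneg (one_sub_norm_pos (hFd b hb)).le,
      kernelRatio]
  have hvd : ∀ b ∈ F, DifferentiableOn ℂ (v b) disc := by
    intro b hb
    refine DifferentiableOn.const_mul (DifferentiableOn.pow (DifferentiableOn.div (by fun_prop)
      (by fun_prop) fun z hz => ?_) m) _
    exact norm_pos_iff.1 (kernel_pos (hFd b hb) hz)
  set f : Finset ℂ → ℂ → ℂ := fun S z => ∑ b ∈ F, (if b ∈ S then 1 else -1) * v b z
  have hfd : ∀ S, DifferentiableOn ℂ (f S) disc := fun S =>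
    DifferentiableOn.fun_sum fun b hb => (hvd b hb).const_mul _
  set T := ∑ b ∈ F, a b ^ p
  have hae : ∀ᵐ z ∂(weighted (tilde ω)), z ∈ disc :=
    (weighted_absolutelyContinuous _).ae_le (ae_restrict_mem measurableSet_disc)
  have hfp : ∀ S, ∫⁻ z, ‖f S z‖ₑ ^ p ∂(radialMeasure ω) ≤ ENNReal.ofReal (C₂ * C₁ * T) := by
    intro S
    refine (h₂ _ p hp (hfd S)).trans ?_
    rw [mul_assoc, ENNReal.ofReal_mul C₂.coe_nonneg, ENNReal.ofReal_coe_nnreal]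
    gcongr
    refine le_trans (lintegral_mono_ae ?_) (h₁ F hF a ha)
    filter_upwards [hae] with z hz
    rw [enorm_rpow_eq hp.le]
    refine ENNReal.ofReal_le_ofReal (Real.rpow_le_rpow (norm_nonneg _) ?_ hp.le)
    refine (norm_sum_le _ _).trans (Finset.sum_le_sum fun b hb => ?_)
    rw [norm_mul, hvn b hb z hz]
    refine mul_le_of_le_one_left ((norm_nonneg _).trans_eq (hvn b hb z hz)) ?_
    split_ifs <;> simp
  have hfq : ∀ S, ∫⁻ z, ‖f S z‖ₑ ^ q ∂μ ≤
      embeddingNorm p q ω μ ^ q * ENNReal.ofReal (C₂ * C₁ * T) ^ (q / p) := fun S =>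
    lintegral_le_embeddingNorm hp hq (hfd S) (by positivity) (hfp S)
  have hμae : ∀ᵐ z ∂μ, z ∈ disc := by rw [ae_iff]; exact hμ
  have hFne : 0 < F.card := by
    rw [Finset.card_pos, Finset.nonempty_iff_ne_empty]
    rintro rfl
    simp [T] at hT
  -- At a given `z` at most `M` lattice points are near, so the lower bound by a single term
  -- replaces Khinchine's inequality. On `nearSet N b` the kernel ratio is at least `1 / N`, which
  -- gives the constant `κ`.
  have hpt : ∀ z ∈ disc, ∑ b ∈ F, (nearSet N b).indicator
      (fun _ => 2 ^ (F.card - 1) * ENNReal.ofReal (w b) ^ q) z ≤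
        κ * (M + 1) * ∑ S ∈ F.powerset, ‖f S z‖ₑ ^ q := by
    intro z hz
    have hterm : ∀ b ∈ F.filter fun b => z ∈ nearSet N b,
        2 ^ (F.card - 1) * ENNReal.ofReal (w b) ^ q ≤
          κ * ∑ S ∈ F.powerset, ‖f S z‖ₑ ^ q := by
      intro b hb
      obtain ⟨hb, -, hbz⟩ := Finset.mem_filter.1 hb
      have h3 := sum_signs_ge F (fun b => v b z) hq hb
      have h4 : ENNReal.ofReal (w b) ^ q ≤ κ * ‖v b z‖ₑ ^ q := by
        have hκ : (κ : ℝ≥0∞) = ENNReal.ofReal (N ^ m) ^ q := by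
          rw [ENNReal.coe_rpow_of_nonneg _ hq.le, ENNReal.ofReal_pow hN.le, ENNReal.coe_pow]
          rfl
        rw [hκ, ← ENNReal.mul_rpow_of_nonneg _ _ hq.le, ← ofReal_norm, hvn b hb z hz,
          ← ENNReal.ofReal_mul (by positivity)]
        refine ENNReal.rpow_le_rpow (ENNReal.ofReal_le_ofReal ?_) hq.le
        have h5 : 1 ≤ N * kernelRatio b z := by
          rw [kernelRatio, ← mul_div_assoc, one_le_div (kernel_pos (hFd b hb) hz)]
          exact hbz.1
        calc w b ≤ w b * (N * kernelRatio b z) ^ m :=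
              le_mul_of_one_le_right (hw b hb) (one_le_pow₀ h5)
          _ = _ := by ring
      calc 2 ^ (F.card - 1) * ENNReal.ofReal (w b) ^ q
          ≤ 2 ^ (F.card - 1) * (κ * ‖v b z‖ₑ ^ q) := by gcongr
        _ = κ * (2 ^ (F.card - 1) * ‖v b z‖ₑ ^ q) := by ring
        _ ≤ _ := by gcongr
    have hcard : (F.filter fun b => z ∈ nearSet N b).card ≤ M :=
      hM _ (fun b hb => hF (Finset.mem_filter.1 hb).1) z hz
        fun b hb => (Finset.mem_filter.1 hb).2.2
    have hsum : ∑ b ∈ F, (nearSet N b).indicator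
        (fun _ => 2 ^ (F.card - 1) * ENNReal.ofReal (w b) ^ q) z =
        ∑ b ∈ F.filter fun b => z ∈ nearSet N b, 2 ^ (F.card - 1) * ENNReal.ofReal (w b) ^ q := by
      rw [Finset.sum_filter]
      rfl
    rw [hsum]
    refine (Finset.sum_le_card_nsmul _ _ _ hterm).trans ?_
    rw [nsmul_eq_mul]
    have : ((F.filter fun b => z ∈ nearSet N b).card : ℝ≥0∞) ≤ M + 1 :=
      (Nat.cast_le.2 hcard).trans le_self_add
    calc _ ≤ ((M : ℝ≥0∞) + 1) * (κ * ∑ S ∈ F.powerset, ‖f S z‖ₑ ^ q) := by gcongr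
      _ = _ := by ring
  -- The `2 ^ F.card` sign choices on the right against `2 ^ (F.card - 1)` pairs on the left leave a
  -- factor 2, independent of `F`.
  have key : 2 ^ (F.card - 1) * ∑ b ∈ F, ENNReal.ofReal (w b) ^ q * μ (nearSet N b) ≤
      2 ^ (F.card - 1) * (κ * (2 * (M + 1)) *
        (embeddingNorm p q ω μ ^ q * ENNReal.ofReal (C₂ * C₁ * T) ^ (q / p))) := by
    calc 2 ^ (F.card - 1) * ∑ b ∈ F, ENNReal.ofReal (w b) ^ q * μ (nearSet N b)
        = ∫⁻ z, ∑ b ∈ F, (nearSet N b).indicator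
          (fun _ => 2 ^ (F.card - 1) * ENNReal.ofReal (w b) ^ q) z ∂μ := by
          rw [lintegral_finsetSum _ fun b _ =>
            measurable_const.indicator (measurableSet_nearSet N b), Finset.mul_sum]
          refine Finset.sum_congr rfl fun b _ => ?_
          rw [lintegral_indicator_const (measurableSet_nearSet N b), mul_assoc]
      _ ≤ ∫⁻ z, κ * (M + 1) * ∑ S ∈ F.powerset, ‖f S z‖ₑ ^ q ∂μ := by
          refine lintegral_mono_ae ?_
          filter_upwards [hμae] with z hz using hpt z hz
      _ = κ * (M + 1) * ∑ S ∈ F.powerset, ∫⁻ z, ‖f S z‖ₑ ^ q ∂μ := by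
          rw [lintegral_const_mul' _ _ (by finiteness), lintegral_finsetSum']
          intro S _
          have := aemeasurable_enorm_rpow (hfd S) q (μ := μ)
          rwa [restrict_disc_eq hμ] at this
      _ ≤ κ * (M + 1) * ∑ S ∈ F.powerset,
          (embeddingNorm p q ω μ ^ q * ENNReal.ofReal (C₂ * C₁ * T) ^ (q / p)) := by
          gcongr with S
          exact hfq S
      _ = _ := by
          rw [Finset.sum_const, Finset.card_powerset, nsmul_eq_mul]
          obtain ⟨k, hk⟩ := Nat.exists_eq_succ_of_ne_zero hFne.ne'
          rw [hk, Nat.succ_sub_one, Nat.succ_eq_add_one, pow_succ]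
          push_cast
          ring
  rw [ENNReal.mul_le_mul_iff_right (by simp) (by finiteness)] at key
  refine key.trans_eq ?_
  have e : (((C₂ * C₁.toNNReal) ^ (q / p) : ℝ≥0) : ℝ≥0∞) = ENNReal.ofReal (C₂ * C₁) ^ (q / p) := by
    rw [ENNReal.coe_rpow_of_nonneg _ (by positivity), ENNReal.ofReal_mul C₂.coe_nonneg,
      ENNReal.ofReal_coe_nnreal, ENNReal.coe_mul]
    rfl
  rw [ENNReal.ofReal_mul (by positivity), ENNReal.mul_rpow_of_nonneg _ _ (by positivity), ← e]
  generalize (C₂ * C₁.toNNReal) ^ (q / p) = D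
  generalize κ = κ'
  push_cast
  ring

end

/-! ### Duality and the necessity estimate -/

section

/-- A duality bound for finite sums. -/
theorem sum_rpow_le_of_forall {ι : Type*} (F : Finset ι) {p q : ℝ} (hq : 0 < q) (hqp : q < p)
    {x : ι → ℝ≥0∞} {B : ℝ≥0∞} (hB : B ≠ ∞)
    (h : ∀ a : ι → ℝ, (∀ i ∈ F, 0 ≤ a i) → 0 < ∑ i ∈ F, a i ^ p →
      ∑ i ∈ F, ENNReal.ofReal (a i) ^ q * x i ≤ B * ENNReal.ofReal (∑ i ∈ F, a i ^ p) ^ (q / p)) :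
    ∑ i ∈ F, x i ^ (p / (p - q)) ≤ B ^ (p / (p - q)) := by
  classical
  have hp : 0 < p := hq.trans hqp
  have hpq : 0 < p - q := sub_pos.2 hqp
  -- Testing on a single index; finiteness is needed to take real powers and to divide by the sum at
  -- the end.
  have hfin : ∀ i ∈ F, x i ≠ ∞ := by
    intro i hi
    have hs : ∑ j ∈ F, (if j = i then (1 : ℝ) else 0) ^ p = 1 := by
      rw [Finset.sum_eq_single_of_mem i hi fun j _ hj => by simp [hj, Real.zero_rpow hp.ne']]
      simp
    have h1 := h (fun j => if j = i then 1 else 0) (fun j _ => by split_ifs <;> norm_num)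
      (by rw [hs]; norm_num)
    rw [hs, ENNReal.ofReal_one, ENNReal.one_rpow, mul_one] at h1
    have h2 := (Finset.single_le_sum
      (f := fun j => ENNReal.ofReal (if j = i then 1 else 0) ^ q * x j)
      (fun j _ => zero_le) hi).trans h1
    simp only [if_true, ENNReal.ofReal_one, ENNReal.one_rpow, one_mul] at h2
    exact (h2.trans_lt hB.lt_top).ne
  -- The extremal sequence for the duality: `a^p = a^q x = x^(p/(p-q))`, so the hypothesis reads `T
  -- ≤ B T^(q/p)`.
  set a : ι → ℝ := fun i => (x i).toReal ^ (1 / (p - q))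
  have ha : ∀ i ∈ F, 0 ≤ a i := fun i _ => by positivity
  have hap : ∀ i, a i ^ p = (x i).toReal ^ (p / (p - q)) := fun i => by
    rw [← Real.rpow_mul ENNReal.toReal_nonneg]
    congr 1
    ring
  have hof : ∀ i ∈ F, ENNReal.ofReal ((x i).toReal ^ (p / (p - q))) = x i ^ (p / (p - q)) :=
    fun i hi => by
      rw [← ENNReal.ofReal_rpow_of_nonneg ENNReal.toReal_nonneg (by positivity),
        ENNReal.ofReal_toReal (hfin i hi)]
  have hT : ENNReal.ofReal (∑ i ∈ F, a i ^ p) = ∑ i ∈ F, x i ^ (p / (p - q)) := by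
    rw [ENNReal.ofReal_sum_of_nonneg fun i _ => by positivity]
    exact Finset.sum_congr rfl fun i hi => by rw [hap, hof i hi]
  have haq : ∀ i ∈ F, ENNReal.ofReal (a i) ^ q * x i = x i ^ (p / (p - q)) := by
    intro i hi
    rw [← ENNReal.ofReal_rpow_of_nonneg ENNReal.toReal_nonneg (by positivity),
      ENNReal.ofReal_toReal (hfin i hi), ← ENNReal.rpow_mul]
    nth_rewrite 2 [← ENNReal.rpow_one (x i)]
    rw [← ENNReal.rpow_add_of_nonneg _ _ (by positivity) zero_le_one]
    congr 1
    field_simp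
    ring
  rcases (Finset.sum_nonneg fun i hi => Real.rpow_nonneg (ha i hi) p).eq_or_lt with h0 | h0
  · rw [← hT, ← h0, ENNReal.ofReal_zero]
    exact zero_le
  have h1 := h a ha h0
  rw [Finset.sum_congr rfl haq, ← hT] at h1
  rw [← hT]
  set T := ENNReal.ofReal (∑ i ∈ F, a i ^ p)
  have hT0 : T ≠ 0 := by simpa [T] using h0
  have hTt : T ≠ ∞ := ENNReal.ofReal_ne_top
  have h2 : T ^ ((p - q) / p) ≤ B := by
    rw [show (p - q) / p = 1 - q / p by field_simp, ENNReal.rpow_sub _ _ hT0 hTt,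
      ENNReal.rpow_one]
    exact ENNReal.div_le_of_le_mul h1
  calc T = (T ^ ((p - q) / p)) ^ (p / (p - q)) := by
        rw [← ENNReal.rpow_mul, show (p - q) / p * (p / (p - q)) = 1 by field_simp,
          ENNReal.rpow_one]
    _ ≤ _ := by gcongr

variable {ω : ℝ → ℝ}

theorem ClassD.exists_hat_le_of_le (h : ClassD ω) {N : ℝ} (hN : 0 < N) : ∃ C : ℝ, 0 < C ∧
    ∀ a ∈ disc, ∀ b ∈ disc, 1 - ‖a‖ ≤ N * (1 - ‖b‖) → hat ω ‖a‖ ≤ C * hat ω ‖b‖ := by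
  obtain ⟨C, γ, β, hC, hγ, hγβ, h1⟩ := h.exists_hat_le
  refine ⟨C * (N ^ γ + N ^ β), by positivity, fun a ha b hb hab => ?_⟩
  have ha' := one_sub_norm_pos ha
  have hb' := one_sub_norm_pos hb
  have hx : (1 - ‖a‖) / (1 - ‖b‖) ≤ N := by rwa [div_le_iff₀ hb']
  have hx0 : 0 ≤ (1 - ‖a‖) / (1 - ‖b‖) := by positivity
  have hβ : 0 ≤ β := hγ.le.trans hγβ
  have := h.weight.hat_pos _ (norm_mem_Ico hb)
  calc hat ω ‖a‖ ≤ C * hat ω ‖b‖ *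
      (((1 - ‖a‖) / (1 - ‖b‖)) ^ γ + ((1 - ‖a‖) / (1 - ‖b‖)) ^ β) :=
        h1 _ (norm_mem_Ico ha) _ (norm_mem_Ico hb)
    _ ≤ C * hat ω ‖b‖ * (N ^ γ + N ^ β) := by gcongr
    _ = _ := by ring

/-- The averaging function on a lattice ball. -/
theorem ClassD.exists_Theta_le (h : ClassD ω) (hm : Measurable ω) {r : ℝ}
    (hr : r ∈ Ioo (0 : ℝ) 1) : ∃ N : ℝ, 0 < N ∧ ∃ C : ℝ≥0, ∀ μ : Measure ℂ, ∀ b ∈ disc, ∀ z,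
      z ≠ 0 → ‖z - b‖ ≤ 1 / 2 * (1 - ‖b‖) →
        Theta ω μ r z ≤ C * μ (nearSet N b) / ENNReal.ofReal (squareMass ω b) := by
  obtain ⟨C₁, hC₁, h₁⟩ := h.exists_carlesonSquare hm
  obtain ⟨C₂, hC₂, h₂⟩ := h.exists_hat_le_of_le (N := 5) (by norm_num)
  have hr2 : 0 < 1 - r ^ 2 := by have := hr.1; have := hr.2; nlinarith
  set K := 4 / (1 - r ^ 2)
  have hK : 0 < K := by positivity
  -- The constant of `Near.trans`: 5 leads from `b` to `z` and `K` from `z` across `Δ(z, r)`.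
  refine ⟨(5 + K) * max 5 K, by positivity, (5 * C₂ * C₁).toNNReal, fun μ b hb z hz hzb => ?_⟩
  have hzd : z ∈ disc := mem_disc_of_norm_sub_le hb (by norm_num) hzb
  have hn : Near 5 b z := near_of_norm_sub_le hb le_rfl hzb
  have hsub : pseudoDisc z r ⊆ nearSet ((5 + K) * max 5 K) b := fun w hw =>
    ⟨hw.1, hn.trans hb hzd hw.1 (near_of_mem_pseudoDisc hzd hr hw)⟩
  have hA := h.weight.squareMass_pos hb
  have hz' := one_sub_norm_pos hzd
  have hb' := one_sub_norm_pos hb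
  have hhb := h.weight.hat_pos _ (norm_mem_Ico hb)
  have hhz := h.weight.hat_pos _ (norm_mem_Ico hzd)
  have hAz : squareMass ω b ≤ 5 * C₂ * ((1 - ‖z‖) * hat ω ‖z‖) := by
    have e1 := hn.le_right hzd
    calc squareMass ω b ≤ (5 * (1 - ‖z‖)) * (C₂ * hat ω ‖z‖) := by
          unfold squareMass
          gcongr
          exact h₂ b hb z hzd e1
      _ = _ := by ring
  have hS : ENNReal.ofReal (squareMass ω b) ≤
      (5 * C₂ * C₁).toNNReal * radialMeasure ω (carlesonSquare z) := by
    calc ENNReal.ofReal (squareMass ω b)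
        ≤ ENNReal.ofReal (5 * C₂) * ENNReal.ofReal ((1 - ‖z‖) * hat ω ‖z‖) := by
          rw [← ENNReal.ofReal_mul (by positivity)]
          exact ENNReal.ofReal_le_ofReal hAz
      _ ≤ ENNReal.ofReal (5 * C₂) * (ENNReal.ofReal C₁ * radialMeasure ω (carlesonSquare z)) := by
          gcongr
          exact (h₁ z hz (mem_disc.1 hzd)).2
      _ = _ := by
          rw [← mul_assoc, ← ENNReal.ofReal_mul (by positivity)]
          rfl
  have hS0 := h.carlesonSquare_ne_zero hm hz hzd
  have hSt : radialMeasure ω (carlesonSquare z) ≠ ∞ :=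
    ((h₁ z hz (mem_disc.1 hzd)).1.trans_lt ENNReal.ofReal_lt_top).ne
  have hA0 : ENNReal.ofReal (squareMass ω b) ≠ 0 := by simpa using hA
  rw [Theta, ENNReal.div_le_iff hS0 hSt, ENNReal.div_eq_inv_mul]
  calc μ (pseudoDisc z r) ≤ μ (nearSet ((5 + K) * max 5 K) b) := measure_mono hsub
    _ = (ENNReal.ofReal (squareMass ω b))⁻¹ * ENNReal.ofReal (squareMass ω b) *
        μ (nearSet ((5 + K) * max 5 K) b) := by
        rw [ENNReal.inv_mul_cancel hA0 ENNReal.ofReal_ne_top, one_mul]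
    _ ≤ (ENNReal.ofReal (squareMass ω b))⁻¹ *
        ((5 * C₂ * C₁).toNNReal * radialMeasure ω (carlesonSquare z)) *
        μ (nearSet ((5 + K) * max 5 K) b) := by gcongr
    _ = _ := by ring

theorem ClassD.exists_weighted_tilde_closedBall_le (h : ClassD ω) : ∃ C : ℝ≥0, ∀ b ∈ disc,
    weighted (tilde ω) (Metric.closedBall b (1 / 2 * (1 - ‖b‖))) ≤
      C * ENNReal.ofReal (squareMass ω b) := by
  obtain ⟨C₂, hC₂, h₂⟩ := h.exists_hat_le_of_le (N := 5) (by norm_num)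
  refine ⟨(5 * C₂ * Real.pi).toNNReal, fun b hb => ?_⟩
  have hb' := one_sub_norm_pos hb
  have hhb := h.weight.hat_pos _ (norm_mem_Ico hb)
  rw [weighted, withDensity_apply _ Metric.isClosed_closedBall.measurableSet]
  have hball : volume (Metric.closedBall b (1 / 2 * (1 - ‖b‖))) ≤
      ENNReal.ofReal (Real.pi * (1 - ‖b‖) ^ 2) := by
    rw [volume_closedBall_eq b (by positivity)]
    refine ENNReal.ofReal_le_ofReal ?_
    have : 0 ≤ Real.pi * (1 - ‖b‖) ^ 2 := by positivity
    nlinarith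
  calc ∫⁻ z in Metric.closedBall b (1 / 2 * (1 - ‖b‖)), ENNReal.ofReal (tilde ω z)
        ∂(volume.restrict disc)
      ≤ ∫⁻ z in Metric.closedBall b (1 / 2 * (1 - ‖b‖)),
          ENNReal.ofReal (5 * C₂ * hat ω ‖b‖ / (1 - ‖b‖)) ∂(volume.restrict disc) := by
        refine setLIntegral_mono' Metric.isClosed_closedBall.measurableSet fun z hz => ?_
        rw [Metric.mem_closedBall, dist_eq_norm] at hz
        have hzd : z ∈ disc := mem_disc_of_norm_sub_le hb (by norm_num) hz
        have hn : Near 5 b z := near_of_norm_sub_le hb le_rfl hz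
        have hz' := one_sub_norm_pos hzd
        refine ENNReal.ofReal_le_ofReal ?_
        rw [tilde, div_le_div_iff₀ hz' hb']
        have e1 := h₂ z hzd b hb (hn.le_left hb)
        have e2 := hn.le_right hzd
        calc hat ω ‖z‖ * (1 - ‖b‖) ≤ (C₂ * hat ω ‖b‖) * (5 * (1 - ‖z‖)) := by gcongr
          _ = _ := by ring
    _ ≤ ENNReal.ofReal (5 * C₂ * hat ω ‖b‖ / (1 - ‖b‖)) *
        ENNReal.ofReal (Real.pi * (1 - ‖b‖) ^ 2) := by
        rw [setLIntegral_const]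
        gcongr
        exact (Measure.restrict_apply_le _ _).trans hball
    _ = _ := by
        rw [← ENNReal.ofReal_mul (by positivity)]
        change _ = ENNReal.ofReal _ * _
        rw [← ENNReal.ofReal_mul (by positivity)]
        congr 1
        unfold squareMass
        field_simp

/-- The necessity estimate. -/
theorem ClassD.exists_lintegral_Theta_le (h : ClassD ω) (hm : Measurable ω) {r p q : ℝ}
    (hr : r ∈ Ioo (0 : ℝ) 1) (hq : 0 < q) (hqp : q < p) : ∃ C : ℝ≥0, 0 < C ∧
      ∀ μ : Measure ℂ, μ discᶜ = 0 →
        (∫⁻ z, Theta ω μ r z ^ (p / (p - q)) ∂(weighted (tilde ω))) ^ ((p - q) / p) ≤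
          C * embeddingNorm p q ω μ ^ q := by
  have hp : 0 < p := hq.trans hqp
  have hpq : 0 < p - q := sub_pos.2 hqp
  -- With `5c = 1/2`, the balls that cover the disc are those on which the averaging function was
  -- estimated.
  obtain ⟨u, hu⟩ := exists_isLattice (c := 1 / 10) (by norm_num)
  obtain ⟨N, hN, C₁, h₁⟩ := h.exists_Theta_le hm hr
  obtain ⟨C₂, h₂⟩ := h.exists_weighted_tilde_closedBall_le
  obtain ⟨C₃, hC₃, h₃⟩ := h.exists_sum_nearSet_le hm (by norm_num) (by norm_num) hu hN hp hq
  set s := p / (p - q)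
  have hs : 0 < s := by positivity
  refine ⟨(C₁ ^ s * C₂ + 1) ^ ((p - q) / p) * C₃, by positivity, fun μ hμ => ?_⟩
  rcases eq_or_ne (embeddingNorm p q ω μ) ∞ with hE | hE
  · rw [hE, ENNReal.top_rpow_of_pos hq, ENNReal.mul_top]
    · exact le_top
    · exact ENNReal.coe_ne_zero.2 (by positivity)
  set x : ℂ → ℝ≥0∞ := fun b => ENNReal.ofReal (squareMass ω b ^ (-p⁻¹)) ^ q * μ (nearSet N b)
  have hsum : ∀ F : Finset ℂ, ↑F ⊆ u →
      ∑ b ∈ F, x b ^ s ≤ (C₃ * embeddingNorm p q ω μ ^ q) ^ s := by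
    intro F hF
    refine sum_rpow_le_of_forall F hq hqp (by finiteness) fun a ha hT => ?_
    refine le_trans (Finset.sum_le_sum fun b hb => ?_) (h₃ μ hμ F hF a ha hT)
    rw [ENNReal.ofReal_mul (ha b hb), ENNReal.mul_rpow_of_nonneg _ _ hq.le, mul_assoc]
  have hae : ∀ᵐ z ∂(weighted (tilde ω)), z ≠ 0 :=
    (weighted_absolutelyContinuous _).ae_le ae_ne_zero_disc
  set B : ℂ → Set ℂ := fun b => Metric.closedBall b (1 / 2 * (1 - ‖b‖))
  have hBm : ∀ b, MeasurableSet (B b) := fun b => Metric.isClosed_closedBall.measurableSet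
  have hpiece : ∀ b ∈ u, ∫⁻ z in B b, Theta ω μ r z ^ s ∂(weighted (tilde ω)) ≤
      (C₁ ^ s * C₂ : ℝ≥0) * x b ^ s := by
    intro b hb
    have hbd := hu.subset hb
    have hA := h.weight.squareMass_pos hbd
    set A := squareMass ω b
    have hA0 : ENNReal.ofReal A ≠ 0 := by simpa using hA
    -- The exponents match because `s q / p = s - 1`: the mass of the ball restores the power of `A`
    -- that separates `μ / A` from the test coefficients.
    have hxs : (μ (nearSet N b) / ENNReal.ofReal A) ^ s * ENNReal.ofReal A = x b ^ s := by
      have e1 : ENNReal.ofReal (A ^ (-p⁻¹)) ^ q = ENNReal.ofReal A ^ (-(q / p)) := by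
        rw [← ENNReal.ofReal_rpow_of_pos hA, ← ENNReal.rpow_mul]
        congr 1
        ring
      simp only [x]
      rw [e1, ENNReal.mul_rpow_of_nonneg _ _ hs.le, ENNReal.div_rpow_of_nonneg _ _ hs.le,
        ← ENNReal.rpow_mul, div_eq_mul_inv, ← ENNReal.rpow_neg, mul_assoc, mul_comm]
      congr 1
      nth_rewrite 2 [← ENNReal.rpow_one (ENNReal.ofReal A)]
      rw [← ENNReal.rpow_add _ _ hA0 ENNReal.ofReal_ne_top]
      congr 1
      simp only [s]
      field_simp
      ring
    calc ∫⁻ z in B b, Theta ω μ r z ^ s ∂(weighted (tilde ω))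
        ≤ ∫⁻ z in B b, (C₁ * μ (nearSet N b) / ENNReal.ofReal A) ^ s ∂(weighted (tilde ω)) := by
          refine setLIntegral_mono_ae' (hBm b) ?_
          filter_upwards [hae] with z hz hzb
          refine ENNReal.rpow_le_rpow (h₁ μ b hbd z hz ?_) hs.le
          rw [← dist_eq_norm]
          exact hzb
      _ ≤ (C₁ * (μ (nearSet N b) / ENNReal.ofReal A)) ^ s * (C₂ * ENNReal.ofReal A) := by
          rw [setLIntegral_const, mul_div_assoc]
          gcongr
          exact h₂ b hbd
      _ = C₁ ^ s * C₂ * ((μ (nearSet N b) / ENNReal.ofReal A) ^ s * ENNReal.ofReal A) := by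
          rw [ENNReal.mul_rpow_of_nonneg _ _ hs.le]
          ring
      _ = _ := by
          rw [hxs, ENNReal.coe_mul, ENNReal.coe_rpow_of_nonneg _ hs.le]
  have hcov : ∀ᵐ z ∂(weighted (tilde ω)), z ∈ ⋃ b ∈ u, B b := by
    filter_upwards [(weighted_absolutelyContinuous (tilde ω)).ae_le
      (ae_restrict_mem measurableSet_disc)] with z hz
    obtain ⟨b, hb, hzb⟩ := hu.cover z hz
    refine mem_iUnion₂.2 ⟨b, hb, ?_⟩
    rw [Metric.mem_closedBall, dist_eq_norm]
    refine hzb.trans_eq ?_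
    norm_num
  have := hu.countable.to_subtype
  have hint : ∫⁻ z, Theta ω μ r z ^ s ∂(weighted (tilde ω)) ≤
      (C₁ ^ s * C₂ + 1 : ℝ≥0) * (C₃ * embeddingNorm p q ω μ ^ q) ^ s := by
    calc ∫⁻ z, Theta ω μ r z ^ s ∂(weighted (tilde ω))
        = ∫⁻ z in ⋃ b : u, B b, Theta ω μ r z ^ s ∂(weighted (tilde ω)) := by
          rw [← biUnion_eq_iUnion u fun b _ => B b, Measure.restrict_eq_self_of_ae_mem hcov]
      _ ≤ ∑' b : u, ∫⁻ z in B b, Theta ω μ r z ^ s ∂(weighted (tilde ω)) :=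
          lintegral_iUnion_le _ _
      _ ≤ ∑' b : u, (C₁ ^ s * C₂ : ℝ≥0) * x b ^ s :=
          ENNReal.tsum_le_tsum fun b => hpiece b b.2
      _ = (C₁ ^ s * C₂ : ℝ≥0) * ∑' b : u, x b ^ s := ENNReal.tsum_mul_left
      _ ≤ _ := by
          gcongr
          · exact le_self_add
          rw [ENNReal.tsum_eq_iSup_sum]
          refine iSup_le fun F => ?_
          have := hsum (F.map (Function.Embedding.subtype _)) (by
            intro y hy
            simp only [Finset.coe_map, mem_image] at hy
            obtain ⟨y, -, rfl⟩ := hy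
            exact y.2)
          rwa [Finset.sum_map] at this
  calc (∫⁻ z, Theta ω μ r z ^ s ∂(weighted (tilde ω))) ^ ((p - q) / p)
      ≤ ((C₁ ^ s * C₂ + 1 : ℝ≥0) * (C₃ * embeddingNorm p q ω μ ^ q) ^ s) ^ ((p - q) / p) := by
        gcongr
    _ = _ := by
        rw [ENNReal.mul_rpow_of_nonneg _ _ (by positivity), ← ENNReal.rpow_mul,
          show s * ((p - q) / p) = 1 by simp only [s]; field_simp, ENNReal.rpow_one,
          ENNReal.coe_mul, ENNReal.coe_rpow_of_nonneg _ (by positivity), mul_assoc]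

end

/-! ### Normal families and averaging functions near the boundary -/

section

/-- A sequential Arzelà–Ascoli theorem for locally Lipschitz families. -/
theorem exists_subseq_tendsto_of_locally_lipschitz {X : Type*} [MetricSpace X]
    [WeaklyLocallyCompactSpace X] [SigmaCompactSpace X] {B δ L : X → ℝ} (hδ : ∀ x, 0 < δ x)
    (f : ℕ → C(X, ℂ)) (hB : ∀ n x, ‖f n x‖ ≤ B x)
    (hL : ∀ n c x, dist x c < δ c → ‖f n x - f n c‖ ≤ L c * dist x c) :
    ∃ φ : ℕ → ℕ, StrictMono φ ∧ ∃ g : C(X, ℂ), Tendsto (f ∘ φ) atTop (𝓝 g) := by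
  set P : (X → ℂ) → Prop := fun g => (∀ x, ‖g x‖ ≤ B x) ∧
    ∀ c x, dist x c < δ c → ‖g x - g c‖ ≤ L c * dist x c
  have hcont : ∀ g, P g → Continuous g := by
    intro g hg
    rw [continuous_iff_continuousAt]
    intro c
    rw [ContinuousAt, tendsto_iff_norm_sub_tendsto_zero]
    refine squeeze_zero' (Eventually.of_forall fun _ => norm_nonneg _)
      (Filter.mem_of_superset (Metric.ball_mem_nhds c (hδ c)) fun x hx => hg.2 c x hx) ?_
    have : Tendsto (fun x => L c * dist x c) (𝓝 c) (𝓝 (L c * dist c c)) :=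
      (continuous_const.mul (continuous_id.dist continuous_const)).tendsto c
    simpa using this
  set S : Set C(X, ℂ) := {g | P g}
  have himg : ContinuousMap.toFun '' S = {g | P g} := by
    ext g
    exact ⟨by rintro ⟨h, hh, rfl⟩; exact hh, fun hg => ⟨⟨g, hcont g hg⟩, hg, rfl⟩⟩
  have hcl : IsClosed {g : X → ℂ | P g} := by
    have e : {g : X → ℂ | P g} = {g | ∀ x, ‖g x‖ ≤ B x} ∩
        {g | ∀ c x, dist x c < δ c → ‖g x - g c‖ ≤ L c * dist x c} := rfl
    rw [e]
    refine IsClosed.inter ?_ ?_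
    · simp only [ofPred_forall]
      exact isClosed_iInter fun x => isClosed_le (continuous_apply x).norm continuous_const
    · simp only [ofPred_forall]
      exact isClosed_iInter fun c => isClosed_iInter fun x => isClosed_iInter fun _ =>
        isClosed_le ((continuous_apply x).sub (continuous_apply c)).norm continuous_const
  -- Both bounds in `P` survive pointwise limits, so Tychonoff gives compactness for pointwise
  -- convergence; the Lipschitz bound supplies the equicontinuity that upgrades it to locally
  -- uniform convergence.
  have hcomp : IsCompact {g : X → ℂ | P g} := by
    refine (isCompact_univ_pi fun x => isCompact_closedBall (0 : ℂ) (B x)).of_isClosed_subset hcl ?_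
    intro g hg x _
    rw [mem_closedBall_zero_iff]
    exact hg.1 x
  have hS : IsCompact S := by
    refine ArzelaAscoli.isCompact_of_equicontinuous S (by rwa [himg]) ?_
    intro c
    rw [Metric.equicontinuousAt_iff]
    intro ε hε
    refine ⟨min (δ c) (ε / (|L c| + 1)), lt_min (hδ c) (by positivity), fun x hx g => ?_⟩
    rw [dist_comm, dist_eq_norm]
    have h1 := g.2.2 c x (hx.trans_le (min_le_left _ _))
    have h2 : dist x c < ε / (|L c| + 1) := hx.trans_le (min_le_right _ _)
    rw [lt_div_iff₀ (by positivity)] at h2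
    have h3 := le_abs_self (L c)
    have h4 : 0 ≤ dist x c := dist_nonneg
    exact h1.trans_lt (by nlinarith)
  obtain ⟨g, -, φ, hφ, hlim⟩ := hS.isSeqCompact (x := f) fun n => ⟨hB n, hL n⟩
  exact ⟨φ, hφ, g, hlim⟩

/-- Montel's theorem on the unit disc. -/
theorem exists_subseq_tendstoLocallyUniformlyOn {f : ℕ → ℂ → ℂ}
    (hf : ∀ n, DifferentiableOn ℂ (f n) disc)
    (hb : ∀ ρ < 1, ∃ B : ℝ, ∀ n z, ‖z‖ ≤ ρ → ‖f n z‖ ≤ B) :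
    ∃ φ : ℕ → ℕ, StrictMono φ ∧ ∃ g : ℂ → ℂ, DifferentiableOn ℂ g disc ∧
      TendstoLocallyUniformlyOn (fun n => f (φ n)) g atTop disc := by
  classical
  have hopen : IsOpen disc := Metric.isOpen_ball
  have : LocallyCompactSpace disc := hopen.locallyCompactSpace
  have : SigmaCompactSpace disc := sigmaCompactSpace_of_locallyCompact_secondCountable
  choose! B hB using hb
  have hρ : ∀ x : disc, (1 + ‖(x : ℂ)‖) / 2 < 1 := fun x => by linarith [mem_disc.1 x.2]
  obtain ⟨φ, hφ, g, hlim⟩ := exists_subseq_tendsto_of_locally_lipschitz (X := disc)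
    (B := fun x => B ((1 + ‖(x : ℂ)‖) / 2)) (δ := fun x => (1 - ‖(x : ℂ)‖) / 2)
    (L := fun x => 2 * B ((1 + ‖(x : ℂ)‖) / 2) / ((1 - ‖(x : ℂ)‖) / 2))
    (fun x => by linarith [mem_disc.1 x.2])
    (fun n => ⟨disc.domRestrict (f n), (hf n).continuousOn.domRestrict⟩)
    (fun n x => hB _ (hρ x) n x (by linarith [mem_disc.1 x.2]))
    (fun n c x hx => by
      have hc := mem_disc.1 c.2
      have hbd : ∀ z ∈ Metric.ball (c : ℂ) ((1 - ‖(c : ℂ)‖) / 2),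
          ‖z‖ ≤ (1 + ‖(c : ℂ)‖) / 2 := fun z hz => by
        rw [Metric.mem_ball, dist_eq_norm] at hz
        linarith [norm_sub_norm_le z c]
      have hd : DifferentiableOn ℂ (f n) (Metric.ball (c : ℂ) ((1 - ‖(c : ℂ)‖) / 2)) :=
        (hf n).mono fun z hz => mem_disc.2 ((hbd z hz).trans_lt (hρ c))
      -- The Schwarz lemma turns local boundedness into a local Lipschitz bound; the values stay
      -- within `2B` of `f n c`.
      have := Complex.dist_le_div_mul_dist_of_mapsTo_ball hd
        (R₂ := 2 * B ((1 + ‖(c : ℂ)‖) / 2)) (z := (x : ℂ)) (fun z hz => by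
          rw [Metric.mem_closedBall, dist_eq_norm]
          have h1 := hB _ (hρ c) n z (hbd z hz)
          have h2 := hB _ (hρ c) n c (by linarith)
          linarith [norm_sub_le (f n z) (f n c)]) hx
      rwa [dist_eq_norm] at this)
  have hloc : TendstoLocallyUniformlyOn (fun n => f (φ n))
      (fun z => if hz : z ∈ disc then g ⟨z, hz⟩ else 0) atTop disc := by
    rw [tendstoLocallyUniformlyOn_iff_tendstoLocallyUniformly_comp_coe]
    have h1 := ContinuousMap.tendsto_iff_tendstoLocallyUniformly.1 hlim
    have e : (fun z => if hz : z ∈ disc then g ⟨z, hz⟩ else 0) ∘ ((↑) : disc → ℂ) = g := by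
      funext x
      simp
    rw [e]
    exact h1
  exact ⟨φ, hφ, _, hloc.differentiableOn (Eventually.of_forall fun n => hf _) hopen, hloc⟩

variable {ω : ℝ → ℝ}

/-- Boundedness in the Bergman space implies local boundedness. -/
theorem ClassD.exists_norm_le (h : ClassD ω) (hm : Measurable ω) {p : ℝ} (hp : 0 < p) {ρ : ℝ}
    (hρ : ρ < 1) (M : ℝ≥0) : ∃ B : ℝ, ∀ f : ℂ → ℂ, DifferentiableOn ℂ f disc →
      ∫⁻ z, ‖f z‖ₑ ^ p ∂(radialMeasure ω) ≤ M → ∀ z, ‖z‖ ≤ ρ → ‖f z‖ ≤ B := by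
  obtain ⟨C, hC, hle⟩ := h.exists_lintegral_tilde_le hm
  rcases lt_or_ge ρ 0 with h0 | h0
  · exact ⟨0, fun f _ _ z hz => by linarith [norm_nonneg z]⟩
  set R := (1 - ρ) / 2
  have hR : 0 < R := by simp only [R]; linarith
  -- A lower bound for `ω̃` on every ball of radius `R` centred in `|z| ≤ ρ`, through which the norm
  -- controls the area average.
  set δ := hat ω (ρ + R)
  have hδ : 0 < δ := h.weight.hat_pos _ ⟨by positivity, by simp only [R]; linarith⟩
  have hk : 0 < Real.pi * R ^ 2 := by have := Real.pi_pos; positivity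
  refine ⟨((M * C / (Real.pi * R ^ 2 * δ) : ℝ)) ^ (1 / p), fun f hf hfM z hz => ?_⟩
  have h1 := enorm_rpow_le_lintegral_ball (c := z) hR hp (by simp only [R]; linarith) hf
  have hsub : Metric.ball z R ⊆ disc := fun w hw => by
    rw [Metric.mem_ball, dist_eq_norm] at hw
    rw [mem_disc]
    have := norm_sub_norm_le w z
    simp only [R] at hw
    linarith
  have h2 : ENNReal.ofReal δ * ∫⁻ w in Metric.ball z R, ‖f w‖ₑ ^ p ≤ (C * M : ℝ≥0) := by
    calc ENNReal.ofReal δ * ∫⁻ w in Metric.ball z R, ‖f w‖ₑ ^ p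
        = ∫⁻ w in Metric.ball z R, ENNReal.ofReal δ * ‖f w‖ₑ ^ p := by
          rw [lintegral_const_mul' _ _ ENNReal.ofReal_ne_top]
      _ ≤ ∫⁻ w in Metric.ball z R, ENNReal.ofReal (tilde ω w) * ‖f w‖ₑ ^ p := by
          refine setLIntegral_mono' Metric.isOpen_ball.measurableSet fun w hw => ?_
          have hwd := hsub hw
          rw [Metric.mem_ball, dist_eq_norm] at hw
          have hw1 := norm_sub_norm_le w z
          have hw2 := one_sub_norm_pos hwd
          gcongr
          rw [tilde, le_div_iff₀ hw2]
          calc δ * (1 - ‖w‖) ≤ δ := mul_le_of_le_one_right hδ.le (by linarith [norm_nonneg w])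
            _ ≤ hat ω ‖w‖ := h.weight.hat_anti (norm_mem_Ico hwd).1
                (by linarith) (by simp only [R]; linarith)
      _ ≤ ∫⁻ w in disc, ENNReal.ofReal (tilde ω w) * ‖f w‖ₑ ^ p := lintegral_mono_set hsub
      _ = ∫⁻ w, ‖f w‖ₑ ^ p ∂(weighted (tilde ω)) := (h.weight.lintegral_tilde _).symm
      _ ≤ C * ∫⁻ w, ‖f w‖ₑ ^ p ∂(radialMeasure ω) := hle f p hp hf
      _ ≤ C * M := by gcongr
      _ = _ := by push_cast; rfl
  have h3 : ENNReal.ofReal (Real.pi * R ^ 2 * δ * ‖f z‖ ^ p) ≤ ENNReal.ofReal (C * M) := by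
    calc ENNReal.ofReal (Real.pi * R ^ 2 * δ * ‖f z‖ ^ p)
        = ENNReal.ofReal δ * (ENNReal.ofReal (Real.pi * R ^ 2) * ‖f z‖ₑ ^ p) := by
          rw [enorm_rpow_eq hp.le, ← ENNReal.ofReal_mul hk.le, ← ENNReal.ofReal_mul hδ.le]
          congr 1
          ring
      _ ≤ (C * M : ℝ≥0) := by
          refine le_trans ?_ h2
          gcongr
      _ = _ := by rw [← NNReal.coe_mul, ENNReal.ofReal_coe_nnreal]
  rw [ENNReal.ofReal_le_ofReal_iff (by positivity)] at h3
  rw [one_div, Real.le_rpow_inv_iff_of_pos (norm_nonneg _) (by positivity) hp,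
    le_div_iff₀ (by positivity)]
  linarith

/-- The kernel with `b = 0` is constant, so the kernel estimate with `η = 0` says that `ω̃` has
finite mass; the norm comparison for `f = 1` passes this to `ω`. -/
theorem ClassD.radialMeasure_univ_lt_top (h : ClassD ω) (hm : Measurable ω) :
    radialMeasure ω univ < ∞ := by
  obtain ⟨γ, β, hγ, -, hint⟩ := h.exists_kernel_integral
  obtain ⟨C, hC, h1⟩ := hint 0 (β + 2) hγ (by linarith)
  obtain ⟨C', -, h2⟩ := h.exists_lintegral_le_tilde hm
  have h3 := h1 0 (mem_disc.2 (by simp))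
  have h4 := h2 (fun _ => 1) 1 one_pos (differentiableOn_const _)
  simp only [norm_zero, map_zero, zero_mul, sub_zero, norm_one, div_one, Real.one_rpow, neg_zero,
    Real.rpow_zero, mul_one, ENNReal.ofReal_one, lintegral_one] at h3
  simp only [enorm_one, ENNReal.one_rpow, lintegral_one] at h4
  exact h4.trans_lt (ENNReal.mul_lt_top ENNReal.coe_lt_top (h3.trans_lt ENNReal.ofReal_lt_top))

theorem enorm_sub_rpow_le {p : ℝ} (hp : 0 < p) (x y : ℂ) :
    ‖x - y‖ₑ ^ p ≤ 2 ^ p * (‖x‖ₑ ^ p + ‖y‖ₑ ^ p) := by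
  have h1 : ‖x - y‖ₑ ≤ 2 * max ‖x‖ₑ ‖y‖ₑ := by
    refine (enorm_sub_le (a := x) (b := y)).trans ?_
    rw [two_mul]
    gcongr
    · exact le_max_left _ _
    · exact le_max_right _ _
  calc ‖x - y‖ₑ ^ p ≤ (2 * max ‖x‖ₑ ‖y‖ₑ) ^ p := by gcongr
    _ = 2 ^ p * max (‖x‖ₑ ^ p) (‖y‖ₑ ^ p) := by
        rw [ENNReal.mul_rpow_of_nonneg _ _ hp.le,
          (ENNReal.monotone_rpow_of_nonneg hp.le).map_max]
    _ ≤ _ := by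
        gcongr
        exact max_le le_self_add le_add_self

/-- Averaging functions of the parts of `μ` near the boundary tend to zero. -/
theorem tendsto_lintegral_Theta_restrict (hm : Measurable ω) {r s : ℝ} (hr : r ∈ Ioo (0 : ℝ) 1)
    (hs : 0 < s) {μ : Measure ℂ}
    (hΘ : ∫⁻ z, Theta ω μ r z ^ s ∂(weighted (tilde ω)) ≠ ∞) :
    Tendsto (fun k : ℕ => ∫⁻ z, Theta ω (μ.restrict {w | 1 - 1 / ((k : ℝ) + 1) < ‖w‖}) r z ^ s
      ∂(weighted (tilde ω))) atTop (𝓝 0) := by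
  have hac := weighted_absolutelyContinuous (tilde ω)
  have h0 : ∫⁻ _, 0 ∂(weighted (tilde ω)) = 0 := lintegral_zero
  rw [← h0]
  refine tendsto_lintegral_of_dominated_convergence' (fun z => Theta ω μ r z ^ s)
    (fun k => ((aemeasurable_Theta hm _ r).pow_const s).mono_ac hac)
    (fun k => Eventually.of_forall fun z => ?_) hΘ ?_
  · refine ENNReal.rpow_le_rpow (ENNReal.div_le_div_right ?_ _) hs.le
    exact Measure.restrict_apply_le _ _
  · filter_upwards [hac.ae_le (ae_restrict_mem measurableSet_disc)] with z hz
    have hr2 : 0 < 1 - r ^ 2 := by have := hr.1; have := hr.2; nlinarith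
    set K := 4 / (1 - r ^ 2)
    have hK : 0 < K := by positivity
    have hz' := one_sub_norm_pos hz
    -- For fixed `z` the disc `Δ(z, r)` keeps a distance at least `(1 - |z|) / K` from the unit
    -- circle, so it misses thin enough annuli: the integrand is eventually zero at `z`.
    have hev : ∀ᶠ k : ℕ in atTop, 1 / ((k : ℝ) + 1) < (1 - ‖z‖) / K :=
      tendsto_one_div_add_atTop_nhds_zero_nat.eventually_lt_const (by positivity)
    refine tendsto_const_nhds.congr' ?_
    filter_upwards [hev] with k hk
    have hempty : pseudoDisc z r ∩ {w | 1 - 1 / ((k : ℝ) + 1) < ‖w‖} = ∅ := by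
      ext w
      simp only [mem_inter_iff, mem_ofPred_eq, mem_empty_iff_false, iff_false, not_and, not_lt]
      intro hw
      have h1 := (near_of_mem_pseudoDisc hz hr hw).le_right hw.1
      have h2 : (1 - ‖z‖) / K ≤ 1 - ‖w‖ := by rwa [div_le_iff₀' hK]
      linarith
    have : Theta ω (μ.restrict {w | 1 - 1 / ((k : ℝ) + 1) < ‖w‖}) r z = 0 := by
      rw [Theta, Measure.restrict_apply (isOpen_pseudoDisc hz r).measurableSet, hempty,
        measure_empty, ENNReal.zero_div]
    rw [this, ENNReal.zero_rpow_of_pos hs]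

end

/-! ### Compactness and the equivalences -/

section

variable {ω : ℝ → ℝ}

theorem aestronglyMeasurable_of_differentiableOn {f : ℂ → ℂ} (hf : DifferentiableOn ℂ f disc)
    {μ : Measure ℂ} (hμ : μ discᶜ = 0) : AEStronglyMeasurable f μ := by
  have := hf.continuousOn.aestronglyMeasurable (μ := μ) measurableSet_disc
  rwa [restrict_disc_eq hμ] at this

theorem lintegral_le_of_bergmanNorm_le {p : ℝ} (hp : 0 < p) {f : ℂ → ℂ} {M : ℝ≥0∞}
    (hf : bergmanNorm p ω f ≤ M) : ∫⁻ z, ‖f z‖ₑ ^ p ∂(radialMeasure ω) ≤ M ^ p := by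
  rwa [bergmanNorm, eLpNorm_ofReal_eq hp, one_div, ENNReal.rpow_inv_le_iff hp] at hf

theorem lintegral_lt_top_of_mem_bergman {p : ℝ} (hp : 0 < p) {f : ℂ → ℂ} (hf : f ∈ Bergman p ω) :
    ∫⁻ z, ‖f z‖ₑ ^ p ∂(radialMeasure ω) < ∞ :=
  (lintegral_le_of_bergmanNorm_le hp le_rfl).trans_lt
    (ENNReal.rpow_lt_top_of_nonneg hp.le hf.2.2.ne)

/-- A consequence of Fatou's lemma. -/
theorem lintegral_le_of_tendsto_disc {p : ℝ} {f : ℕ → ℂ → ℂ} {g : ℂ → ℂ}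
    (hf : ∀ n, DifferentiableOn ℂ (f n) disc)
    (hlim : ∀ z ∈ disc, Tendsto (fun n => f n z) atTop (𝓝 (g z))) {M : ℝ≥0∞}
    (hM : ∀ n, ∫⁻ z, ‖f n z‖ₑ ^ p ∂(radialMeasure ω) ≤ M) :
    ∫⁻ z, ‖g z‖ₑ ^ p ∂(radialMeasure ω) ≤ M := by
  have hac : radialMeasure ω ≪ volume.restrict disc := weighted_absolutelyContinuous _
  calc ∫⁻ z, ‖g z‖ₑ ^ p ∂(radialMeasure ω)
      = ∫⁻ z, liminf (fun n => ‖f n z‖ₑ ^ p) atTop ∂(radialMeasure ω) := by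
        refine lintegral_congr_ae ?_
        filter_upwards [hac.ae_le (ae_restrict_mem measurableSet_disc)] with z hz
        exact (((ENNReal.continuous_rpow_const.comp continuous_enorm).tendsto (g z)).comp
          (hlim z hz)).liminf_eq.symm
    _ ≤ liminf (fun n => ∫⁻ z, ‖f n z‖ₑ ^ p ∂(radialMeasure ω)) atTop :=
        lintegral_liminf_le' fun n => (aemeasurable_enorm_rpow (hf n) p).mono_ac hac
    _ ≤ M := liminf_le_of_frequently_le' (Frequently.of_forall hM)

/-- The sufficiency estimate applied to `f = 1`. -/
theorem ClassD.measure_univ_lt_top (h : ClassD ω) (hm : Measurable ω) {r p q : ℝ}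
    (hr : r ∈ Ioo (0 : ℝ) 1) (hq : 0 < q) (hqp : q < p) {μ : Measure ℂ} (hμ : μ discᶜ = 0)
    (hΘ : ∫⁻ z, Theta ω μ r z ^ (p / (p - q)) ∂(weighted (tilde ω)) ≠ ∞) : μ univ < ∞ := by
  have hp : 0 < p := hq.trans hqp
  have hpq : 0 < p - q := sub_pos.2 hqp
  obtain ⟨C, -, hC⟩ := h.exists_lintegral_le_mul hm hr hq hqp
  have h1 := hC μ hμ (fun _ => 1) (differentiableOn_const _)
  simp only [enorm_one, ENNReal.one_rpow, lintegral_one] at h1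
  refine h1.trans_lt (ENNReal.mul_lt_top (ENNReal.mul_lt_top ENNReal.coe_lt_top ?_) ?_)
  · exact ENNReal.rpow_lt_top_of_nonneg (by positivity) hΘ
  · exact ENNReal.rpow_lt_top_of_nonneg (by positivity) (h.radialMeasure_univ_lt_top hm).ne

/-- Bounded sequences converging pointwise to zero tend to zero in `L^q_μ`. -/
theorem ClassD.tendsto_lintegral_zero (h : ClassD ω) (hm : Measurable ω) {r p q : ℝ}
    (hr : r ∈ Ioo (0 : ℝ) 1) (hq : 0 < q) (hqp : q < p) {μ : Measure ℂ} (hμ : μ discᶜ = 0)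
    (hΘ : ∫⁻ z, Theta ω μ r z ^ (p / (p - q)) ∂(weighted (tilde ω)) ≠ ∞) {F : ℕ → ℂ → ℂ}
    (hF : ∀ n, DifferentiableOn ℂ (F n) disc) {M : ℝ≥0}
    (hM : ∀ n, ∫⁻ z, ‖F n z‖ₑ ^ p ∂(radialMeasure ω) ≤ M)
    (hlim : ∀ z ∈ disc, Tendsto (fun n => F n z) atTop (𝓝 0)) :
    Tendsto (fun n => ∫⁻ z, ‖F n z‖ₑ ^ q ∂μ) atTop (𝓝 0) := by
  have hp : 0 < p := hq.trans hqp
  have hpq : 0 < p - q := sub_pos.2 hqp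
  obtain ⟨C, -, hC⟩ := h.exists_lintegral_le_mul hm hr hq hqp
  have hfin := h.measure_univ_lt_top hm hr hq hqp hμ hΘ
  set U : ℕ → Set ℂ := fun k => {w | 1 - 1 / ((k : ℝ) + 1) < ‖w‖}
  have hU : ∀ k, MeasurableSet (U k) := fun k => measurableSet_lt measurable_const measurable_norm
  -- The sufficiency estimate for `μ` restricted to an annulus: its contribution is small uniformly
  -- over the bounded sequence.
  have htail : Tendsto (fun k => C * (∫⁻ z, Theta ω (μ.restrict (U k)) r z ^ (p / (p - q))
      ∂(weighted (tilde ω))) ^ ((p - q) / p) * (M : ℝ≥0∞) ^ (q / p)) atTop (𝓝 0) := by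
    have h1 := tendsto_lintegral_Theta_restrict hm hr (s := p / (p - q)) (by positivity) hΘ
    have h2 := (ENNReal.continuous_rpow_const (y := (p - q) / p)).tendsto 0 |>.comp h1
    rw [ENNReal.zero_rpow_of_pos (by positivity)] at h2
    have h3 := ENNReal.Tendsto.mul_const (ENNReal.Tendsto.const_mul h2
      (Or.inr (ENNReal.coe_ne_top (r := C)))) (b := (M : ℝ≥0∞) ^ (q / p)) (Or.inr (by finiteness))
    simpa only [Function.comp_def, mul_zero, zero_mul] using h3
  -- Inside, the sequence is uniformly bounded and `μ` is finite, so dominated convergence applies.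
  have hinner : ∀ k, Tendsto (fun n => ∫⁻ z in (U k)ᶜ, ‖F n z‖ₑ ^ q ∂μ) atTop (𝓝 0) := by
    intro k
    have hρ : 1 - 1 / ((k : ℝ) + 1) < 1 := by
      have : 0 < 1 / ((k : ℝ) + 1) := by positivity
      linarith
    obtain ⟨B, hB⟩ := h.exists_norm_le hm hp hρ M
    have hUc : ∀ z ∈ (U k)ᶜ, ‖z‖ ≤ 1 - 1 / ((k : ℝ) + 1) := fun z hz =>
      not_lt.1 fun hlt => hz hlt
    have hUd : (U k)ᶜ ⊆ disc := fun z hz => mem_disc.2 ((hUc z hz).trans_lt hρ)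
    have h0 : ∫⁻ _ in (U k)ᶜ, 0 ∂μ = 0 := lintegral_zero
    rw [← h0]
    refine tendsto_lintegral_of_dominated_convergence' (fun _ => ENNReal.ofReal B ^ q)
      (fun n => (aemeasurable_enorm_rpow (hF n) q (μ := μ)).mono_measure
        (Measure.restrict_mono hUd le_rfl)) (fun n => ?_) ?_ ?_
    · refine (ae_restrict_iff' (hU k).compl).2 (Eventually.of_forall fun z hz => ?_)
      refine ENNReal.rpow_le_rpow ?_ hq.le
      rw [← ofReal_norm]
      exact ENNReal.ofReal_le_ofReal (hB _ (hF n) (hM n) z (hUc z hz))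
    · rw [setLIntegral_const]
      exact ENNReal.mul_ne_top (by finiteness)
        ((measure_mono (subset_univ _)).trans_lt hfin).ne
    · refine (ae_restrict_iff' (hU k).compl).2 (Eventually.of_forall fun z hz => ?_)
      have := ((ENNReal.continuous_rpow_const (y := q)).comp continuous_enorm).tendsto (0 : ℂ)
        |>.comp (hlim z (hUd hz))
      simpa [Function.comp_def, ENNReal.zero_rpow_of_pos hq] using this
  rw [ENNReal.tendsto_nhds_zero]
  intro ε hε
  have hε2 : 0 < ε / 2 := ENNReal.half_pos hε.ne'
  obtain ⟨k, hk⟩ := (ENNReal.tendsto_nhds_zero.1 htail (ε / 2) hε2).exists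
  filter_upwards [ENNReal.tendsto_nhds_zero.1 (hinner k) (ε / 2) hε2] with n hn
  have hμk : μ.restrict (U k) discᶜ = 0 :=
    nonpos_iff_eq_zero.1 ((Measure.restrict_apply_le _ _).trans_eq hμ)
  rw [← lintegral_add_compl _ (hU k)]
  calc _ ≤ ε / 2 + ε / 2 := by
        refine add_le_add ((hC _ hμk (F n) (hF n)).trans (le_trans ?_ hk)) hn
        gcongr
        exact hM n
    _ = ε := ENNReal.add_halves ε

theorem ClassD.memLp_of_lintegral_Theta (h : ClassD ω) (hm : Measurable ω) {r p q : ℝ}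
    (hr : r ∈ Ioo (0 : ℝ) 1) (hq : 0 < q) (hqp : q < p) {μ : Measure ℂ} (hμ : μ discᶜ = 0)
    (hΘ : ∫⁻ z, Theta ω μ r z ^ (p / (p - q)) ∂(weighted (tilde ω)) ≠ ∞) {f : ℂ → ℂ}
    (hf : f ∈ Bergman p ω) : MemLp f (ENNReal.ofReal q) μ := by
  have hp : 0 < p := hq.trans hqp
  have hpq : 0 < p - q := sub_pos.2 hqp
  obtain ⟨C, -, hC⟩ := h.exists_lintegral_le_mul hm hr hq hqp
  refine ⟨aestronglyMeasurable_of_differentiableOn hf.1 hμ, ?_⟩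
  rw [eLpNorm_ofReal_eq hq]
  refine ENNReal.rpow_lt_top_of_nonneg (by positivity) (((hC μ hμ f hf.1).trans_lt ?_).ne)
  refine ENNReal.mul_lt_top (ENNReal.mul_lt_top ENNReal.coe_lt_top ?_) ?_
  · exact ENNReal.rpow_lt_top_of_nonneg (by positivity) hΘ
  · exact ENNReal.rpow_lt_top_of_nonneg (by positivity) (lintegral_lt_top_of_mem_bergman hp hf).ne

/-- Montel provides a locally uniform limit, Fatou puts it in `A^p_ω`, and the differences form a
bounded sequence tending to zero pointwise. -/
theorem ClassD.isCompactEmbedding (h : ClassD ω) (hm : Measurable ω) {r p q : ℝ}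
    (hr : r ∈ Ioo (0 : ℝ) 1) (hq : 0 < q) (hqp : q < p) {μ : Measure ℂ} (hμ : μ discᶜ = 0)
    (hΘ : ∫⁻ z, Theta ω μ r z ^ (p / (p - q)) ∂(weighted (tilde ω)) ≠ ∞) :
    IsCompactEmbedding p q ω μ := by
  have hp : 0 < p := hq.trans hqp
  refine ⟨fun f hf => h.memLp_of_lintegral_Theta hm hr hq hqp hμ hΘ hf, ?_⟩
  rintro f hf ⟨M, hM⟩
  have hfM : ∀ n, ∫⁻ z, ‖f n z‖ₑ ^ p ∂(radialMeasure ω) ≤ (M ^ p : ℝ≥0) := fun n => by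
    rw [ENNReal.coe_rpow_of_nonneg _ hp.le]
    exact lintegral_le_of_bergmanNorm_le hp (hM n)
  obtain ⟨φ, hφ, g, hg, hlim⟩ := exists_subseq_tendstoLocallyUniformlyOn (fun n => (hf n).1)
    fun ρ hρ => by
      obtain ⟨B, hB⟩ := h.exists_norm_le hm hp hρ (M ^ p)
      exact ⟨B, fun n z hz => hB _ (hf n).1 (hfM n) z hz⟩
  have hgM := lintegral_le_of_tendsto_disc (ω := ω) (p := p) (fun n => (hf (φ n)).1)
    (fun z hz => hlim.tendsto_at hz) fun n => hfM (φ n)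
  have hgB : g ∈ Bergman p ω := by
    refine ⟨hg, aestronglyMeasurable_radialMeasure hg ω, ?_⟩
    rw [eLpNorm_ofReal_eq hp]
    exact ENNReal.rpow_lt_top_of_nonneg (by positivity) (hgM.trans_lt ENNReal.coe_lt_top).ne
  refine ⟨φ, hφ, g, h.memLp_of_lintegral_Theta hm hr hq hqp hμ hΘ hgB, ?_⟩
  have hac : radialMeasure ω ≪ volume.restrict disc := weighted_absolutelyContinuous _
  have hdiff : ∀ n, ∫⁻ z, ‖f (φ n) z - g z‖ₑ ^ p ∂(radialMeasure ω) ≤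
      (2 ^ p * (M ^ p + M ^ p) : ℝ≥0) := by
    intro n
    calc ∫⁻ z, ‖f (φ n) z - g z‖ₑ ^ p ∂(radialMeasure ω)
        ≤ ∫⁻ z, 2 ^ p * (‖f (φ n) z‖ₑ ^ p + ‖g z‖ₑ ^ p) ∂(radialMeasure ω) :=
          lintegral_mono fun z => enorm_sub_rpow_le hp _ _
      _ = 2 ^ p * (∫⁻ z, ‖f (φ n) z‖ₑ ^ p ∂(radialMeasure ω) +
            ∫⁻ z, ‖g z‖ₑ ^ p ∂(radialMeasure ω)) := by
          rw [lintegral_const_mul' _ _ (by finiteness),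
            lintegral_add_right' _ ((aemeasurable_enorm_rpow hg p).mono_ac hac)]
      _ ≤ 2 ^ p * ((M ^ p : ℝ≥0) + (M ^ p : ℝ≥0)) := by
          gcongr
          exact hfM _
      _ = _ := by
          rw [ENNReal.coe_mul, ENNReal.coe_add, ENNReal.coe_rpow_of_nonneg 2 hp.le]
          rfl
  have h0 := h.tendsto_lintegral_zero hm hr hq hqp hμ hΘ
    (F := fun n z => f (φ n) z - g z) (fun n => (hf (φ n)).1.sub hg) hdiff
    fun z hz => by simpa using (hlim.tendsto_at hz).sub_const (g z)
  have h1 := (ENNReal.continuous_rpow_const (y := 1 / q)).tendsto 0 |>.comp h0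
  rw [ENNReal.zero_rpow_of_pos (by positivity)] at h1
  simp only [eLpNorm_ofReal_eq hq]
  exact h1

/-- Otherwise the unit ball contains functions of `L^q_μ` norm exceeding every `n`, although a
convergent subsequence has bounded norms. -/
theorem IsCompactEmbedding.embeddingNorm_ne_top {p q : ℝ} {μ : Measure ℂ}
    (h : IsCompactEmbedding p q ω μ) : embeddingNorm p q ω μ ≠ ∞ := by
  intro hE
  have hex : ∀ n : ℕ, ∃ f, (f ∈ Bergman p ω ∧ bergmanNorm p ω f ≤ 1) ∧
      (n : ℝ≥0∞) < eLpNorm f (ENNReal.ofReal q) μ := by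
    intro n
    have h1 : (n : ℝ≥0∞) < embeddingNorm p q ω μ := by
      rw [hE]
      exact ENNReal.natCast_lt_top n
    obtain ⟨f, hf⟩ := lt_iSup_iff.1 h1
    obtain ⟨hf1, hf2⟩ := lt_iSup_iff.1 hf
    exact ⟨f, hf1, hf2⟩
  choose f hf hfn using hex
  obtain ⟨φ, hφ, g, hg, hlim⟩ := h.2 f (fun n => (hf n).1) ⟨1, fun n => (hf n).2⟩
  -- The quasi-triangle constant, needed because `q < 1` is allowed.
  set K := ENNReal.LpAddConst (ENNReal.ofReal q)
  have hK : K < ∞ := ENNReal.LpAddConst_lt_top _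
  set G := K * (1 + eLpNorm g (ENNReal.ofReal q) μ)
  have hG : G ≠ ∞ :=
    ENNReal.mul_ne_top hK.ne (ENNReal.add_ne_top.2 ⟨ENNReal.one_ne_top, hg.2.ne⟩)
  obtain ⟨m, hm⟩ := ENNReal.exists_nat_gt hG
  obtain ⟨n, hn1, hn2⟩ := ((ENNReal.tendsto_nhds_zero.1 hlim 1 one_pos).and
    (eventually_ge_atTop m)).exists
  have h1 := h.1 _ (hf (φ n)).1
  have h2 : eLpNorm (f (φ n)) (ENNReal.ofReal q) μ ≤ G := by
    have h3 := eLpNorm_add_le' (f := fun z => f (φ n) z - g z) (h1.1.sub hg.1) hg.1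
      (ENNReal.ofReal q)
    have e : (fun z => f (φ n) z - g z) + g = f (φ n) := by
      ext z
      simp
    rw [e] at h3
    refine h3.trans ?_
    simp only [G, K]
    gcongr
  have h4 : (m : ℝ≥0∞) ≤ φ n := Nat.cast_le.2 (hn2.trans (hφ.id_le n))
  exact absurd (h4.trans_lt (hfn (φ n))) (not_lt.2 (h2.trans hm.le))

theorem IsCarleson.embeddingNorm_ne_top {p q : ℝ} {μ : Measure ℂ} (h : IsCarleson p q ω μ) :
    embeddingNorm p q ω μ ≠ ∞ := by
  obtain ⟨C, hC⟩ := h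
  refine (lt_of_le_of_lt (iSup₂_le fun f hf => ?_) (ENNReal.coe_lt_top (r := C))).ne
  refine (hC f hf.1).2.trans ?_
  exact mul_le_of_le_one_right' hf.2

theorem ClassD.isCarleson (h : ClassD ω) (hm : Measurable ω) {r p q : ℝ}
    (hr : r ∈ Ioo (0 : ℝ) 1) (hq : 0 < q) (hqp : q < p) {μ : Measure ℂ} (hμ : μ discᶜ = 0)
    (hΘ : ∫⁻ z, Theta ω μ r z ^ (p / (p - q)) ∂(weighted (tilde ω)) ≠ ∞) :
    IsCarleson p q ω μ := by
  have hp : 0 < p := hq.trans hqp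
  have hpq : 0 < p - q := sub_pos.2 hqp
  obtain ⟨C, -, hC⟩ := h.exists_lintegral_le_mul hm hr hq hqp
  set D : ℝ≥0∞ := C * (∫⁻ z, Theta ω μ r z ^ (p / (p - q)) ∂(weighted (tilde ω))) ^ ((p - q) / p)
  have hD : D ≠ ∞ := ENNReal.mul_ne_top ENNReal.coe_ne_top
    (ENNReal.rpow_lt_top_of_nonneg (by positivity) hΘ).ne
  have hD' : D ^ (1 / q) ≠ ∞ := (ENNReal.rpow_lt_top_of_nonneg (by positivity) hD).ne
  refine ⟨(D ^ (1 / q)).toNNReal, fun f hf =>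
    ⟨h.memLp_of_lintegral_Theta hm hr hq hqp hμ hΘ hf, ?_⟩⟩
  rw [ENNReal.coe_toNNReal hD', bergmanNorm, eLpNorm_ofReal_eq hq, eLpNorm_ofReal_eq hp]
  calc (∫⁻ z, ‖f z‖ₑ ^ q ∂μ) ^ (1 / q)
      ≤ (D * (∫⁻ z, ‖f z‖ₑ ^ p ∂(radialMeasure ω)) ^ (q / p)) ^ (1 / q) := by
        gcongr
        exact hC μ hμ f hf.1
    _ = _ := by
        rw [ENNReal.mul_rpow_of_nonneg _ _ (by positivity), ← ENNReal.rpow_mul]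
        congr 2
        field_simp

theorem ClassD.exists_embeddingNorm_rpow_le (h : ClassD ω) (hm : Measurable ω) {r p q : ℝ}
    (hr : r ∈ Ioo (0 : ℝ) 1) (hq : 0 < q) (hqp : q < p) : ∃ C : ℝ≥0, 0 < C ∧
      ∀ μ : Measure ℂ, μ discᶜ = 0 → embeddingNorm p q ω μ ^ q ≤
        C * (∫⁻ z, Theta ω μ r z ^ (p / (p - q)) ∂(weighted (tilde ω))) ^ ((p - q) / p) := by
  have hp : 0 < p := hq.trans hqp
  obtain ⟨C, hC0, hC⟩ := h.exists_lintegral_le_mul hm hr hq hqp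
  refine ⟨C, hC0, fun μ hμ => ?_⟩
  rw [← ENNReal.le_rpow_inv_iff hq]
  refine iSup₂_le fun f hf => ?_
  rw [eLpNorm_ofReal_eq hq, one_div]
  gcongr
  refine (hC μ hμ f hf.1.1).trans (mul_le_of_le_one_right' ?_)
  refine ENNReal.rpow_le_one ?_ (by positivity)
  have := lintegral_le_of_bergmanNorm_le hp hf.2
  rwa [ENNReal.one_rpow] at this

theorem eLpNorm_Theta {p q : ℝ} (hq : 0 < q) (hqp : q < p) (ω : ℝ → ℝ) (μ ν : Measure ℂ) (r : ℝ) :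
    eLpNorm (Theta ω μ r) (ENNReal.ofReal (p / (p - q))) ν =
      (∫⁻ z, Theta ω μ r z ^ (p / (p - q)) ∂ν) ^ ((p - q) / p) := by
  have hp : 0 < p := hq.trans hqp
  have hpq : 0 < p - q := sub_pos.2 hqp
  rw [eLpNorm_ofReal_eq (by positivity), one_div_div]
  rfl

theorem memLp_Theta_iff (hm : Measurable ω) {p q : ℝ} (hq : 0 < q) (hqp : q < p) (μ : Measure ℂ)
    (r : ℝ) : MemLp (Theta ω μ r) (ENNReal.ofReal (p / (p - q))) (weighted (tilde ω)) ↔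
      ∫⁻ z, Theta ω μ r z ^ (p / (p - q)) ∂(weighted (tilde ω)) ≠ ∞ := by
  have hp : 0 < p := hq.trans hqp
  have hpq : 0 < p - q := sub_pos.2 hqp
  have hmeas : AEStronglyMeasurable (Theta ω μ r) (weighted (tilde ω)) :=
    ((aemeasurable_Theta hm μ r).mono_ac (weighted_absolutelyContinuous _)).aestronglyMeasurable
  rw [MemLp, and_iff_right hmeas, eLpNorm_Theta hq hqp, lt_top_iff_ne_top, Ne, Ne,
    ENNReal.rpow_eq_top_iff_of_pos (by positivity)]

/-- The theorem for a weight with measurable profile. -/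
theorem carleson_theorem_of_measurable (p q : ℝ) (hq : 0 < q) (hqp : q < p) (hω : ClassD ω)
    (hm : Measurable ω) :
    (∀ μ : Measure ℂ, μ discᶜ = 0 →
      (IsCarleson p q ω μ ↔ IsCompactEmbedding p q ω μ) ∧
      (IsCarleson p q ω μ ↔ ∃ r ∈ Ioo (0 : ℝ) 1,
        MemLp (Theta ω μ r) (ENNReal.ofReal (p / (p - q))) (weighted (tilde ω))) ∧
      (IsCarleson p q ω μ ↔ ∀ r ∈ Ioo (0 : ℝ) 1,
        MemLp (Theta ω μ r) (ENNReal.ofReal (p / (p - q))) (weighted (tilde ω)))) ∧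
    (∀ r ∈ Ioo (0 : ℝ) 1, ∃ C : ℝ≥0, 0 < C ∧ ∀ μ : Measure ℂ, μ discᶜ = 0 →
      embeddingNorm p q ω μ ^ q ≤
        C * eLpNorm (Theta ω μ r) (ENNReal.ofReal (p / (p - q))) (weighted (tilde ω)) ∧
      eLpNorm (Theta ω μ r) (ENNReal.ofReal (p / (p - q))) (weighted (tilde ω)) ≤
        C * embeddingNorm p q ω μ ^ q) := by
  have hp : 0 < p := hq.trans hqp
  have hpq : 0 < p - q := sub_pos.2 hqp
  refine ⟨fun μ hμ => ?_, fun r hr => ?_⟩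
  · simp only [memLp_Theta_iff hm hq hqp]
    -- The hub of all equivalences: boundedness and compactness each make the embedding norm finite,
    -- which gives integrability for every `r`, and any one `r` gives both back.
    have hall : embeddingNorm p q ω μ ≠ ∞ → ∀ r ∈ Ioo (0 : ℝ) 1,
        ∫⁻ z, Theta ω μ r z ^ (p / (p - q)) ∂(weighted (tilde ω)) ≠ ∞ := by
      intro hE r hr htop
      obtain ⟨C, -, hC⟩ := hω.exists_lintegral_Theta_le hm hr hq hqp
      have h1 := hC μ hμ
      rw [htop, ENNReal.top_rpow_of_pos (by positivity), top_le_iff] at h1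
      exact ENNReal.mul_ne_top ENNReal.coe_ne_top (by finiteness) h1
    have hhalf : (1 / 2 : ℝ) ∈ Ioo (0 : ℝ) 1 := by norm_num
    refine ⟨⟨fun h => ?_, fun h => ?_⟩, ⟨fun h => ?_, ?_⟩, ⟨fun h => ?_, fun h => ?_⟩⟩
    · exact hω.isCompactEmbedding hm hhalf hq hqp hμ (hall h.embeddingNorm_ne_top _ hhalf)
    · exact hω.isCarleson hm hhalf hq hqp hμ (hall h.embeddingNorm_ne_top _ hhalf)
    · exact ⟨_, hhalf, hall h.embeddingNorm_ne_top _ hhalf⟩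
    · rintro ⟨r, hr, h⟩
      exact hω.isCarleson hm hr hq hqp hμ h
    · exact hall h.embeddingNorm_ne_top
    · exact hω.isCarleson hm hhalf hq hqp hμ (h _ hhalf)
  · obtain ⟨C₁, hC₁, h₁⟩ := hω.exists_embeddingNorm_rpow_le hm hr hq hqp
    obtain ⟨C₂, hC₂, h₂⟩ := hω.exists_lintegral_Theta_le hm hr hq hqp
    refine ⟨C₁ + C₂, by positivity, fun μ hμ => ?_⟩
    rw [eLpNorm_Theta hq hqp]
    constructor
    · refine (h₁ μ hμ).trans ?_
      gcongr
      exact le_self_add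
    · refine (h₂ μ hμ).trans ?_
      gcongr
      exact le_add_self

end

/-! ### Passage to a Borel measurable profile -/

/-- The class `𝒟` only depends on the almost everywhere class of the profile. -/
theorem ClassD.congr {ω ω' : ℝ → ℝ} (h : ClassD ω) (h0 : ∀ s, 0 ≤ ω' s)
    (hae : ω' =ᵐ[volume.restrict (Ico (0 : ℝ) 1)] ω) : ClassD ω' := by
  have hhat : ∀ r ∈ Ico (0 : ℝ) 1, hat ω' r = hat ω r := fun r hr => hat_congr hae hr
  refine ⟨⟨fun s _ => h0 s, h.weight.integrable.congr_fun_ae hae.symm, fun r hr => ?_⟩, ?_, ?_⟩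
  · rw [hhat r hr]
    exact h.weight.hat_pos r hr
  · obtain ⟨C, hC, hup⟩ := h.upper
    refine ⟨C, hC, fun r hr => ?_⟩
    rw [hhat r hr, hhat _ ⟨by linarith [hr.1], by linarith [hr.2]⟩]
    exact hup r hr
  · obtain ⟨K, C, hK, hC, hlow⟩ := h.lower
    refine ⟨K, C, hK, hC, fun r hr => ?_⟩
    rw [hhat r hr, hhat _ (one_sub_div_mem hr hK.le)]
    exact hlow r hr

end DoublingBergman

end

theorem theorem2 (p q : ℝ) (hq : 0 < q) (hqp : q < p) (ω : ℝ → ℝ)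
    (hω : DoublingBergman.ClassD ω) :
    (∀ μ : Measure ℂ, μ DoublingBergman.discᶜ = 0 →
      (DoublingBergman.IsCarleson p q ω μ ↔ DoublingBergman.IsCompactEmbedding p q ω μ) ∧
      (DoublingBergman.IsCarleson p q ω μ ↔
        ∃ r ∈ Ioo (0 : ℝ) 1, MemLp (DoublingBergman.Theta ω μ r) (ENNReal.ofReal (p / (p - q)))
          (DoublingBergman.weighted (DoublingBergman.tilde ω))) ∧
      (DoublingBergman.IsCarleson p q ω μ ↔
        ∀ r ∈ Ioo (0 : ℝ) 1, MemLp (DoublingBergman.Theta ω μ r) (ENNReal.ofReal (p / (p - q)))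
          (DoublingBergman.weighted (DoublingBergman.tilde ω)))) ∧
    (∀ r ∈ Ioo (0 : ℝ) 1, ∃ C : ℝ≥0, 0 < C ∧
      ∀ μ : Measure ℂ, μ DoublingBergman.discᶜ = 0 →
        DoublingBergman.embeddingNorm p q ω μ ^ q ≤
          C * eLpNorm (DoublingBergman.Theta ω μ r) (ENNReal.ofReal (p / (p - q)))
            (DoublingBergman.weighted (DoublingBergman.tilde ω)) ∧
        eLpNorm (DoublingBergman.Theta ω μ r) (ENNReal.ofReal (p / (p - q)))
            (DoublingBergman.weighted (DoublingBergman.tilde ω)) ≤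
          C * DoublingBergman.embeddingNorm p q ω μ ^ q) := by
  -- Every object in the statement depends on the profile only through its almost everywhere class
  -- on `[0, 1)`, so a Borel nonnegative representative may be used.
  obtain ⟨ω', hm, h0, hae⟩ := hω.weight.exists_measurable
  have hrad := DoublingBergman.radialMeasure_congr hae
  have htil : DoublingBergman.weighted (DoublingBergman.tilde ω') =
      DoublingBergman.weighted (DoublingBergman.tilde ω) :=
    DoublingBergman.weighted_congr ((ae_restrict_iff' DoublingBergman.measurableSet_disc).2
      (Eventually.of_forall fun z hz => by
        simp only [DoublingBergman.tilde,
          DoublingBergman.hat_congr hae (DoublingBergman.norm_mem_Ico hz)]))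
  have hΘ : DoublingBergman.Theta ω' = DoublingBergman.Theta ω := by
    funext μ r z
    simp only [DoublingBergman.Theta, hrad]
  have hE : DoublingBergman.embeddingNorm p q ω' = DoublingBergman.embeddingNorm p q ω := by
    funext μ
    simp only [DoublingBergman.embeddingNorm, DoublingBergman.bergmanNorm,
      DoublingBergman.Bergman, hrad]
  have hC : DoublingBergman.IsCarleson p q ω' = DoublingBergman.IsCarleson p q ω := by
    funext μ
    simp only [DoublingBergman.IsCarleson, DoublingBergman.bergmanNorm,
      DoublingBergman.Bergman, hrad]
  have hK : DoublingBergman.IsCompactEmbedding p q ω' =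
      DoublingBergman.IsCompactEmbedding p q ω := by
    funext μ
    simp only [DoublingBergman.IsCompactEmbedding, DoublingBergman.bergmanNorm,
      DoublingBergman.Bergman, hrad]
  have key := DoublingBergman.carleson_theorem_of_measurable p q hq hqp (hω.congr h0 hae) hm
  rwa [htil, hΘ, hE, hC, hK] at key
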